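/- There are a fixed program $P$ for the word RAM and a constant $C$ such that the following holds. Let $\mathcal A=(A,+,\times,a_1,\dots,a_k)$ be any semiring with finitely many constants, where only the following is assumed: $(A,+)$ is a commutative semigroup, $(A,\times)$ is a semigroup, and both distributive laws hold ($\times$ need not be commutative, and neither operation need have an identity element). An arithmetic circuit $\mathcal G$ over $\mathcal A$ is a finite acyclic circuit with one output gate in which every gate is one of the constant symbols $a_1,\dots,a_k$ or a sum or product of an ordered pair of (not necessarily distinct) gates. Its size $|\mathcal G|$ is the number of its wires, its derivation tree $t$ is the tree obtained by unfolding $\mathcal G$ from the output gate, its depth is the depth (in edges) of $t$, and its value is the value of $t$ in $\mathcal A$. Given an arithmetic circuit $\mathcal G$ over $\mathcal A$ whose derivation tree has $n$ nodes, $P$ computes from $\mathcal G$, in at most $C\,(|\mathcal G|+1)$ steps, an arithmetic circuit $\mathcal H$ over $\mathcal A$ with the same value as $\mathcal G$ and with $$|\mathcal H|\le C\,|\mathcal G|,\qquad \operatorname{depth}(\mathcal H)\le C\,\lfloor\log_2 n\rfloor .$$ Here the word RAM has words of $w$ bits for an arbitrary $w$ with $2^w\ge C\,(n+m+k)$, where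 $m$ is the number of gates of $\mathcal G$ (so that $n$, the gate numbers and the constant symbols fit into a word). It performs $+$, truncated $-$, $\times$, integer division, comparisons, and indirect loads and stores on words in one step each. The input is given as the list of the gates of $\mathcal G$, in any order, together with the number of gates and the number of the output gate; all other memory cells initially contain $0$. -/

import Mathlib

/-! ### Arithmetic circuits with `k` constants -/

/-- A gate of a circuit whose gates are numbered by `Fin m` and whose constant symbols are numbered
by `Fin k`: an input gate carrying a constant symbol, or a binary sum or product of two gates. -/
inductive Gate (k m : ℕ) : Type
  | const (c : Fin k) : Gate k m
  | add (x y : Fin m) : Gate k m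
  | mul (x y : Fin m) : Gate k m

/-- The gates that feed a gate, from left to right. -/
def Gate.inputs {k m : ℕ} : Gate k m → List (Fin m)
  | .const _ => []
  | .add x y => [x, y]
  | .mul x y => [x, y]

/-- An arithmetic circuit over `+`, `*` and `k` constant symbols: finitely many gates, in any order,
with one output gate, such that the wiring relation has no directed cycle. -/
structure Circuit (k : ℕ) : Type where
  numGates : ℕ
  gate : Fin numGates → Gate k numGates
  out : Fin numGates
  acyclic : ∀ x, ¬ Relation.TransGen (fun y z => y ∈ (gate z).inputs) x x

/-- Expressions built from constant symbols with `+` and `*`. They are finite ordered binary trees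
with labelled nodes. -/
inductive ArithTree (k : ℕ) : Type
  | const (c : Fin k) : ArithTree k
  | add (s t : ArithTree k) : ArithTree k
  | mul (s t : ArithTree k) : ArithTree k

namespace ArithTree

variable {k : ℕ}

/-- The number of nodes of the tree. -/
def numNodes : ArithTree k → ℕ
  | const _ => 1
  | add s t => 1 + s.numNodes + t.numNodes
  | mul s t => 1 + s.numNodes + t.numNodes

/-- The maximal number of edges on a path from the root to a leaf. -/
def depth : ArithTree k → ℕ
  | const _ => 0
  | add s t => 1 + max s.depth t.depth
  | mul s t => 1 + max s.depth t.depth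

/-- The value of the expression when the constant symbol `c` is interpreted as `a c`. -/
def eval {A : Type*} [Add A] [Mul A] (a : Fin k → A) : ArithTree k → A
  | const c => a c
  | add s t => s.eval a + t.eval a
  | mul s t => s.eval a * t.eval a

end ArithTree

namespace Circuit

variable {k : ℕ}

theorem wellFounded (G : Circuit k) :
    WellFounded (fun y z : Fin G.numGates => y ∈ (G.gate z).inputs) := by
  have h : WellFounded (Relation.TransGen fun y z => y ∈ (G.gate z).inputs) := by
    have : Std.Irrefl (Relation.TransGen fun y z => y ∈ (G.gate z).inputs) := ⟨G.acyclic⟩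
    exact Finite.wellFounded_of_trans_of_irrefl _
  exact Subrelation.wf (fun h => Relation.TransGen.single h) h

/-- The tree obtained by unfolding the circuit from the gate `x`. -/
noncomputable def unfoldAt (G : Circuit k) : Fin G.numGates → ArithTree k :=
  G.wellFounded.fix fun x rec =>
    match h : G.gate x with
    | .const c => .const c
    | .add y z => .add (rec y (by simp [h, Gate.inputs])) (rec z (by simp [h, Gate.inputs]))
    | .mul y z => .mul (rec y (by simp [h, Gate.inputs])) (rec z (by simp [h, Gate.inputs]))

theorem unfoldAt_eq (G : Circuit k) (x : Fin G.numGates) :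
    G.unfoldAt x = match G.gate x with
      | .const c => .const c
      | .add y z => .add (G.unfoldAt y) (G.unfoldAt z)
      | .mul y z => .mul (G.unfoldAt y) (G.unfoldAt z) := by
  rw [unfoldAt, WellFounded.fix_eq]
  split <;> rename_i h <;> simp [h]

/-- The unfolding (derivation tree) of the circuit. -/
noncomputable def unfolding (G : Circuit k) : ArithTree k := G.unfoldAt G.out

/-- The value computed by the circuit. -/
noncomputable def value {A : Type*} [Add A] [Mul A] (a : Fin k → A) (G : Circuit k) : A :=
  G.unfolding.eval a

/-- The size of the circuit: the number of its wires. -/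
def size (G : Circuit k) : ℕ := ∑ x, (G.gate x).inputs.length

/-- The depth of the circuit: the depth of its unfolding. -/
noncomputable def depth (G : Circuit k) : ℕ := G.unfolding.depth

end Circuit

/-! ### A random access machine with words of `w` bits -/

namespace RAM

/-- The arithmetic operations; subtraction is truncated at `0` and division rounds down. -/
inductive Op : Type
  | add | sub | mul | div

def Op.eval : Op → ℕ → ℕ → ℕ
  | .add, x, y => x + y
  | .sub, x, y => x - y
  | .mul, x, y => x * y
  | .div, x, y => x / y

/-- A test comparing the contents of two registers. -/
inductive Test : Type
  | lt (i j : ℕ) : Test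
  | eq (i j : ℕ) : Test

/-- Programs. A program mentions finitely many registers, by their numbers. -/
inductive Prog : Type
  | skip : Prog
  /-- `R[d] := c` -/
  | imm (d c : ℕ) : Prog
  /-- `R[d] := R[i] o R[j]` -/
  | op (o : Op) (d i j : ℕ) : Prog
  /-- `R[d] := M[R[i]]` -/
  | load (d i : ℕ) : Prog
  /-- `M[R[i]] := R[j]` -/
  | store (i j : ℕ) : Prog
  | seq (p q : Prog) : Prog
  | ite (b : Test) (p q : Prog) : Prog
  | loop (b : Test) (p : Prog) : Prog

/-- The contents of the registers and of the memory cells. -/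
structure State : Type where
  reg : ℕ → ℕ
  mem : ℕ → ℕ

def Test.Holds (s : State) : Test → Prop
  | .lt i j => s.reg i < s.reg j
  | .eq i j => s.reg i = s.reg j

/-- `Exec w p s t s'`: on a machine with words of `w` bits, the program `p` started in the state `s`
halts in the state `s'` after `t` steps. Every assignment, memory access and test is one step.
An arithmetic operation (or constant) whose result does not fit into a word cannot be executed, so
no number outside `[0, 2 ^ w)` is ever written to a register, or used as an address. -/
inductive Exec (w : ℕ) : Prog → State → ℕ → State → Prop
  | skip (s : State) : Exec w .skip s 1 s
  | imm (s : State) (d c : ℕ) (h : c < 2 ^ w) :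
      Exec w (.imm d c) s 1 { s with reg := Function.update s.reg d c }
  | op (s : State) (o : Op) (d i j : ℕ) (h : o.eval (s.reg i) (s.reg j) < 2 ^ w) :
      Exec w (.op o d i j) s 1
        { s with reg := Function.update s.reg d (o.eval (s.reg i) (s.reg j)) }
  | load (s : State) (d i : ℕ) :
      Exec w (.load d i) s 1 { s with reg := Function.update s.reg d (s.mem (s.reg i)) }
  | store (s : State) (i j : ℕ) :
      Exec w (.store i j) s 1 { s with mem := Function.update s.mem (s.reg i) (s.reg j) }
  | seq {p q : Prog} {s₁ s₂ s₃ : State} {t₁ t₂ : ℕ} (hp : Exec w p s₁ t₁ s₂)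
      (hq : Exec w q s₂ t₂ s₃) : Exec w (.seq p q) s₁ (t₁ + t₂) s₃
  | ite_true {b : Test} {p q : Prog} {s s' : State} {t : ℕ} (hb : b.Holds s)
      (hp : Exec w p s t s') : Exec w (.ite b p q) s (1 + t) s'
  | ite_false {b : Test} {p q : Prog} {s s' : State} {t : ℕ} (hb : ¬ b.Holds s)
      (hq : Exec w q s t s') : Exec w (.ite b p q) s (1 + t) s'
  | loop_false {b : Test} {p : Prog} {s : State} (hb : ¬ b.Holds s) :
      Exec w (.loop b p) s 1 s
  | loop_true {b : Test} {p : Prog} {s₁ s₂ s₃ : State} {t₁ t₂ : ℕ} (hb : b.Holds s₁)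
      (hp : Exec w p s₁ t₁ s₂) (hl : Exec w (.loop b p) s₂ t₂ s₃) :
      Exec w (.loop b p) s₁ (1 + t₁ + t₂) s₃

end RAM

/-! ### Circuits as inputs and outputs of the machine -/

/-- A gate is described by three consecutive words: a tag and two arguments. -/
def Gate.StoredAt {k m : ℕ} (g : Gate k m) (mem : ℕ → ℕ) (b : ℕ) : Prop :=
  match g with
  | .const c => mem b = 1 ∧ mem (b + 1) = c ∧ mem (b + 2) = 0
  | .add x y => mem b = 2 ∧ mem (b + 1) = x ∧ mem (b + 2) = y
  | .mul x y => mem b = 3 ∧ mem (b + 1) = x ∧ mem (b + 2) = y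

/-- The description of the circuit, namely the number of gates, the output gate and then the list of
gates, is written in the memory from the address `b` on. -/
def Circuit.StoredAt {k : ℕ} (G : Circuit k) (mem : ℕ → ℕ) (b : ℕ) : Prop :=
  mem b = G.numGates ∧ mem (b + 1) = G.out ∧
    ∀ x : Fin G.numGates, (G.gate x).StoredAt mem (b + 2 + 3 * x)

/-- The initial state on the input `G`: the description of `G` is written in the memory from the
address `0` on, and all other memory cells and all registers contain `0`. -/
def RAM.State.IsInitial {k : ℕ} (s : RAM.State) (G : Circuit k) : Prop :=
  (∀ i, s.reg i = 0) ∧ G.StoredAt s.mem 0 ∧ ∀ i, 2 + 3 * G.numGates ≤ i → s.mem i = 0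

/-- The state `s` outputs `H`: register `0` holds an address from which on the description of `H`
is written in the memory. -/
def RAM.State.Outputs {k : ℕ} (s : RAM.State) (H : Circuit k) : Prop :=
  H.StoredAt s.mem (s.reg 0)

/-! Let `T u` be the number of paths from the output gate to `u` and `bot u` the number of nodes of
the tree unfolded at `u`, and round both down to powers of two. An edge from `u` to an argument is
heavy if both ends have the same pair of rounded numbers. A node has at most one heavy argument,
since two would double `bot` (`not_sameClass_light`), and it is the heavy argument of at most one
node, since two would double `T` (`heavy_injective`). Hence the heavy edges form disjoint paths.
Along every edge `T` does not decrease and `bot` does not increase, along a light edge one of their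
logarithms changes, and `T u * bot u ≤ n`; so a walk from the root meets only O(log n) light edges.

On a heavy path the value of a node is an affine function `x ↦ α x β + γ` of the value of its heavy
argument, and the value of the light argument is the only coefficient. Such functions are closed
under composition by the distributive and associative laws (`Acts.comp`); as there need be no `0`
and no `1`, coefficients may be absent. It remains to evaluate all suffixes of a path with linearly
many compositions and with a depth that telescopes over the light edges.

A path is processed from its end upwards and kept as a stack of blocks whose weights at least double
from each block to the next. A new node absorbs blocks as long as the next one weighs less than
twice the weight collected so far (`PopInv.step`, `PopInv.finish`). The weight of a node measures
the light edges that enter and leave the path there, and the total weight of a path is below `4 * pw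
T * pw bot` (`Setup.weight_sum_lt`). A light edge of weight `q` then costs a depth of about
log(total/q), which is paid for by the change of the two logarithms along it (`Setup.light_depth`).
A block is absorbed at most once because the paths are disjoint (`CountInv.le`), so size and running
time are linear.

The machine enters through a small program logic. A depth-first search numbers the reachable gates,
`bot` and `T` are summed up and down this order, and the rounded values are maintained along with
the sums (`pw_combine`), so that no logarithm is ever computed. -/

set_option linter.unusedSimpArgs false
set_option linter.unusedSectionVars false
set_option linter.unnecessarySimpa false

/-! ### A machine with arrays, implemented on the word RAM. -/

namespace RAM

/-- A machine with words of `w` bits on an input with `m` gates, stored in the cells below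
`2 + 3 * m`. -/
structure Env where
  w : ℕ
  m : ℕ
  inp : ℕ → ℕ
  bound : 1000 * (m + 1) ≤ 2 ^ w

@[simp] theorem Env.w_ne_zero (E : Env) : E.w ≠ 0 := by
  intro h
  have := E.bound
  rw [h] at this
  omega

/-- An abstract view of the machine: registers, arrays `fld f` with `m` entries, and a list of
gates that is written to the output. -/
structure AState where
  reg : ℕ → ℕ
  fld : ℕ → ℕ → ℕ
  out : List (ℕ × ℕ × ℕ)

/-- The concrete state `s` represents the abstract state `σ`. The registers below `8` are reserved
for the base addresses and for address computations. -/
structure Rel (E : Env) (s : State) (σ : AState) : Prop where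
  reg : ∀ v, s.reg (v + 8) = σ.reg v
  zero : s.reg 6 = 0
  base : s.reg 3 = 2 + 3 * E.m
  obase : s.reg 4 = 4 + 20 * E.m
  cnt : s.reg 5 = σ.out.length
  inp : ∀ a < 2 + 3 * E.m, s.mem a = E.inp a
  fld : ∀ f < 17, ∀ i < E.m, s.mem (2 + 3 * E.m + (17 * i + f)) = σ.fld f i
  out : ∀ j t x y, σ.out[j]? = some (t, x, y) → s.mem (4 + 20 * E.m + 3 * j) = t ∧
    s.mem (4 + 20 * E.m + 3 * j + 1) = x ∧ s.mem (4 + 20 * E.m + 3 * j + 1 + 1) = y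

/-- Abstract instructions. -/
inductive Instr
  /-- `d := c` -/
  | imm (d c : ℕ)
  /-- `d := i` -/
  | mov (d i : ℕ)
  /-- `d := i o j` -/
  | op (o : Op) (d i j : ℕ)
  /-- `d := fld f i` -/
  | get (d f i : ℕ)
  /-- `fld f i := j` -/
  | put (f i j : ℕ)
  /-- `d :=` component `e` of the input gate `i` -/
  | inp (d e i : ℕ)
  /-- append the gate with tag `t` and arguments `i`, `j` to the output, let `d` be its number -/
  | emit (d t i j : ℕ)

namespace Instr

def code : Instr → Prog
  | imm d c => .imm (d + 8) c
  | mov d i => .seq (.imm 1 0) (.op .add (d + 8) (i + 8) 1)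
  | op o d i j => .op o (d + 8) (i + 8) (j + 8)
  | get d f i => .seq (.imm 1 17) (.seq (.op .mul 1 1 (i + 8)) (.seq (.imm 2 f)
      (.seq (.op .add 1 1 2) (.seq (.op .add 1 3 1) (.load (d + 8) 1)))))
  | put f i j => .seq (.imm 1 17) (.seq (.op .mul 1 1 (i + 8)) (.seq (.imm 2 f)
      (.seq (.op .add 1 1 2) (.seq (.op .add 1 3 1) (.store 1 (j + 8))))))
  | inp d e i => .seq (.imm 1 3) (.seq (.op .mul 1 1 (i + 8)) (.seq (.imm 2 (2 + e))
      (.seq (.op .add 1 1 2) (.load (d + 8) 1))))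
  | emit d t i j => .seq (.imm 1 3) (.seq (.op .mul 1 1 5) (.seq (.op .add 1 4 1)
      (.seq (.imm 2 t) (.seq (.store 1 2) (.seq (.imm 2 1) (.seq (.op .add 1 1 2)
      (.seq (.store 1 (i + 8)) (.seq (.op .add 1 1 2) (.seq (.store 1 (j + 8))
      (.seq (.imm 1 0) (.seq (.op .add (d + 8) 5 1) (.op .add 5 5 2))))))))))))

def cost : Instr → ℕ
  | imm _ _ => 1
  | mov _ _ => 2
  | op _ _ _ _ => 1
  | get _ _ _ => 6
  | put _ _ _ => 6
  | inp _ _ _ => 5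
  | emit _ _ _ _ => 13

def step (E : Env) : Instr → AState → AState
  | imm d c, σ => ⟨Function.update σ.reg d c, σ.fld, σ.out⟩
  | mov d i, σ => ⟨Function.update σ.reg d (σ.reg i), σ.fld, σ.out⟩
  | op o d i j, σ => ⟨Function.update σ.reg d (o.eval (σ.reg i) (σ.reg j)), σ.fld, σ.out⟩
  | get d f i, σ => ⟨Function.update σ.reg d (σ.fld f (σ.reg i)), σ.fld, σ.out⟩
  | put f i j, σ =>
    ⟨σ.reg, Function.update σ.fld f (Function.update (σ.fld f) (σ.reg i) (σ.reg j)), σ.out⟩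
  | inp d e i, σ => ⟨Function.update σ.reg d (E.inp (2 + 3 * σ.reg i + e)), σ.fld, σ.out⟩
  | emit d t i j, σ =>
    ⟨Function.update σ.reg d σ.out.length, σ.fld, σ.out ++ [(t, σ.reg i, σ.reg j)]⟩

def Ok (E : Env) : Instr → AState → Prop
  | imm _ c, _ => c < 2 ^ E.w
  | mov _ i, σ => σ.reg i < 2 ^ E.w
  | op o _ i j, σ => o.eval (σ.reg i) (σ.reg j) < 2 ^ E.w
  | get _ f i, σ => f < 17 ∧ σ.reg i < E.m
  | put f i _, σ => f < 17 ∧ σ.reg i < E.m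
  | inp _ e i, σ => e < 3 ∧ σ.reg i < E.m
  | emit _ t _ _, σ => t < 10 ∧ σ.out.length < 100 * (E.m + 1)

/-- The regions of the memory are disjoint: the input below `2 + 3 * m`, the 17 interleaved arrays
below `2 + 20 * m`, two cells left free for the header of the output, then the emitted gates. The
registers `1` and `2` are scratch and do not occur in `Rel`. -/
theorem sound {E : Env} {c : Instr} {s : State} {σ : AState} (hr : Rel E s σ) (h : c.Ok E σ) :
    ∃ s', Exec E.w c.code s c.cost s' ∧ Rel E s' (c.step E σ) := by
  obtain ⟨hreg, hzero, hbase, hobase, hcnt, hinp, hfld, hout⟩ := hr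
  have hb := E.bound
  cases c with
  | imm d c =>
    refine ⟨_, Exec.imm _ _ _ h, ?_⟩
    constructor <;> simp [step, Function.update_apply, *]
    all_goals assumption
  | mov d i =>
    simp only [Ok] at h
    refine ⟨_, Exec.seq (Exec.imm _ _ _ ?_) (Exec.op _ _ _ _ _ ?_), ?_⟩
    · omega
    · simpa [Op.eval, Function.update_apply, *] using h
    constructor <;> simp [step, Op.eval, Function.update_apply, *]
    all_goals assumption
  | op o d i j =>
    simp only [Ok] at h
    refine ⟨_, Exec.op _ _ _ _ _ ?_, ?_⟩
    · simpa [*] using h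
    constructor <;> simp [step, Function.update_apply, *]
    all_goals assumption
  | get d f i =>
    simp only [Ok] at h
    refine ⟨_, Exec.seq (Exec.imm _ _ _ ?_) (Exec.seq (Exec.op _ _ _ _ _ ?_)
      (Exec.seq (Exec.imm _ _ _ ?_) (Exec.seq (Exec.op _ _ _ _ _ ?_)
      (Exec.seq (Exec.op _ _ _ _ _ ?_) (Exec.load _ _ _))))), ?_⟩
    · omega
    · simp [Op.eval, Function.update_apply, *]; omega
    · omega
    · simp [Op.eval, Function.update_apply, *]; omega
    · simp [Op.eval, Function.update_apply, *]; omega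
    constructor <;> simp [step, Op.eval, Function.update_apply, *]
    all_goals assumption
  | put f i j =>
    simp only [Ok] at h
    refine ⟨_, Exec.seq (Exec.imm _ _ _ ?_) (Exec.seq (Exec.op _ _ _ _ _ ?_)
      (Exec.seq (Exec.imm _ _ _ ?_) (Exec.seq (Exec.op _ _ _ _ _ ?_)
      (Exec.seq (Exec.op _ _ _ _ _ ?_) (Exec.store _ _ _))))), ?_⟩
    · omega
    · simp [Op.eval, Function.update_apply, *]; omega
    · omega
    · simp [Op.eval, Function.update_apply, *]; omega
    · simp [Op.eval, Function.update_apply, *]; omega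
    have h1 := h.1
    have h2 := h.2
    constructor <;> simp [step, Op.eval, Function.update_apply, *]
    · intro a ha
      rw [if_neg (by omega)]
      exact hinp a ha
    · intro f' hf' i' hi'
      by_cases hff : f' = f
      · subst hff
        by_cases hii : i' = σ.reg i
        · subst hii; simp
        · have : ¬ (17 * i' = 17 * σ.reg i) := by omega
          simp [hii, Function.update_apply, hfld _ hf' _ hi']
      · have : ¬ (17 * i' + f' = 17 * σ.reg i + f) := by omega
        simp [this, hff, hfld _ hf' _ hi']
    · intro j' t x y hj
      have n1 : ¬ (4 + 20 * E.m + 3 * j' = 2 + 3 * E.m + (17 * σ.reg i + f)) := by omega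
      have n2 : ¬ (4 + 20 * E.m + 3 * j' + 1 = 2 + 3 * E.m + (17 * σ.reg i + f)) := by omega
      have n3 : ¬ (4 + 20 * E.m + 3 * j' + 1 + 1 = 2 + 3 * E.m + (17 * σ.reg i + f)) := by omega
      simp only [n1, n2, n3, if_false]
      exact hout _ _ _ _ hj
  | inp d e i =>
    simp only [Ok] at h
    refine ⟨_, Exec.seq (Exec.imm _ _ _ ?_) (Exec.seq (Exec.op _ _ _ _ _ ?_)
      (Exec.seq (Exec.imm _ _ _ ?_) (Exec.seq (Exec.op _ _ _ _ _ ?_) (Exec.load _ _ _)))), ?_⟩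
    · omega
    · simp [Op.eval, Function.update_apply, *]; omega
    · omega
    · simp [Op.eval, Function.update_apply, *]; omega
    have e1 : 3 * σ.reg i + (2 + e) = 2 + 3 * σ.reg i + e := by omega
    have e2 := hinp (2 + 3 * σ.reg i + e) (by omega)
    constructor <;> simp [step, Op.eval, Function.update_apply, *]
    all_goals assumption
  | emit d t i j =>
    simp only [Ok] at h
    refine ⟨_, Exec.seq (Exec.imm _ _ _ ?_) (Exec.seq (Exec.op _ _ _ _ _ ?_)
      (Exec.seq (Exec.op _ _ _ _ _ ?_) (Exec.seq (Exec.imm _ _ _ ?_)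
      (Exec.seq (Exec.store _ _ _) (Exec.seq (Exec.imm _ _ _ ?_)
      (Exec.seq (Exec.op _ _ _ _ _ ?_) (Exec.seq (Exec.store _ _ _)
      (Exec.seq (Exec.op _ _ _ _ _ ?_) (Exec.seq (Exec.store _ _ _)
      (Exec.seq (Exec.imm _ _ _ ?_) (Exec.seq (Exec.op _ _ _ _ _ ?_)
      (Exec.op _ _ _ _ _ ?_)))))))))))), ?_⟩
    · omega
    · simp [Op.eval, Function.update_apply, *]; omega
    · simp [Op.eval, Function.update_apply, *]; omega
    · omega
    · omega
    · simp [Op.eval, Function.update_apply, *]; omega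
    · simp [Op.eval, Function.update_apply, *]; omega
    · omega
    · simp [Op.eval, Function.update_apply, *]; omega
    · simp [Op.eval, Function.update_apply, *]; omega
    constructor <;> simp [step, Op.eval, Function.update_apply, *]
    · intro a ha
      rw [if_neg (by omega), if_neg (by omega), if_neg (by omega)]
      exact hinp a ha
    · intro f' hf' i' hi'
      rw [if_neg (by omega), if_neg (by omega), if_neg (by omega)]
      exact hfld _ hf' _ hi'
    · intro j' t' x y hj
      rw [List.getElem?_append] at hj
      split at hj
      · obtain ⟨o1, o2, o3⟩ := hout _ _ _ _ hj
        refine ⟨?_, ?_, ?_⟩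
        · rw [if_neg (by omega), if_neg (by omega), if_neg (by omega), o1]
        · rw [if_neg (by omega), if_neg (by omega), if_neg (by omega), o2]
        · rw [if_neg (by omega), if_neg (by omega), if_neg (by omega), o3]
      · rcases Nat.eq_zero_or_pos (j' - σ.out.length) with h0 | h0
        · have : j' = σ.out.length := by omega
          subst this
          simp at hj
          obtain ⟨rfl, rfl, rfl⟩ := hj
          simp
          intro h; omega
        · rw [List.getElem?_eq_none (by simp; omega)] at hj
          simp at hj

end Instr

/-- Straight-line code. -/
def block : List Instr → Prog
  | [] => .skip
  | c :: l => .seq c.code (block l)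

def blockCost : List Instr → ℕ
  | [] => 1
  | c :: l => c.cost + blockCost l

def blockStep (E : Env) : List Instr → AState → AState
  | [], σ => σ
  | c :: l, σ => blockStep E l (c.step E σ)

def BlockOk (E : Env) : List Instr → AState → Prop
  | [], _ => True
  | c :: l, σ => c.Ok E σ ∧ BlockOk E l (c.step E σ)

/-- Tests on abstract registers. -/
inductive ATest
  | lt (i j : ℕ)
  | eq (i j : ℕ)
  | zero (i : ℕ)
  | pos (i : ℕ)

def ATest.code : ATest → Test
  | lt i j => .lt (i + 8) (j + 8)
  | eq i j => .eq (i + 8) (j + 8)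
  | zero i => .eq (i + 8) 6
  | pos i => .lt 6 (i + 8)

def ATest.Holds (σ : AState) : ATest → Prop
  | lt i j => σ.reg i < σ.reg j
  | eq i j => σ.reg i = σ.reg j
  | zero i => σ.reg i = 0
  | pos i => 0 < σ.reg i

theorem ATest.holds_iff {E : Env} {s : State} {σ : AState} (hr : Rel E s σ) (b : ATest) :
    b.code.Holds s ↔ b.Holds σ := by
  cases b <;> simp [ATest.code, ATest.Holds, Test.Holds, hr.reg, hr.zero]

/-- Every state represented by `σ` leads under `p` after some `t` steps to a state represented by
some `σ'` with `Q t σ'`. -/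
def WP (E : Env) (p : Prog) (Q : ℕ → AState → Prop) (σ : AState) : Prop :=
  ∀ s, Rel E s σ → ∃ t s' σ', Exec E.w p s t s' ∧ Rel E s' σ' ∧ Q t σ'

/-! ### Rules for reasoning about programs with running times. -/

namespace WP

variable {E : Env} {p q : Prog} {Q : ℕ → AState → Prop} {σ : AState}

theorem mono {Q' : ℕ → AState → Prop} (h : WP E p Q' σ) (hQ : ∀ t σ', Q' t σ' → Q t σ') :
    WP E p Q σ := fun s hs =>
  let ⟨t, s', σ', h1, h2, h3⟩ := h s hs
  ⟨t, s', σ', h1, h2, hQ _ _ h3⟩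

theorem seq (h : WP E p (fun t σ' => WP E q (fun t' σ'' => Q (t + t') σ'') σ') σ) :
    WP E (.seq p q) Q σ := fun s hs =>
  let ⟨_, _, _, h1, h2, h3⟩ := h s hs
  let ⟨_, _, _, h1', h2', h3'⟩ := h3 _ h2
  ⟨_, _, _, Exec.seq h1 h1', h2', h3'⟩

theorem ite {b : ATest} (h1 : b.Holds σ → WP E p (fun t σ' => Q (1 + t) σ') σ)
    (h2 : ¬ b.Holds σ → WP E q (fun t σ' => Q (1 + t) σ') σ) :
    WP E (.ite b.code p q) Q σ := fun s hs => by
  by_cases hb : b.Holds σ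
  · obtain ⟨_, _, _, h1, h2, h3⟩ := h1 hb s hs
    exact ⟨_, _, _, Exec.ite_true ((b.holds_iff hs).2 hb) h1, h2, h3⟩
  · obtain ⟨_, _, _, h1, h2, h3⟩ := h2 hb s hs
    exact ⟨_, _, _, Exec.ite_false (fun h => hb ((b.holds_iff hs).1 h)) h1, h2, h3⟩

theorem block {l : List Instr} (hl : BlockOk E l σ) (hQ : Q (blockCost l) (blockStep E l σ)) :
    WP E (block l) Q σ := by
  intro s hs
  suffices ∃ s', Exec E.w (RAM.block l) s (blockCost l) s' ∧ Rel E s' (blockStep E l σ) from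
    let ⟨s', h1, h2⟩ := this
    ⟨_, _, _, h1, h2, hQ⟩
  clear hQ
  induction l generalizing s σ with
  | nil => exact ⟨s, Exec.skip s, hs⟩
  | cons c l ih =>
    obtain ⟨s', h1, h2⟩ := Instr.sound hs hl.1
    obtain ⟨s'', h3, h4⟩ := ih hl.2 s' h2
    exact ⟨s'', Exec.seq h1 h3, h4⟩

/-- Rule for loops: `Inv n T` holds after `T` steps, and `n` decreases with each iteration. -/
theorem loop {b : ATest} (Inv : ℕ → ℕ → AState → Prop) {n : ℕ} (h0 : Inv n 0 σ)
    (h : ∀ n T σ P, Inv n T σ → b.Holds σ →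
      (∀ t σ', (∃ n' < n, Inv n' (T + (1 + t)) σ') → P t σ') → WP E p P σ)
    (hQ : ∀ n T σ', Inv n T σ' → ¬ b.Holds σ' → Q (T + 1) σ') :
    WP E (.loop b.code p) Q σ := by
  -- The induction starts in the middle of a run, so the time `T` already spent is carried along.
  suffices ∀ n T σ, Inv n T σ → WP E (.loop b.code p) (fun t σ' => Q (T + t) σ') σ by
    simpa using this n 0 σ h0
  intro n
  induction n using Nat.strong_induction_on with
  | _ n ih =>
    intro T σ hI s hs
    by_cases hb : b.Holds σ
    · obtain ⟨t, s', σ', h1, h2, n', hn, h3⟩ :=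
        h n T σ _ hI hb (fun _ _ h => h) s hs
      obtain ⟨t', s'', σ'', h4, h5, h6⟩ := ih n' hn _ σ' h3 s' h2
      refine ⟨_, _, _, Exec.loop_true ((b.holds_iff hs).2 hb) h1 h4, h5, ?_⟩
      convert h6 using 1
      omega
    · exact ⟨_, _, _, Exec.loop_false (fun h => hb ((b.holds_iff hs).1 h)), hs, hQ _ _ _ hI hb⟩

end WP

end RAM

/-! ### Lists of gates and their values -/

namespace RAM

section Den

variable {A : Type*} [Add A] [Mul A] {k : ℕ}

/-- The gate `g` of the list `L` has the value `u`, and its unfolding has depth at most `d`. -/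
inductive Den (a : Fin k → A) (L : List (ℕ × ℕ × ℕ)) : ℕ → A → ℕ → Prop
  | const {g c d : ℕ} (hc : c < k) (h : L[g]? = some (1, c, 0)) : Den a L g (a ⟨c, hc⟩) d
  | add {g x y d : ℕ} {u v : A} (h : L[g]? = some (2, x, y)) (hx : Den a L x u d)
      (hy : Den a L y v d) : Den a L g (u + v) (d + 1)
  | mul {g x y d : ℕ} {u v : A} (h : L[g]? = some (3, x, y)) (hx : Den a L x u d)
      (hy : Den a L y v d) : Den a L g (u * v) (d + 1)

theorem prefix_getElem? {α : Type*} {L L' : List α} (h : L <+: L') {g : ℕ} {e : α}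
    (he : L[g]? = some e) : L'[g]? = some e := by
  obtain ⟨M, rfl⟩ := h
  have : g < L.length := by
    by_contra hg
    rw [List.getElem?_eq_none (by omega)] at he
    simp at he
  rw [List.getElem?_append_left this, he]

namespace Den

variable {a : Fin k → A} {L L' : List (ℕ × ℕ × ℕ)} {g d d' : ℕ} {u : A}

/-- The output is only ever appended to, so what is known about a gate stays true; the depth is
merely an upper bound. -/
theorem mono (h : Den a L g u d) (hL : L <+: L') (hd : d ≤ d') : Den a L' g u d' := by
  induction h generalizing d' with
  | const hc h => exact .const hc (prefix_getElem? hL h)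
  | add h _ _ ih1 ih2 =>
    obtain ⟨e, rfl⟩ := Nat.exists_eq_add_of_le' hd
    exact .add (prefix_getElem? hL h) (ih1 (Nat.le_add_left _ _)) (ih2 (Nat.le_add_left _ _))
  | mul h _ _ ih1 ih2 =>
    obtain ⟨e, rfl⟩ := Nat.exists_eq_add_of_le' hd
    exact .mul (prefix_getElem? hL h) (ih1 (Nat.le_add_left _ _)) (ih2 (Nat.le_add_left _ _))

theorem lt_length (h : Den a L g u d) : g < L.length := by
  by_contra hg
  cases h <;> rename_i h <;> simp_all [List.getElem?_eq_none]

end Den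

/-- Partial version of `Den`: the number `0` stands for an absent gate. -/
def DenO (a : Fin k → A) (L : List (ℕ × ℕ × ℕ)) (g : ℕ) : Option A → ℕ → Prop
  | none, _ => g = 0
  | some u, d => 0 < g ∧ Den a L g u d

namespace DenO

variable {a : Fin k → A} {L L' : List (ℕ × ℕ × ℕ)} {g d d' : ℕ} {u : Option A}

theorem mono (h : DenO a L g u d) (hL : L <+: L') (hd : d ≤ d') : DenO a L' g u d' := by
  cases u with
  | none => exact h
  | some u => exact ⟨h.1, h.2.mono hL hd⟩

theorem lt_length (h : DenO a L g u d) (hL : 0 < L.length) : g < L.length := by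
  cases u with
  | none => cases h; exact hL
  | some u => exact h.2.lt_length

end DenO

/-- Every gate of the list is a constant symbol or takes its arguments from earlier gates. -/
def WfGates (k : ℕ) (L : List (ℕ × ℕ × ℕ)) : Prop :=
  ∀ g t x y, L[g]? = some (t, x, y) →
    (t = 1 ∧ x < k ∧ y = 0) ∨ ((t = 2 ∨ t = 3) ∧ x < g ∧ y < g)

theorem WfGates.append {L : List (ℕ × ℕ × ℕ)} (h : WfGates k L) {t x y : ℕ}
    (hn : (t = 1 ∧ x < k ∧ y = 0) ∨ ((t = 2 ∨ t = 3) ∧ x < L.length ∧ y < L.length)) :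
    WfGates k (L ++ [(t, x, y)]) := by
  intro g t' x' y' hg
  rw [List.getElem?_append] at hg
  split at hg
  · exact h _ _ _ _ hg
  · rcases Nat.eq_zero_or_pos (g - L.length) with h0 | h0
    · have : g = L.length := by omega
      subst this
      simp at hg
      obtain ⟨rfl, rfl, rfl⟩ := hg
      exact hn
    · rw [List.getElem?_eq_none (by simp; omega)] at hg
      simp at hg

/-- The number of binary gates. -/
def binCount (L : List (ℕ × ℕ × ℕ)) : ℕ := L.countP fun e => e.1 ≠ 1

/-- `L'` extends `L` by at most `n` gates. -/
structure Grow (k : ℕ) (L L' : List (ℕ × ℕ × ℕ)) (n : ℕ) : Prop where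
  isPrefix : L <+: L'
  wf : WfGates k L → WfGates k L'
  bin : binCount L' ≤ binCount L + n
  length : L'.length ≤ L.length + n

namespace Grow

variable {L L' L'' : List (ℕ × ℕ × ℕ)} {n n' : ℕ}

theorem refl (L : List (ℕ × ℕ × ℕ)) (n : ℕ) : Grow k L L n :=
  ⟨List.prefix_rfl, id, Nat.le_add_right _ _, Nat.le_add_right _ _⟩

theorem trans (h : Grow k L L' n) (h' : Grow k L' L'' n') : Grow k L L'' (n + n') :=
  ⟨h.isPrefix.trans h'.isPrefix, fun hw => h'.wf (h.wf hw), by have := h.bin; have := h'.bin; omega,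
    by have := h.length; have := h'.length; omega⟩

theorem mono (h : Grow k L L' n) (hn : n ≤ n') : Grow k L L' n' :=
  ⟨h.isPrefix, h.wf, by have := h.bin; omega, by have := h.length; omega⟩

theorem append {t x y : ℕ} (ht : t = 2 ∨ t = 3) (hx : x < L.length) (hy : y < L.length) :
    Grow k L (L ++ [(t, x, y)]) 1 :=
  ⟨List.prefix_append _ _, fun h => h.append (.inr ⟨ht, hx, hy⟩), by
    simp only [binCount, List.countP_append]
    have : List.countP (fun e : ℕ × ℕ × ℕ => decide (e.1 ≠ 1)) [(t, x, y)] ≤ 1 := by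
      simpa using List.countP_le_length (p := fun e : ℕ × ℕ × ℕ => decide (e.1 ≠ 1))
        (l := [(t, x, y)])
    omega, by simp⟩

theorem length_pos (h : Grow k L L' n) (hL : 0 < L.length) : 0 < L'.length :=
  hL.trans_le h.isPrefix.length_le

end Grow

/-- A partial operation with `none` as identity. -/
def oop (f : A → A → A) : Option A → Option A → Option A
  | none, v => v
  | some x, none => some x
  | some x, some y => some (f x y)

abbrev oadd : Option A → Option A → Option A := oop (· + ·)

abbrev omul : Option A → Option A → Option A := oop (· * ·)

/-- The product `α c β`, which is absent if `c` is. -/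
def sandwich (α c β : Option A) : Option A := c.elim none fun c => omul (omul α (some c)) β

/-- The affine function `x ↦ α x β + γ`, with possibly absent coefficients, takes `x` to `y`. -/
def Acts (α β γ : Option A) (x y : A) : Prop := oadd (omul (omul α (some x)) β) γ = some y

end Den

/-! ### Affine functions over a semiring without identity elements. -/

section Affine

variable {A : Type*} [AddCommSemigroup A] [Semigroup A] [LeftDistribClass A] [RightDistribClass A]

/-- This is `α (α' x β' + γ') β + γ = (α α') x (β' β) + (α γ' β + γ)`, checked for each pattern of
absent coefficients. Keeping factors on both sides of `x` avoids commutativity of `*`. An absent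
multiplier acts as `1` and an absent summand as `0`, which is why `sandwich` vanishes together with
its middle argument. -/
theorem Acts.comp {α β γ α' β' γ' : Option A} {x y z : A} (h : Acts α β γ y z)
    (h' : Acts α' β' γ' x y) :
    Acts (omul α α') (omul β' β)
      (oadd (sandwich α γ' β) γ) x z := by
  unfold Acts sandwich at *
  rcases α with _ | α <;> rcases β with _ | β <;> rcases γ with _ | γ <;>
  rcases α' with _ | α' <;> rcases β' with _ | β' <;> rcases γ' with _ | γ' <;>
  simp only [oop, Option.some.injEq, Option.elim] at h h' ⊢ <;> subst h' <;> subst h <;>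
  simp only [mul_add, add_mul, mul_assoc, add_assoc]

end Affine

section FunDen

variable {A : Type*} [Add A] [Mul A] {k : ℕ}

/-- The gates `p`, `q`, `r` are the coefficients of an affine function that takes `x` to `y`. -/
def FunDen (a : Fin k → A) (L : List (ℕ × ℕ × ℕ)) (p q r : ℕ) (x y : A) (d : ℕ) : Prop :=
  ∃ α β γ : Option A, DenO a L p α d ∧ DenO a L q β d ∧ DenO a L r γ d ∧ Acts α β γ x y

theorem FunDen.mono {a : Fin k → A} {L L' : List (ℕ × ℕ × ℕ)} {p q r d d' : ℕ} {x y : A}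
    (h : FunDen a L p q r x y d) (hL : L <+: L') (hd : d ≤ d') : FunDen a L' p q r x y d' :=
  let ⟨α, β, γ, h1, h2, h3, h4⟩ := h
  ⟨α, β, γ, h1.mono hL hd, h2.mono hL hd, h3.mono hL hd, h4⟩

theorem FunDen.id (a : Fin k → A) (L : List (ℕ × ℕ × ℕ)) (x : A) (d : ℕ) :
    FunDen a L 0 0 0 x x d :=
  ⟨none, none, none, rfl, rfl, rfl, rfl⟩

end FunDen

/-! ### Code for affine functions -/

/-- `d := i o j`, where `o` is the operation with the given tag and absent arguments are skipped. -/
def optCode (tag d i j : ℕ) : Prog :=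
  .ite (ATest.zero i).code (block [.mov d j])
    (.ite (ATest.zero j).code (block [.mov d i]) (block [.emit d tag i j]))

section OptCode

variable {A : Type*} [Add A] [Mul A] {k : ℕ} {E : Env} {Q : ℕ → AState → Prop} {σ : AState}
  {a : Fin k → A} {d i j D : ℕ} {u v : Option A}

theorem WP.optCode (f : A → A → A) {tag : ℕ} (htag : tag = 2 ∨ tag = 3)
    (hf : ∀ {L g x y d u v}, L[g]? = some (tag, x, y) → Den a L x u d → Den a L y v d →
      Den a L g (f u v) (d + 1))
    (h0 : 0 < σ.out.length) (hlen : σ.out.length < 100 * (E.m + 1))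
    (hi : DenO a σ.out (σ.reg i) u D) (hj : DenO a σ.out (σ.reg j) v D)
    (hQ : ∀ t ≤ 20, ∀ L o, Grow k σ.out L 1 → DenO a L o (oop f u v) (D + 1) →
      Q t ⟨Function.update σ.reg d o, σ.fld, L⟩) : WP E (optCode tag d i j) Q σ := by
  have hb := E.bound
  have hil := hi.lt_length h0
  have hjl := hj.lt_length h0
  apply WP.ite <;> intro hzi
  · apply WP.block
    · simp [BlockOk, Instr.Ok]; omega
    · apply hQ _ (by simp [blockCost, Instr.cost]) _ _ (Grow.refl _ _)
      cases u with
      | none => exact hj.mono List.prefix_rfl (by omega)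
      | some u => exact absurd hzi hi.1.ne'
  apply WP.ite <;> intro hzj
  · apply WP.block
    · simp [BlockOk, Instr.Ok]; omega
    · apply hQ _ (by simp [blockCost, Instr.cost]) _ _ (Grow.refl _ _)
      cases v with
      | none =>
        cases u with
        | none => exact absurd hi hzi
        | some u => exact hi.mono List.prefix_rfl (by omega)
      | some v => exact absurd hzj hj.1.ne'
  · apply WP.block
    · simp [BlockOk, Instr.Ok]; omega
    · apply hQ _ (by simp [blockCost, Instr.cost]) _ _ (Grow.append htag hil hjl)
      cases u with
      | none => exact absurd hi hzi
      | some u =>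
        cases v with
        | none => exact absurd hj hzj
        | some v =>
          -- The new gate gets the length of the list as its number; this is positive, so it cannot
          -- be mistaken for an absent coefficient.
          refine ⟨h0, hf (x := σ.reg i) (y := σ.reg j) (by simp) ?_ ?_⟩
          · exact hi.2.mono (List.prefix_append _ _) le_rfl
          · exact hj.2.mono (List.prefix_append _ _) le_rfl

theorem WP.optAdd (h0 : 0 < σ.out.length) (hlen : σ.out.length < 100 * (E.m + 1))
    (hi : DenO a σ.out (σ.reg i) u D) (hj : DenO a σ.out (σ.reg j) v D)
    (hQ : ∀ t ≤ 20, ∀ L o, Grow k σ.out L 1 → DenO a L o (oadd u v) (D + 1) →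
      Q t ⟨Function.update σ.reg d o, σ.fld, L⟩) : WP E (RAM.optCode 2 d i j) Q σ :=
  WP.optCode (· + ·) (.inl rfl) Den.add h0 hlen hi hj hQ

theorem WP.optMul (h0 : 0 < σ.out.length) (hlen : σ.out.length < 100 * (E.m + 1))
    (hi : DenO a σ.out (σ.reg i) u D) (hj : DenO a σ.out (σ.reg j) v D)
    (hQ : ∀ t ≤ 20, ∀ L o, Grow k σ.out L 1 → DenO a L o (omul u v) (D + 1) →
      Q t ⟨Function.update σ.reg d o, σ.fld, L⟩) : WP E (RAM.optCode 3 d i j) Q σ :=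
  WP.optCode (· * ·) (.inr rfl) Den.mul h0 hlen hi hj hQ

end OptCode

/-- Replaces the affine function with coefficients in the registers `20`, `21`, `22` by its
composition with the function in the registers `23`, `24`, `25`, which is applied first. -/
def compCode : Prog :=
  .seq (block [.imm 26 0]) <|
  .seq (.ite (ATest.zero 25).code (block []) (.seq (optCode 3 26 20 25) (optCode 3 26 26 21))) <|
  .seq (optCode 2 22 26 22) <| .seq (optCode 3 20 20 23) (optCode 3 21 24 21)

/-- Applies the affine function in the registers `20`, `21`, `22` to the gate in register `27`. -/
def applyCode : Prog :=
  .seq (optCode 3 27 20 27) <| .seq (optCode 3 27 27 21) (optCode 2 27 27 22)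

section Code

variable {A : Type*} [AddCommSemigroup A] [Semigroup A] [LeftDistribClass A] [RightDistribClass A]
  {k : ℕ} {E : Env} {Q : ℕ → AState → Prop} {σ : AState} {a : Fin k → A} {D : ℕ} {x y z : A}

theorem WP.applyCode (h0 : 0 < σ.out.length) (hlen : σ.out.length < 100 * E.m)
    (hF : FunDen a σ.out (σ.reg 20) (σ.reg 21) (σ.reg 22) x y D)
    (hx : DenO a σ.out (σ.reg 27) (some x) D)
    (hQ : ∀ t ≤ 60, ∀ L o, Grow k σ.out L 3 → DenO a L o (some y) (D + 3) →
      Q t ⟨Function.update σ.reg 27 o, σ.fld, L⟩) : WP E applyCode Q σ := by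
  obtain ⟨α, β, γ, hα, hβ, hγ, hy⟩ := hF
  refine WP.seq (WP.optMul h0 (by omega) hα hx fun t1 ht1 L1 o1 g1 e1 => ?_)
  have p1 := g1.isPrefix
  have l1 := g1.length
  refine WP.seq (WP.optMul (g1.length_pos h0) (by simp; omega) (by simpa using e1)
    (by simpa using hβ.mono p1 (by omega)) fun t2 ht2 L2 o2 g2 e2 => ?_)
  have p2 := p1.trans g2.isPrefix
  have l2 := g2.length
  simp only at g2 l2
  refine WP.optAdd (g2.length_pos (g1.length_pos h0)) (by simp; omega) (by simpa using e2)
    (by simpa using hγ.mono p2 (by omega)) fun t3 ht3 L3 o3 g3 e3 => ?_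
  have := hQ (t1 + (t2 + t3)) (by omega) L3 o3 ((g1.trans (g2.trans g3)).mono (by omega))
    (by rw [← hy]; exact e3)
  simpa using this

/-- At most five gates are needed: two for `α γ' β`, one to add `γ`, and one each for `α α'` and `β'
β`. The longest chain consists of two products and a sum, hence `D + 3`. -/
theorem WP.compCode (h0 : 0 < σ.out.length) (hlen : σ.out.length < 100 * E.m)
    (hF : FunDen a σ.out (σ.reg 20) (σ.reg 21) (σ.reg 22) y z D)
    (hG : FunDen a σ.out (σ.reg 23) (σ.reg 24) (σ.reg 25) x y D)
    (hQ : ∀ t ≤ 110, ∀ L p q r s, Grow k σ.out L 5 → FunDen a L p q r x z (D + 3) →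
      Q t ⟨Function.update (Function.update (Function.update (Function.update σ.reg 26 s) 22 r)
        20 p) 21 q, σ.fld, L⟩) : WP E compCode Q σ := by
  have hb := E.bound
  obtain ⟨α, β, γ, hα, hβ, hγ, hz⟩ := hF
  obtain ⟨α', β', γ', hα', hβ', hγ', hy⟩ := hG
  have key := hz.comp hy
  refine WP.seq (WP.block (by simp [BlockOk, Instr.Ok]) ?_)
  simp only [blockStep, Instr.step]
  -- A common postcondition for both branches: if `γ'` is absent, so is the product `α γ' β`, and
  -- nothing is emitted.
  refine WP.seq (WP.mono (Q' := fun t σ' => ∃ L s, t ≤ 45 ∧ Grow k σ.out L 2 ∧ DenO a L s (sandwich α γ' β) (D + 2) ∧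
    σ' = ⟨Function.update σ.reg 26 s, σ.fld, L⟩) ?_ ?_)
  · refine WP.ite (fun hz => ?_) (fun hz => ?_)
    · refine WP.block trivial ⟨σ.out, 0, by decide, Grow.refl _ _, ?_, rfl⟩
      cases γ' with
      | none => rfl
      | some c => exact absurd hz (by simpa [ATest.Holds] using hγ'.1.ne')
    · have hc : ∃ c, γ' = some c := by
        cases γ' with
        | none => exact absurd hγ' (by simpa [ATest.Holds, DenO] using hz)
        | some c => exact ⟨c, rfl⟩
      obtain ⟨c, rfl⟩ := hc
      refine WP.seq (WP.optMul h0 (by simp; omega) (by simpa using hα) (by simpa using hγ')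
        fun t1 ht1 L1 o1 g1 e1 => ?_)
      have p1 := g1.isPrefix
      have l1 := g1.length
      simp only at g1 l1 p1
      refine WP.optMul (g1.length_pos h0) (by simp; omega) (by simpa using e1)
        (by simpa using hβ.mono p1 (by omega)) fun t2 ht2 L2 o2 g2 e2 => ?_
      exact ⟨L2, o2, by omega, (g1.trans g2), e2, by simp⟩
  · rintro t0 _ ⟨L0, s, ht0, g0, e0, rfl⟩
    have p0 := g0.isPrefix
    have l0 := g0.length
    refine WP.seq (WP.optAdd (g0.length_pos h0) (by simp; omega) (by simpa using e0)
      (by simpa using hγ.mono p0 (by omega)) fun t1 ht1 L1 o1 g1 e1 => ?_)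
    simp only at g1
    have g1 := g0.trans g1
    have p1 := g1.isPrefix
    have l1 := g1.length
    refine WP.seq (WP.optMul (g1.length_pos h0) (by simp; omega)
      (by simpa using hα.mono p1 le_rfl)
      (by simpa using hα'.mono p1 le_rfl) fun t2 ht2 L2 o2 g2 e2 => ?_)
    have g2' := g2
    have g2 := g1.trans g2
    have p2 := g2.isPrefix
    have l2 := g2.length
    refine WP.optMul (g2.length_pos h0) (by simp; omega)
      (by simpa using hβ'.mono p2 le_rfl)
      (by simpa using hβ.mono p2 le_rfl) fun t3 ht3 L3 o3 g3 e3 => ?_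
    have g := g2.trans g3
    have := hQ (blockCost [Instr.imm 26 0] + (t0 + (t1 + (t2 + t3))))
      (by simp [blockCost, Instr.cost]; omega) L3 o2 o3 o1 s (g.mono (by omega))
      ⟨_, _, _, e2.mono g3.isPrefix (by omega), e3.mono List.prefix_rfl (by omega),
        e1.mono (g2'.isPrefix.trans g3.isPrefix) (by omega), key⟩
    simpa using this

end Code

/-! ### Straight-line programs given by arrays -/

/-- The arrays `tag`, `X`, `Y` describe a straight-line program with `R` nodes in which all nodes are
reachable from the last one; `bot i` is the number of nodes of the unfolding at `i`. -/
structure Slp (k R : ℕ) (tag X Y bot : ℕ → ℕ) : Prop where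
  pos : 0 < R
  gate : ∀ i < R, (tag i = 1 ∧ X i < k ∧ bot i = 1) ∨
    ((tag i = 2 ∨ tag i = 3) ∧ X i < i ∧ Y i < i ∧ bot i = 1 + bot (X i) + bot (Y i))
  parent : ∀ i, i + 1 < R → ∃ j < R, tag j ≠ 1 ∧ (X j = i ∨ Y j = i)

namespace Slp

variable {k R : ℕ} {tag X Y bot : ℕ → ℕ}

theorem binary (h : Slp k R tag X Y bot) {i : ℕ} (hi : i < R) (ht : tag i ≠ 1) :
    (tag i = 2 ∨ tag i = 3) ∧ X i < i ∧ Y i < i ∧ bot i = 1 + bot (X i) + bot (Y i) := by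
  rcases h.gate i hi with h | h
  · exact absurd h.1 ht
  · exact h

theorem const (h : Slp k R tag X Y bot) {i : ℕ} (hi : i < R) (ht : tag i = 1) :
    X i < k ∧ bot i = 1 := by
  rcases h.gate i hi with h | h
  · exact h.2
  · omega

theorem bot_pos (h : Slp k R tag X Y bot) {i : ℕ} (hi : i < R) : 0 < bot i := by
  rcases h.gate i hi with h | h <;> omega

/-- Climb from `i` to parents, which have larger numbers and larger `bot`, until the last node is
reached. -/
theorem bot_le (h : Slp k R tag X Y bot) {i : ℕ} (hi : i < R) : bot i ≤ bot (R - 1) := by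
  obtain ⟨n, hn⟩ : ∃ n, n = R - i := ⟨_, rfl⟩
  induction n using Nat.strong_induction_on generalizing i with
  | _ n ih =>
    by_cases h1 : i + 1 < R
    · obtain ⟨j, hj, ht, hc⟩ := h.parent i h1
      obtain ⟨-, hX, hY, hb⟩ := h.binary hj ht
      have := ih (R - j) (by omega) hj rfl
      rcases hc with rfl | rfl <;> omega
    · have : i = R - 1 := by omega
      rw [this]

end Slp

/-- The largest power of two that is at most `n`, or `0` if `n = 0`. -/
def pw (n : ℕ) : ℕ := if n = 0 then 0 else 2 ^ Nat.log 2 n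

theorem pw_le (n : ℕ) : pw n ≤ n := by
  unfold pw
  split
  · omega
  · exact Nat.pow_log_le_self 2 ‹_›

theorem lt_two_pw {n : ℕ} (h : 0 < n) : n < 2 * pw n := by
  have := Nat.lt_pow_succ_log_self (b := 2) (by norm_num) n
  rw [pw, if_neg (by omega)]
  rw [pow_succ] at this
  omega

theorem pw_pos {n : ℕ} (h : 0 < n) : 0 < pw n := by
  have := lt_two_pw h
  omega

theorem exists_pw {n : ℕ} (h : 0 < n) : ∃ e, pw n = 2 ^ e :=
  ⟨Nat.log 2 n, if_neg (by omega)⟩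

theorem pw_eq_of_bounds {e b : ℕ} (h1 : 2 ^ e ≤ b) (h2 : b < 4 * 2 ^ e) :
    pw b = if b < 2 * 2 ^ e then 2 ^ e else 2 * 2 ^ e := by
  have := Nat.two_pow_pos e
  rw [pw, if_neg (by omega)]
  split
  · rw [(Nat.log_eq_iff (by omega)).2 ⟨h1, by rw [pow_succ]; omega⟩]
  · rw [(Nat.log_eq_iff (m := e + 1) (by omega)).2 ⟨by rw [pow_succ]; omega, by
      rw [pow_succ, pow_succ]; omega⟩, pow_succ, mul_comm]

/-- With `M` the larger of the rounded summands, `x` and `y` are at most `2 * M - 1`, so `M ≤ b < 4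
* M` and one comparison decides between `M` and `2 * M`. The extra `1` admits `bot = 1 + bot X + bot
Y`; the case `x = 0` is needed when the counters `T` start at zero. -/
theorem pw_combine {x y b : ℕ} (hy : 0 < y) (hx : x ≤ b) (hyb : y ≤ b) (hb : b ≤ x + y + 1) :
    pw b = if b < 2 * max (pw x) (pw y) then max (pw x) (pw y) else 2 * max (pw x) (pw y) := by
  have hM : ∃ e, max (pw x) (pw y) = 2 ^ e := by
    rcases Nat.eq_zero_or_pos x with rfl | hx
    · simpa [pw] using ⟨Nat.log 2 y, by rw [if_neg (by omega)]⟩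
    · rcases max_choice (pw x) (pw y) with h | h <;> rw [h] <;> apply exists_pw <;> assumption
  obtain ⟨e, he⟩ := hM
  rw [he]
  have h1 := pw_le x
  have h2 := pw_le y
  have h3 := lt_two_pw hy
  have h4 : x < 2 * 2 ^ e := by
    rcases Nat.eq_zero_or_pos x with rfl | hx
    · have := Nat.two_pow_pos e; omega
    · have := lt_two_pw hx
      have := le_max_left (pw x) (pw y)
      omega
  apply pw_eq_of_bounds
  · rw [← he]; omega
  · have := le_max_right (pw x) (pw y); omega

/-! ### Rounding to powers of two -/

/-- Register `6` becomes `pw` of register `5`, given the values of `pw` at the summands in the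
registers `6` and `7`. -/
def normCode : Prog :=
  .seq (.ite (ATest.lt 6 7).code (block [.mov 6 7]) (block [])) <| .seq (block [.op .add 8 6 6]) <|
    .ite (ATest.lt 5 8).code (block []) (block [.mov 6 8])

theorem WP.normCode {E : Env} {Q : ℕ → AState → Prop} {σ : AState}
    (h : 2 * max (σ.reg 6) (σ.reg 7) < 2 ^ E.w)
    (hQ : ∀ t ≤ 20, ∀ r, Q t ⟨Function.update (Function.update σ.reg 8 r) 6
      (if σ.reg 5 < 2 * max (σ.reg 6) (σ.reg 7) then max (σ.reg 6) (σ.reg 7)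
        else 2 * max (σ.reg 6) (σ.reg 7)), σ.fld, σ.out⟩) : WP E normCode Q σ := by
  have h1 := le_max_left (σ.reg 6) (σ.reg 7)
  have h2 := le_max_right (σ.reg 6) (σ.reg 7)
  refine WP.seq (WP.mono (Q' := fun t σ' => t ≤ 4 ∧
    σ' = ⟨Function.update σ.reg 6 (max (σ.reg 6) (σ.reg 7)), σ.fld, σ.out⟩) ?_ ?_)
  · refine WP.ite (fun hz => WP.block ?_ ?_) (fun hz => WP.block trivial ?_)
    · simp [BlockOk, Instr.Ok]; omega
    · simp only [ATest.Holds] at hz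
      simp [blockCost, Instr.cost, blockStep, Instr.step, max_eq_right hz.le]
    · simp only [ATest.Holds, not_lt] at hz
      simp [blockCost, Instr.cost, blockStep, Instr.step, max_eq_left hz]
  · rintro t _ ⟨ht, rfl⟩
    set M := max (σ.reg 6) (σ.reg 7) with hM
    refine WP.seq (WP.block ?_ ?_)
    · simp [BlockOk, Instr.Ok, Op.eval]; omega
    · simp only [blockStep, Instr.step, Op.eval, Function.update_self]
      refine WP.ite (fun hz => WP.block trivial ?_) (fun hz => WP.block ?_ ?_)
      · simp [ATest.Holds] at hz
        have := hQ (t + (blockCost [Instr.op Op.add 8 6 6] + (1 + blockCost [])))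
          (by simp [blockCost, Instr.cost]; omega) (M + M)
        rw [if_pos (by omega)] at this
        simp only [blockStep, Instr.step]
        convert this using 2
        funext v
        by_cases h6 : v = 6 <;> by_cases h8 : v = 8 <;> simp [Function.update_apply, h6, h8, blockStep]
      · simp [BlockOk, Instr.Ok]; omega
      · simp [ATest.Holds] at hz
        have := hQ (t + (blockCost [Instr.op Op.add 8 6 6] + (1 + blockCost [Instr.mov 6 8])))
          (by simp [blockCost, Instr.cost]; omega) (M + M)
        rw [if_neg (by omega)] at this
        simp only [blockStep, Instr.step]
        convert this using 2
        funext v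
        by_cases h6 : v = 6 <;> by_cases h8 : v = 8 <;>
          simp [Function.update_apply, h6, h8, blockStep, Instr.step, two_mul]

/-! ### Sizes of the unfoldings -/

/-- Computes the arrays `bot` and `pw ∘ bot` in the fields `5` and `6`. -/
def botCode : Prog :=
  .seq (block [.imm 1 0]) <| .loop (ATest.lt 1 0).code <|
    .seq (block [.get 2 2 1, .imm 9 1]) <|
    .ite (ATest.eq 2 9).code (block [.put 5 1 9, .put 6 1 9, .op .add 1 1 9]) <|
    .seq (block [.get 3 3 1, .get 4 4 1, .get 5 5 3, .get 8 5 4, .op .add 5 9 5, .op .add 5 5 8,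
      .get 6 6 3, .get 7 6 4]) <|
    .seq normCode (block [.put 5 1 5, .put 6 1 6, .op .add 1 1 9])

theorem WP.botCode {k R : ℕ} {tag X Y bot : ℕ → ℕ} (hS : Slp k R tag X Y bot) {E : Env}
    {Q : ℕ → AState → Prop} {σ : AState} (hR : R ≤ E.m) (hn : 1000 * bot (R - 1) ≤ 2 ^ E.w)
    (r0 : σ.reg 0 = R) (f2 : σ.fld 2 = tag) (f3 : σ.fld 3 = X) (f4 : σ.fld 4 = Y)
    (hQ : ∀ t σ', t ≤ 200 * R + 10 → σ'.reg 0 = R → σ'.out = σ.out →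
      (∀ f, f ≠ 5 → f ≠ 6 → σ'.fld f = σ.fld f) → (∀ i < R, σ'.fld 5 i = bot i) →
      (∀ i < R, σ'.fld 6 i = pw (bot i)) → Q t σ') : WP E botCode Q σ := by
  have hb := E.bound
  refine WP.seq (WP.block (by simp [BlockOk, Instr.Ok]) ?_)
  refine WP.loop (fun n T σ' => ∃ i ≤ R, n = R - i ∧ T ≤ 200 * i ∧ σ'.reg 0 = R ∧ σ'.reg 1 = i ∧
    σ'.out = σ.out ∧ (∀ f, f ≠ 5 → f ≠ 6 → σ'.fld f = σ.fld f) ∧ (∀ j < i, σ'.fld 5 j = bot j) ∧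
    (∀ j < i, σ'.fld 6 j = pw (bot j)))
    ⟨0, by omega, rfl, by omega, by simpa [blockStep, Instr.step] using r0,
      by simp [blockStep, Instr.step], rfl, fun _ _ _ => rfl, by simp, by simp⟩ ?_ ?_
  · rintro n T σ' P ⟨i, hi, rfl, hT, h0, h1, hout, hf, hb5, hb6⟩ hlt hP
    simp only [ATest.Holds, h0, h1] at hlt
    have g2 : σ'.fld 2 = tag := by rw [hf 2 (by decide) (by decide), f2]
    have g3 : σ'.fld 3 = X := by rw [hf 3 (by decide) (by decide), f3]
    have g4 : σ'.fld 4 = Y := by rw [hf 4 (by decide) (by decide), f4]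
    refine WP.seq (WP.block (by simp [BlockOk, Instr.Ok, Instr.step, h1]; omega) ?_)
    simp only [blockStep, Instr.step]
    have hle := hS.bot_le hlt
    refine WP.ite (fun ht => WP.block ?_ ?_) (fun ht => ?_)
    · simp [BlockOk, Instr.Ok, Instr.step, h1, Op.eval]; omega
    · simp [ATest.Holds, h1, g2] at ht
      refine hP _ _ ⟨R - (i + 1), by omega, i + 1, by omega, rfl, ?_, ?_⟩
      · simp [blockCost, Instr.cost]; omega
      · have hc := (hS.const hlt ht).2
        simp [blockStep, Instr.step, Function.update_apply, h0, h1, Op.eval, hout]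
        refine ⟨fun f h5 h6 => by simp [h5, h6, hf], fun j hj => ?_, fun j hj => ?_⟩
        · split
          · subst_vars; exact hc.symm
          · exact hb5 j (by omega)
        · split
          · subst_vars; rw [hc]; rfl
          · exact hb6 j (by omega)
    · simp [ATest.Holds, h1, g2] at ht
      obtain ⟨htag, hX, hY, hbot⟩ := hS.binary hlt ht
      have bx := hb5 _ hX
      have by' := hb5 _ hY
      have bx6 := hb6 _ hX
      have by6 := hb6 _ hY
      have px := pw_le (bot (X i))
      have py := pw_le (bot (Y i))
      refine WP.seq (WP.block ?_ ?_)
      · simp [BlockOk, Instr.Ok, Instr.step, h1, g3, g4, Op.eval, bx, by']; omega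
      · simp [blockStep, Instr.step, h1, g3, g4, Op.eval, bx, by', bx6, by6]
        refine WP.seq (WP.normCode ?_ fun t ht r => WP.block ?_ ?_)
        · simp; omega
        · simp [BlockOk, Instr.Ok, Instr.step, h1, Op.eval]; omega
        · refine hP _ _ ⟨R - (i + 1), by omega, i + 1, by omega, rfl, ?_, ?_⟩
          · simp [blockCost, Instr.cost]; omega
          -- The rounded value at `i` is found from those at the two arguments, which precede `i`.
          · have hc := pw_combine (x := bot (X i)) (y := bot (Y i)) (b := bot i)
              (hS.bot_pos (by omega)) (by omega) (by omega) (by omega)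
            rw [hbot] at hc
            simp [blockStep, Instr.step, Function.update_apply, h0, h1, Op.eval, hout]
            refine ⟨fun f h5 h6 => by simp [h5, h6, hf], fun j hj => ?_, fun j hj => ?_⟩
            · split
              · subst_vars; exact hbot.symm
              · exact hb5 j (by omega)
            · split
              · subst_vars; rw [hbot, hc]
              · exact hb6 j (by omega)
  · rintro n T σ' ⟨i, hi, rfl, hT, h0, h1, hout, hf, hb5, hb6⟩ hlt
    simp only [ATest.Holds, h0, h1] at hlt
    obtain rfl : i = R := by omega
    exact hQ _ _ (by simp [blockCost, Instr.cost]; omega) h0 hout hf hb5 hb6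

/-! ### Numbers of paths from the root -/

/-- The left (`true`) or right (`false`) argument. -/
def arg (X Y : ℕ → ℕ) (b : Bool) (u : ℕ) : ℕ := if b then X u else Y u

/-- The array `T` holds the numbers of paths from the root that end with an edge leaving a node
`≥ i`, or are empty. -/
structure TopInv (R : ℕ) (tag X Y bot : ℕ → ℕ) (i : ℕ) (T : ℕ → ℕ) : Prop where
  root : T (R - 1) = 1
  sum : ∑ j ∈ Finset.range i, T j * bot j ≤ bot (R - 1)
  le : ∀ j, i ≤ j → j < R → T j * bot j ≤ bot (R - 1)
  edge : ∀ b u, i ≤ u → u < R → tag u ≠ 1 → T u ≤ T (arg X Y b u)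
  pair : ∀ b u b' u', i ≤ u → u < R → tag u ≠ 1 → i ≤ u' → u' < R → tag u' ≠ 1 →
    ¬ (b = b' ∧ u = u') → arg X Y b u = arg X Y b' u' → T u + T u' ≤ T (arg X Y b u)

namespace TopInv

variable {k R : ℕ} {tag X Y bot : ℕ → ℕ} {i : ℕ} {T : ℕ → ℕ}

theorem init (hR : 0 < R) : TopInv R tag X Y bot R (Function.update (fun _ => 0) (R - 1) 1) where
  root := by simp
  sum := by
    rw [Finset.sum_eq_single (R - 1)]
    · simp
    · intro j _ hj; simp [hj]
    · intro h; simp at h; omega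
  le := by intros; omega
  edge := by intros; omega
  pair := by intros; omega

theorem congr {T' : ℕ → ℕ} (h : TopInv R tag X Y bot i T) (hS : Slp k R tag X Y bot) (hi : i ≤ R)
    (hT : ∀ j < R, T' j = T j) : TopInv R tag X Y bot i T' := by
  have ha : ∀ b u, u < R → tag u ≠ 1 → arg X Y b u < R := by
    intro b u hu ht
    have := hS.binary hu ht
    cases b <;> simp [arg] <;> omega
  have h0 := hS.pos
  constructor
  · rw [hT _ (by omega), h.root]
  · rw [Finset.sum_congr rfl fun j hj => by rw [hT j (by simp at hj; omega)]]
    exact h.sum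
  · intro j h1 h2
    rw [hT j h2]; exact h.le j h1 h2
  · intro b u h1 h2 h3
    rw [hT u h2, hT _ (ha b u h2 h3)]; exact h.edge b u h1 h2 h3
  · intro b u b' u' h1 h2 h3 h4 h5 h6 h7 h8
    rw [hT u h2, hT _ (ha b u h2 h3), hT u' h5]; exact h.pair b u b' u' h1 h2 h3 h4 h5 h6 h7 h8

/-- Parents lead from `j` up to the root, where `T` is `1`, and `T` does not decrease along edges.
As `i ≤ j + 1`, all nodes above `j` have already passed on their counts. -/
theorem pos (h : TopInv R tag X Y bot i T) (hS : Slp k R tag X Y bot) {j : ℕ} (hj : j < R)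
    (hij : i ≤ j + 1) : 0 < T j := by
  obtain ⟨n, hn⟩ : ∃ n, n = R - j := ⟨_, rfl⟩
  induction n using Nat.strong_induction_on generalizing j with
  | _ n ih =>
    by_cases h1 : j + 1 < R
    · obtain ⟨u, hu, ht, hc⟩ := hS.parent j h1
      obtain ⟨-, hX, hY, hb⟩ := hS.binary hu ht
      have hju : j < u := by rcases hc with rfl | rfl <;> omega
      have := ih (R - u) (by omega) hu (by omega) rfl
      rcases hc with rfl | rfl
      · exact this.trans_le (h.edge true u (by omega) hu ht)
      · exact this.trans_le (h.edge false u (by omega) hu ht)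
    · have : j = R - 1 := by omega
      rw [this, h.root]; exact one_pos

theorem skip (h : TopInv R tag X Y bot (i + 1) T) (ht : tag i = 1) :
    TopInv R tag X Y bot i T where
  root := h.root
  sum := by have := h.sum; rw [Finset.sum_range_succ] at this; omega
  le := by
    intro j h1 h2
    rcases h1.eq_or_lt with rfl | h1
    · have := h.sum; rw [Finset.sum_range_succ] at this; omega
    · exact h.le j h1 h2
  edge := by
    intro b u h1 h2 h3
    rcases h1.eq_or_lt with rfl | h1
    · contradiction
    · exact h.edge b u h1 h2 h3
  pair := by
    intro b u b' u' h1 h2 h3 h4 h5 h6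
    rcases h1.eq_or_lt with rfl | h1
    · contradiction
    rcases h4.eq_or_lt with rfl | h4
    · contradiction
    exact h.pair b u b' u' h1 h2 h3 h4 h5 h6

/-- The sum counts nodes in disjoint subtrees of the derivation tree. Replacing `i` by its arguments
removes the `T i` roots of the copies of its subtree, by `bot i = 1 + bot (X i) + bot (Y i)`, so the
bound by the size of the whole tree persists. If both arguments coincide, the common argument
receives `T i` twice, as `pair` demands for the two parallel edges. -/
theorem push (h : TopInv R tag X Y bot (i + 1) T) (hS : Slp k R tag X Y bot) (ht : tag i ≠ 1)
    (hi : i < R) {T' : ℕ → ℕ}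
    (hT : ∀ j, T' j = T j + (if j = X i then T i else 0) + (if j = Y i then T i else 0)) :
    TopInv R tag X Y bot i T' := by
  obtain ⟨-, hX, hY, hb⟩ := hS.binary hi ht
  have same : ∀ j, i ≤ j → T' j = T j := by
    intro j hj
    rw [hT, if_neg (by omega), if_neg (by omega)]; omega
  have mono : ∀ j, T j ≤ T' j := by intro j; rw [hT]; omega
  have new : ∀ b, T (arg X Y b i) + T i ≤ T' (arg X Y b i) := by
    intro b
    rw [hT]
    cases b <;> simp [arg]
  have two : X i = Y i → T i + T i ≤ T' (X i) := by
    intro h; rw [hT, if_pos rfl, if_pos h]; omega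
  have hs := h.sum
  rw [Finset.sum_range_succ] at hs
  constructor
  · rw [same _ (by omega), h.root]
  · have : ∑ j ∈ Finset.range i, T' j * bot j =
        ∑ j ∈ Finset.range i, T j * bot j + T i * bot (X i) + T i * bot (Y i) := by
      rw [Finset.sum_congr rfl fun j _ => by rw [hT j, add_mul, add_mul, ite_mul, ite_mul, zero_mul]]
      rw [Finset.sum_add_distrib, Finset.sum_add_distrib, Finset.sum_ite_eq', Finset.sum_ite_eq',
        if_pos (by simpa using hX), if_pos (by simpa using hY)]
    rw [this]
    have : T i * bot i = T i + T i * bot (X i) + T i * bot (Y i) := by rw [hb]; ring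
    omega
  · intro j h1 h2
    rw [same j h1]
    rcases h1.eq_or_lt with rfl | h1
    · omega
    · exact h.le j h1 h2
  · intro b u h1 h2 h3
    rw [same u h1]
    rcases h1.eq_or_lt with rfl | h1
    · have := new b; omega
    · exact (h.edge b u h1 h2 h3).trans (mono _)
  · intro b u b' u' h1 h2 h3 h4 h5 h6 h7 h8
    rw [same u h1, same u' h4]
    rcases h1.eq_or_lt with rfl | h1 <;> rcases h4.eq_or_lt with rfl | h4
    · have : b ≠ b' := by rintro rfl; simp at h7
      cases b <;> cases b' <;> simp [arg] at h8 this ⊢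
      · rw [h8]; exact two h8.symm
      · exact two h8
    · have := new b
      have e := h.edge b' u' h4 h5 h6
      rw [← h8] at e
      omega
    · have := new b'
      have e := h.edge b u h1 h2 h3
      rw [← h8] at this
      omega
    · exact (h.pair b u b' u' h1 h2 h3 h4 h5 h6 h7 h8).trans (mono _)

end TopInv

/-- Adds register `10` to the entry of the field `7` at the index in register `c`, and updates the
field `8`. -/
def pushCode (c : ℕ) : Prog :=
  .seq (block [.get 5 7 c, .get 6 8 c, .op .add 5 5 10]) <|
    .seq normCode (block [.put 7 c 5, .put 8 c 6])

theorem WP.pushCode {E : Env} {Q : ℕ → AState → Prop} {σ : AState} {c : ℕ} (hc : c < 5)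
    (hm : σ.reg c < E.m) (h8 : σ.fld 8 (σ.reg c) = pw (σ.fld 7 (σ.reg c)))
    (h7 : σ.reg 7 = pw (σ.reg 10)) (h10 : 0 < σ.reg 10)
    (hw : 4 * (σ.fld 7 (σ.reg c) + σ.reg 10) < 2 ^ E.w)
    (hQ : ∀ t ≤ 60, ∀ r, (∀ v, v ≠ 5 → v ≠ 6 → v ≠ 8 → r v = σ.reg v) → Q t ⟨r,
      Function.update (Function.update σ.fld 7 (Function.update (σ.fld 7) (σ.reg c)
        (σ.fld 7 (σ.reg c) + σ.reg 10))) 8 (Function.update (σ.fld 8) (σ.reg c)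
        (pw (σ.fld 7 (σ.reg c) + σ.reg 10))), σ.out⟩) : WP E (pushCode c) Q σ := by
  have e5 : c ≠ 5 := by omega
  have e6 : c ≠ 6 := by omega
  have e8 : c ≠ 8 := by omega
  have e10 : c ≠ 10 := by omega
  have p1 := pw_le (σ.fld 7 (σ.reg c))
  have p2 := pw_le (σ.reg 10)
  have key := pw_combine (x := σ.fld 7 (σ.reg c)) (y := σ.reg 10)
    (b := σ.fld 7 (σ.reg c) + σ.reg 10) h10 (by omega) (by omega) (by omega)
  refine WP.seq (WP.block ?_ ?_)
  · simp [BlockOk, Instr.Ok, Instr.step, hm, Op.eval, e5, e6]; omega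
  simp only [blockStep, Instr.step, Op.eval]
  refine WP.seq (WP.normCode ?_ fun t ht r => WP.block ?_ ?_)
  · simp [e5, e6, h8, h7]; omega
  · simp [BlockOk, Instr.Ok, Instr.step, hm, Op.eval, e5, e6, e8]
  · have := hQ (blockCost [Instr.get 5 7 c, Instr.get 6 8 c, Instr.op Op.add 5 5 10] +
      (t + blockCost [Instr.put 7 c 5, Instr.put 8 c 6])) (by simp [blockCost, Instr.cost]; omega)
    simp [blockStep, Instr.step, e5, e6, e8, h8, h7, ← key]
    apply this
    intro v h5 h6 h8
    simp [h5, h6, h8]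

/-- Computes the numbers `T` of paths from the root and `pw ∘ T` in the fields `7` and `8`. -/
def topCode : Prog :=
  .seq (block [.mov 1 0, .imm 9 1, .op .sub 2 1 9, .put 7 2 9, .put 8 2 9]) <|
  .loop (ATest.pos 1).code <|
    .seq (block [.imm 9 1, .op .sub 1 1 9, .get 2 2 1]) <|
    .ite (ATest.eq 2 9).code (block []) <|
    .seq (block [.get 3 3 1, .get 4 4 1, .get 10 7 1, .get 7 8 1]) <|
    .seq (pushCode 3) (pushCode 4)

theorem WP.topCode {k R : ℕ} {tag X Y bot : ℕ → ℕ} (hS : Slp k R tag X Y bot) {E : Env}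
    {Q : ℕ → AState → Prop} {σ : AState} (hR : R ≤ E.m) (hn : 1000 * bot (R - 1) ≤ 2 ^ E.w)
    (r0 : σ.reg 0 = R) (f2 : σ.fld 2 = tag) (f3 : σ.fld 3 = X) (f4 : σ.fld 4 = Y)
    (f7 : ∀ i < R, σ.fld 7 i = 0) (f8 : ∀ i < R, σ.fld 8 i = 0)
    (hQ : ∀ t σ', t ≤ 300 * R + 50 → σ'.reg 0 = R → σ'.out = σ.out →
      (∀ f, f ≠ 7 → f ≠ 8 → σ'.fld f = σ.fld f) → TopInv R tag X Y bot 0 (σ'.fld 7) →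
      (∀ i < R, σ'.fld 8 i = pw (σ'.fld 7 i)) → Q t σ') : WP E topCode Q σ := by
  have hb := E.bound
  have hR0 := hS.pos
  have hpos := hS.bot_pos (i := R - 1) (by omega)
  refine WP.seq (WP.block (by simp [BlockOk, Instr.Ok, Instr.step, Op.eval, r0]; omega) ?_)
  refine WP.loop (fun n T σ' => ∃ i ≤ R, n = i ∧ T ≤ 300 * (R - i) ∧ σ'.reg 0 = R ∧ σ'.reg 1 = i ∧
    σ'.out = σ.out ∧ (∀ f, f ≠ 7 → f ≠ 8 → σ'.fld f = σ.fld f) ∧ TopInv R tag X Y bot i (σ'.fld 7) ∧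
    (∀ j < R, σ'.fld 8 j = pw (σ'.fld 7 j))) ⟨R, le_rfl, rfl, by omega, ?_⟩ ?_ ?_
  · simp [blockStep, Instr.step, r0, Op.eval]
    refine ⟨fun f h7 h8 => by simp [h7, h8], (TopInv.init hR0).congr hS le_rfl ?_, ?_⟩
    · intro j hj
      simp only [Function.update_apply]
      rw [f7 j hj]
    · intro j hj
      simp only [Function.update_apply]
      rw [f7 j hj, f8 j hj]
      split <;> simp [pw]
  · rintro n T σ' P ⟨i, hi, rfl, hT, h0, h1, hout, hf, hI, h8⟩ hlt hP
    simp only [ATest.Holds, h1] at hlt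
    obtain ⟨i, rfl⟩ : ∃ j, n = j + 1 := ⟨n - 1, by omega⟩
    have g2 : σ'.fld 2 = tag := by rw [hf 2 (by decide) (by decide), f2]
    have g3 : σ'.fld 3 = X := by rw [hf 3 (by decide) (by decide), f3]
    have g4 : σ'.fld 4 = Y := by rw [hf 4 (by decide) (by decide), f4]
    refine WP.seq (WP.block (by simp [BlockOk, Instr.Ok, Instr.step, h1, Op.eval]; omega) ?_)
    simp only [blockStep, Instr.step]
    refine WP.ite (fun ht => WP.block trivial ?_) (fun ht => ?_)
    · simp [ATest.Holds, h1, g2, Op.eval] at ht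
      refine hP _ _ ⟨i, by omega, i, by omega, rfl, ?_, ?_⟩
      · simp [blockCost, Instr.cost]; omega
      · simp [blockStep, h1, Op.eval, h0, hout]
        exact ⟨hf, hI.skip ht, h8⟩
    · simp [ATest.Holds, h1, g2, Op.eval] at ht
      have htg := ht
      obtain ⟨htag, hX, hY, hbot⟩ := hS.binary (by omega) ht
      have hTi := hI.pos hS (j := i) (by omega) le_rfl
      have hpw := h8 i (by omega)
      have hsum := hI.sum
      rw [Finset.sum_range_succ] at hsum
      -- Both counts are dominated by different terms of the sum in `TopInv.sum`, so every sum
      -- formed here fits into a word.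
      have hTle : ∀ j < i, σ'.fld 7 j + σ'.fld 7 i ≤ bot (R - 1) := by
        intro j hj
        have h1 : σ'.fld 7 j * bot j ≤ _ := Finset.single_le_sum (f := fun j => σ'.fld 7 j * bot j)
          (fun _ _ => Nat.zero_le _) (Finset.mem_range.2 hj)
        have h2 := Nat.le_mul_of_pos_right (σ'.fld 7 j) (hS.bot_pos (i := j) (by omega))
        have h3 := Nat.le_mul_of_pos_right (σ'.fld 7 i) (hS.bot_pos (i := i) (by omega))
        omega
      have hTX := hTle _ hX
      have hTY := hTle _ hY
      have hii : σ'.fld 7 i ≤ bot (R - 1) := by omega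
      refine WP.seq (WP.block ?_ ?_)
      · simp [BlockOk, Instr.Ok, Instr.step, h1, g3, g4, Op.eval]; omega
      simp only [blockStep, Instr.step]
      refine WP.seq (WP.pushCode (by decide) ?_ ?_ ?_ ?_ ?_ fun t ht r hr => ?_)
      · simp [h1, Op.eval, g3]; omega
      · simpa [h1, Op.eval, g3] using h8 _ (by omega)
      · simp [h1, Op.eval, hpw]
      · simpa [h1, Op.eval] using hTi
      · simp [h1, Op.eval, g3]; omega
      have r4 : r 4 = Y i := by rw [hr 4 (by decide) (by decide) (by decide)]; simp [h1, g4, Op.eval]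
      have r10 : r 10 = σ'.fld 7 i := by
        rw [hr 10 (by decide) (by decide) (by decide)]; simp [h1, Op.eval]
      have r7 : r 7 = σ'.fld 8 i := by
        rw [hr 7 (by decide) (by decide) (by decide)]; simp [h1, Op.eval]
      have r0 : r 0 = R := by
        rw [hr 0 (by decide) (by decide) (by decide)]; simp [h0, Op.eval]
      have r1 : r 1 = i := by
        rw [hr 1 (by decide) (by decide) (by decide)]; simp [h1, Op.eval]
      simp [h1, Op.eval, g3]
      refine WP.pushCode (by decide) ?_ ?_ ?_ ?_ ?_ fun t' ht' r' hr' => ?_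
      · simp [r4]; omega
      · simp only [r4]
        simp [Function.update_apply]
        split
        · rfl
        · exact h8 _ (by omega)
      · simp [r7, r10, hpw]
      · simpa [r10] using hTi
      · simp [r10, r4, Function.update_apply]
        split <;> omega
      · refine hP _ _ ⟨i, by omega, i, by omega, rfl, ?_, ?_⟩
        · simp [blockCost, Instr.cost]; omega
        · have e0 : r' 0 = R := by
            rw [hr' 0 (by decide) (by decide) (by decide)]; exact r0
          have e1 : r' 1 = i := by
            rw [hr' 1 (by decide) (by decide) (by decide)]; exact r1
          simp [e0, e1, hout, r4, r10]
          refine ⟨fun f h7 h8 => by simp [h7, h8, hf], hI.push hS htg (by omega) ?_, ?_⟩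
          · intro j
            simp only [Function.update_apply]
            by_cases hx : j = X i <;> by_cases hy : j = Y i <;> simp only [hx, hy, if_true, if_false]
            · simp only [← hx, ← hy, if_true]
            · rw [if_neg (hx ▸ hy : ¬ X i = Y i), if_neg (hx ▸ hy : ¬ X i = Y i)]; omega
            · simp only [if_neg (hy ▸ hx : ¬ Y i = X i)]; omega
            · omega
          · intro j hj
            simp only [Function.update_apply]
            split_ifs <;> first | rfl | exact h8 j hj
  · rintro n T σ' ⟨i, hi, rfl, hT, h0, h1, hout, hf, hI, h8⟩ hlt
    simp only [ATest.Holds, h1] at hlt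
    obtain rfl : n = 0 := by omega
    exact hQ _ _ (by simp [blockCost, Instr.cost]; omega) h0 hout hf hI h8

/-! ### The decomposition into paths -/

/-- The numbers of nodes below and of paths above agree up to the rounding to powers of two. -/
def SameClass (bot T : ℕ → ℕ) (u c : ℕ) : Prop := pw (bot u) = pw (bot c) ∧ pw (T u) = pw (T c)

open Classical in
/-- `1` or `2` if the left or right argument has the class of `u`, and `0` otherwise. -/
noncomputable def kind (tag X Y bot T : ℕ → ℕ) (u : ℕ) : ℕ :=
  if tag u = 1 then 0 else if SameClass bot T u (X u) then 1
    else if SameClass bot T u (Y u) then 2 else 0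

/-- The argument in the same class, if there is one. -/
noncomputable def heavy (tag X Y bot T : ℕ → ℕ) (u : ℕ) : ℕ :=
  if kind tag X Y bot T u = 1 then X u else Y u

/-- The other argument. -/
noncomputable def light (tag X Y bot T : ℕ → ℕ) (u : ℕ) : ℕ :=
  if kind tag X Y bot T u = 1 then Y u else X u

/-- The nodes `u < i` with a heavy argument are recorded at this argument by their value of `T`. -/
def HeavyInv (R : ℕ) (tag X Y bot T : ℕ → ℕ) (i : ℕ) (S : ℕ → ℕ) : Prop :=
  ∀ c < R, (∃ u < i, kind tag X Y bot T u ≠ 0 ∧ heavy tag X Y bot T u = c ∧ S c = T u) ∨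
    (S c = 0 ∧ ∀ u < i, kind tag X Y bot T u ≠ 0 → heavy tag X Y bot T u ≠ c)

section

variable {k R : ℕ} {tag X Y bot T S : ℕ → ℕ} {u u' : ℕ}

theorem kind_cases (h : kind tag X Y bot T u ≠ 0) : tag u ≠ 1 ∧
    SameClass bot T u (heavy tag X Y bot T u) ∧
    (kind tag X Y bot T u = 1 ∧ heavy tag X Y bot T u = X u ∧ light tag X Y bot T u = Y u ∨
      kind tag X Y bot T u = 2 ∧ heavy tag X Y bot T u = Y u ∧ light tag X Y bot T u = X u) := by
  unfold heavy light
  unfold kind at *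
  split_ifs at * <;> simp_all

theorem not_sameClass_of_kind (h : kind tag X Y bot T u = 0) (ht : tag u ≠ 1) :
    ¬ SameClass bot T u (X u) ∧ ¬ SameClass bot T u (Y u) := by
  unfold kind at *
  split_ifs at * <;> simp_all

theorem heavy_lt (hS : Slp k R tag X Y bot) (hu : u < R) (h : kind tag X Y bot T u ≠ 0) :
    heavy tag X Y bot T u < u ∧ light tag X Y bot T u < u ∧
      bot u = 1 + bot (heavy tag X Y bot T u) + bot (light tag X Y bot T u) := by
  obtain ⟨ht, -, h⟩ := kind_cases h
  obtain ⟨-, hX, hY, hb⟩ := hS.binary hu ht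
  rcases h with ⟨-, h1, h2⟩ | ⟨-, h1, h2⟩ <;> rw [h1, h2] <;> omega

/-- If both arguments were in the class of `u`, then `bot u ≥ 1 + 2 * pw (bot u)`, which exceeds
`bot u`. -/
theorem not_sameClass_light (hS : Slp k R tag X Y bot) (hu : u < R)
    (h : kind tag X Y bot T u ≠ 0) : ¬ SameClass bot T u (light tag X Y bot T u) := by
  intro hl
  obtain ⟨h1, h2, hb⟩ := heavy_lt hS hu h
  obtain ⟨-, hs, -⟩ := kind_cases h
  have h3 := pw_le (bot (heavy tag X Y bot T u))
  have h4 := pw_le (bot (light tag X Y bot T u))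
  have h5 := lt_two_pw (hS.bot_pos hu)
  have h6 := hs.1
  have h7 := hl.1
  omega

/-- Two different edges into `c` give `T u + T u' ≤ T c`. If both were heavy, each summand would be
at least `pw (T c)`, contrary to `T c < 2 * pw (T c)`. This is what makes the heavy edges paths
rather than trees. -/
theorem heavy_injective (hS : Slp k R tag X Y bot) (hT : TopInv R tag X Y bot 0 T) (hu : u < R)
    (hu' : u' < R) (h : kind tag X Y bot T u ≠ 0) (h' : kind tag X Y bot T u' ≠ 0)
    (he : heavy tag X Y bot T u = heavy tag X Y bot T u') : u = u' := by
  by_contra hne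
  obtain ⟨h1, -, -⟩ := heavy_lt hS hu h
  obtain ⟨ht, hs, hc⟩ := kind_cases h
  obtain ⟨ht', hs', hc'⟩ := kind_cases h'
  have hb : ∃ b, heavy tag X Y bot T u = arg X Y b u := by
    rcases hc with ⟨-, h, -⟩ | ⟨-, h, -⟩
    · exact ⟨true, h⟩
    · exact ⟨false, h⟩
  have hb' : ∃ b, heavy tag X Y bot T u' = arg X Y b u' := by
    rcases hc' with ⟨-, h, -⟩ | ⟨-, h, -⟩
    · exact ⟨true, h⟩
    · exact ⟨false, h⟩
  obtain ⟨b, hb⟩ := hb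
  obtain ⟨b', hb'⟩ := hb'
  have hp := hT.pair b u b' u' (Nat.zero_le _) hu ht (Nat.zero_le _) hu' ht' (fun h => hne h.2)
    (by rw [← hb, ← hb', he])
  rw [← hb] at hp
  have h2 := hs.2
  have h3 := hs'.2
  rw [← he] at h3
  have h4 := pw_le (T u)
  have h5 := pw_le (T u')
  have h6 := lt_two_pw (hT.pos hS (j := heavy tag X Y bot T u) (by omega) (by omega))
  omega

theorem HeavyInv.heavy_eq (hS : Slp k R tag X Y bot) (hT : TopInv R tag X Y bot 0 T)
    (hI : HeavyInv R tag X Y bot T R S) (hu : u < R) (h : kind tag X Y bot T u ≠ 0) :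
    S (heavy tag X Y bot T u) = T u := by
  obtain ⟨h1, -, -⟩ := heavy_lt hS hu h
  rcases hI (heavy tag X Y bot T u) (by omega) with ⟨v, hv, hk, hh, hs⟩ | ⟨-, hn⟩
  · rw [hs, heavy_injective hS hT hv hu hk h hh]
  · exact absurd rfl (hn u hu h)

/-- The edge from `u` is not the heavy edge whose source is recorded in `S`, so the paths through
the two edges are counted separately in `T` of the common argument. -/
theorem HeavyInv.light_le (hT : TopInv R tag X Y bot 0 T)
    (hI : HeavyInv R tag X Y bot T R S) {b : Bool} (hu : u < R) (ht : tag u ≠ 1)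
    (hc : arg X Y b u < R) (hn : ¬ SameClass bot T u (arg X Y b u) ∨
      kind tag X Y bot T u = if b then 2 else 1) : T u + S (arg X Y b u) ≤ T (arg X Y b u) := by
  rcases hI _ hc with ⟨v, hv, hk, hh, hs⟩ | ⟨hs, -⟩
  · rw [hs]
    obtain ⟨htv, hcv, hkv⟩ := kind_cases hk
    have : ∃ b', heavy tag X Y bot T v = arg X Y b' v ∧
        kind tag X Y bot T v = if b' then 1 else 2 := by
      rcases hkv with ⟨h1, h, -⟩ | ⟨h1, h, -⟩
      · exact ⟨true, h, h1⟩
      · exact ⟨false, h, h1⟩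
    obtain ⟨b', hb', hk'⟩ := this
    refine hT.pair b u b' v (Nat.zero_le _) hu ht (Nat.zero_le _) hv htv ?_ (by rw [← hb', hh])
    rintro ⟨rfl, rfl⟩
    rcases hn with hn | hn
    · rw [← hb'] at hn; exact hn hcv
    · rw [hk'] at hn
      cases b <;> simp at hn
  · rw [hs]
    exact hT.edge b u (Nat.zero_le _) hu ht

end

/-- Register `16` becomes `0` if the registers `10` and `12` agree and the registers `11` and `13`
agree, and `1` otherwise. -/
def cmpCode : Prog :=
  .seq (block [.imm 16 1]) <| .ite (ATest.eq 10 12).code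
    (.ite (ATest.eq 11 13).code (block [.imm 16 0]) (block [])) (block [])

theorem WP.cmpCode {E : Env} {Q : ℕ → AState → Prop} {σ : AState}
    (hQ : ∀ t ≤ 6, Q t ⟨Function.update σ.reg 16
      (if σ.reg 10 = σ.reg 12 ∧ σ.reg 11 = σ.reg 13 then 0 else 1), σ.fld, σ.out⟩) :
    WP E cmpCode Q σ := by
  refine WP.seq (WP.block (by simp [BlockOk, Instr.Ok]) ?_)
  simp only [blockStep, Instr.step]
  refine WP.ite (fun h1 => WP.ite (fun h2 => WP.block (by simp [BlockOk, Instr.Ok]) ?_)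
    (fun h2 => WP.block trivial ?_)) (fun h1 => WP.block trivial ?_)
  · simp [ATest.Holds] at h1 h2
    rw [if_pos ⟨h1, h2⟩] at hQ
    simpa [blockStep, Instr.step] using hQ _ (by simp [blockCost, Instr.cost])
  · simp [ATest.Holds] at h1 h2
    rw [if_neg (fun h => h2 h.2)] at hQ
    exact hQ _ (by simp [blockCost, Instr.cost])
  · simp [ATest.Holds] at h1
    rw [if_neg (fun h => h1 h.1)] at hQ
    exact hQ _ (by simp [blockCost, Instr.cost])

/-- Computes the arrays `kind` and `S` in the fields `10` and `9`. -/
def kindCode : Prog :=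
  .seq (block [.imm 1 0]) <| .loop (ATest.lt 1 0).code <|
    .seq (block [.get 2 2 1, .imm 9 1]) <|
    .seq (.ite (ATest.eq 2 9).code (block []) <|
      .seq (block [.get 3 3 1, .get 4 4 1, .get 10 6 1, .get 11 8 1, .get 14 7 1,
        .get 12 6 3, .get 13 8 3]) <| .seq cmpCode <|
      .ite (ATest.zero 16).code (block [.imm 15 1, .put 10 1 15, .put 9 3 14]) <|
      .seq (block [.get 12 6 4, .get 13 8 4]) <| .seq cmpCode <|
      .ite (ATest.zero 16).code (block [.imm 15 2, .put 10 1 15, .put 9 4 14]) (block [])) <|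
    block [.imm 9 1, .op .add 1 1 9]

theorem WP.kindCode {k R : ℕ} {tag X Y bot T : ℕ → ℕ} (hS : Slp k R tag X Y bot)
    (hT : TopInv R tag X Y bot 0 T) {E : Env}
    {Q : ℕ → AState → Prop} {σ : AState} (hR : R ≤ E.m) (hn : 1000 * bot (R - 1) ≤ 2 ^ E.w)
    (r0 : σ.reg 0 = R) (f2 : σ.fld 2 = tag) (f3 : σ.fld 3 = X) (f4 : σ.fld 4 = Y)
    (f7 : σ.fld 7 = T) (f6 : ∀ i < R, σ.fld 6 i = pw (bot i)) (f8 : ∀ i < R, σ.fld 8 i = pw (T i))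
    (f9 : ∀ i < R, σ.fld 9 i = 0) (f10 : ∀ i < R, σ.fld 10 i = 0)
    (hQ : ∀ t σ', t ≤ 300 * R + 10 → σ'.reg 0 = R → σ'.out = σ.out →
      (∀ f, f ≠ 9 → f ≠ 10 → σ'.fld f = σ.fld f) →
      (∀ i < R, σ'.fld 10 i = kind tag X Y bot T i) → HeavyInv R tag X Y bot T R (σ'.fld 9) →
      Q t σ') : WP E kindCode Q σ := by
  have hb := E.bound
  refine WP.seq (WP.block (by simp [BlockOk, Instr.Ok]) ?_)
  refine WP.loop (fun n time σ' => ∃ i ≤ R, n = R - i ∧ time ≤ 300 * i ∧ σ'.reg 0 = R ∧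
    σ'.reg 1 = i ∧ σ'.out = σ.out ∧ (∀ f, f ≠ 9 → f ≠ 10 → σ'.fld f = σ.fld f) ∧
    (∀ j < R, σ'.fld 10 j = if j < i then kind tag X Y bot T j else 0) ∧
    HeavyInv R tag X Y bot T i (σ'.fld 9))
    ⟨0, by omega, rfl, by omega, by simpa [blockStep, Instr.step] using r0,
      by simp [blockStep, Instr.step], rfl, fun _ _ _ => rfl, by simpa [blockStep, Instr.step] using f10,
      fun c hc => .inr ⟨by simpa [blockStep, Instr.step] using f9 c hc, by simp⟩⟩ ?_ ?_
  · rintro n time σ' P ⟨i, hi, rfl, htime, h0, h1, hout, hf, hk, hI⟩ hlt hP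
    simp only [ATest.Holds, h0, h1] at hlt
    have g2 : σ'.fld 2 = tag := by rw [hf 2 (by decide) (by decide), f2]
    have g3 : σ'.fld 3 = X := by rw [hf 3 (by decide) (by decide), f3]
    have g4 : σ'.fld 4 = Y := by rw [hf 4 (by decide) (by decide), f4]
    have g7 : σ'.fld 7 = T := by rw [hf 7 (by decide) (by decide), f7]
    have g6 : ∀ i < R, σ'.fld 6 i = pw (bot i) := by rw [hf 6 (by decide) (by decide)]; exact f6
    have g8 : ∀ i < R, σ'.fld 8 i = pw (T i) := by rw [hf 8 (by decide) (by decide)]; exact f8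
    refine WP.seq (WP.block (by simp [BlockOk, Instr.Ok, Instr.step, h1]; omega) ?_)
    refine WP.seq (WP.mono (Q' := fun t σ'' => t ≤ 200 ∧ σ''.reg 0 = R ∧
      σ''.reg 1 = i ∧ σ''.out = σ.out ∧ (∀ f, f ≠ 9 → f ≠ 10 → σ''.fld f = σ.fld f) ∧
      (∀ j < R, σ''.fld 10 j = if j < i + 1 then kind tag X Y bot T j else 0) ∧
      HeavyInv R tag X Y bot T (i + 1) (σ''.fld 9)) ?_ ?_)
    · simp only [blockStep, Instr.step]
      -- Without a heavy argument nothing is written, since the entry of `kind` is still its initial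
      -- `0`.
      have step0 : kind tag X Y bot T i = 0 →
          (∀ j < R, σ'.fld 10 j = if j < i + 1 then kind tag X Y bot T j else 0) ∧
          HeavyInv R tag X Y bot T (i + 1) (σ'.fld 9) := by
        intro h0
        refine ⟨fun j hj => ?_, fun c hc => ?_⟩
        · rw [hk j hj]
          by_cases hji : j = i
          · subst hji; simp [h0]
          · have : j < i ↔ j < i + 1 := by omega
            simp [this]
        · rcases hI c hc with ⟨u, hu, h⟩ | ⟨hs, h⟩
          · exact .inl ⟨u, by omega, h⟩
          · refine .inr ⟨hs, fun u hu hku => ?_⟩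
            by_cases hui : u = i
            · subst hui; exact absurd h0 hku
            · exact h u (by omega) hku
      have step1 : kind tag X Y bot T i ≠ 0 →
          (∀ j < R, Function.update (σ'.fld 10) i (kind tag X Y bot T i) j =
            if j < i + 1 then kind tag X Y bot T j else 0) ∧
          HeavyInv R tag X Y bot T (i + 1)
            (Function.update (σ'.fld 9) (heavy tag X Y bot T i) (T i)) := by
        intro h0
        refine ⟨fun j hj => ?_, fun c hc => ?_⟩
        · by_cases hji : j = i
          · subst hji; simp
          · have : j < i ↔ j < i + 1 := by omega
            simp [hji, hk j hj, this]
        · by_cases hch : c = heavy tag X Y bot T i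
          · exact .inl ⟨i, by omega, h0, hch.symm, by simp [hch]⟩
          · simp only [Function.update_apply, if_neg hch]
            rcases hI c hc with ⟨u, hu, h⟩ | ⟨hs, h⟩
            · exact .inl ⟨u, by omega, h⟩
            · refine .inr ⟨hs, fun u hu hku => ?_⟩
              by_cases hui : u = i
              · subst hui; exact Ne.symm hch
              · exact h u (by omega) hku
      refine WP.ite (fun ht => WP.block trivial ?_) (fun ht => ?_)
      · simp [ATest.Holds, h1, g2] at ht
        simp [blockStep, blockCost, h0, h1, hout, -Order.lt_add_one_iff]
        exact ⟨hf, step0 (by simp [kind, ht])⟩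
      · simp [ATest.Holds, h1, g2] at ht
        obtain ⟨htag, hX, hY, hbot⟩ := hS.binary hlt ht
        refine WP.seq (WP.block ?_ ?_)
        · simp [BlockOk, Instr.Ok, Instr.step, h1, g3, g4]; omega
        simp only [blockStep, Instr.step]
        simp [h1, g3, g4, g7, g6 i hlt, g6 (X i) (by omega), g8 i hlt, g8 (X i) (by omega),
          -Order.lt_add_one_iff]
        refine WP.seq (WP.cmpCode fun t1 ht1 => ?_)
        refine WP.ite (fun hz => WP.block ?_ ?_) (fun hz => WP.seq (WP.block ?_ ?_))
        · simp [BlockOk, Instr.Ok, Instr.step, h1]; omega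
        · have hk1 : kind tag X Y bot T i = 1 := by
            unfold kind SameClass
            rw [if_neg ht, if_pos (by simpa [ATest.Holds] using hz)]
          have hh : heavy tag X Y bot T i = X i := by simp [heavy, hk1]
          have := step1 (by omega)
          rw [hh, hk1] at this
          simp [blockStep, Instr.step, blockCost, Instr.cost, h0, h1, hout, -Order.lt_add_one_iff]
          exact ⟨by omega, fun f h9 h10 => by simp [h9, h10, hf], this⟩
        · simp [BlockOk, Instr.Ok, Instr.step]; omega
        have hz1 : ¬ SameClass bot T i (X i) := by
          simpa [ATest.Holds, SameClass] using hz
        clear hz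
        simp [blockStep, Instr.step, g6 (Y i) (by omega), g8 (Y i) (by omega),
          -Order.lt_add_one_iff]
        refine WP.seq (WP.cmpCode fun t2 ht2 => ?_)
        refine WP.ite (fun hz => WP.block ?_ ?_) (fun hz => WP.block trivial ?_)
        · simp [BlockOk, Instr.Ok, Instr.step, h1]; omega
        · have hk1 : kind tag X Y bot T i = 2 := by
            unfold kind
            rw [if_neg ht, if_neg hz1, if_pos (by simpa [ATest.Holds, SameClass] using hz)]
          have hh : heavy tag X Y bot T i = Y i := by simp [heavy, hk1]
          have := step1 (by omega)
          rw [hh, hk1] at this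
          simp [blockStep, Instr.step, blockCost, Instr.cost, h0, h1, hout, -Order.lt_add_one_iff]
          exact ⟨by omega, fun f h9 h10 => by simp [h9, h10, hf], this⟩
        · have hk1 : kind tag X Y bot T i = 0 := by
            unfold kind
            rw [if_neg ht, if_neg hz1, if_neg (by simpa [ATest.Holds, SameClass] using hz)]
          simp [blockStep, Instr.step, blockCost, Instr.cost, h0, h1, hout, -Order.lt_add_one_iff]
          exact ⟨by omega, hf, step0 hk1⟩
    · rintro t σ'' ⟨ht, h0', h1', hout', hf', hk', hI'⟩
      refine WP.block ?_ ?_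
      · simp [BlockOk, Instr.Ok, Instr.step, Op.eval, h1']; omega
      · refine hP _ _ ⟨R - (i + 1), by omega, i + 1, by omega, rfl, ?_, ?_⟩
        · simp [blockCost, Instr.cost]; omega
        · simp [blockStep, Instr.step, Op.eval, h0', h1', hout', -Order.lt_add_one_iff]
          exact ⟨hf', hk', hI'⟩
  · rintro n time σ' ⟨i, hi, rfl, htime, h0, h1, hout, hf, hk, hI⟩ hlt
    simp only [ATest.Holds, h0, h1] at hlt
    obtain rfl : i = R := by omega
    refine hQ _ _ (by simp [blockCost, Instr.cost]; omega) h0 hout hf (fun j hj => ?_) hI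
    rw [hk j hj, if_pos hj]

/-! ### Weights and depths -/

/-- Twice the binary logarithm, rounded down. -/
def lam (q : ℕ) : ℕ := Nat.log 2 (q ^ 2)

theorem lam_mono {x y : ℕ} (h : x ≤ y) : lam x ≤ lam y :=
  Nat.log_mono_right (Nat.pow_le_pow_left h 2)

/-- Because `(3/2) ^ 2 ≥ 2`. The doubled logarithm is used so that growth by a factor `3/2` is
already noticed. -/
theorem lam_succ_le {x y : ℕ} (hx : 0 < x) (h : 3 * x ≤ 2 * y) : lam x + 1 ≤ lam y := by
  unfold lam
  rw [← Nat.log_mul_base (by norm_num) (by positivity)]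
  apply Nat.log_mono_right
  nlinarith

theorem lam_two_pow (e : ℕ) : lam (2 ^ e) = 2 * e := by
  rw [lam, ← pow_mul, Nat.log_pow (by norm_num), mul_comm]

theorem le_lam {e q : ℕ} (h : 2 ^ e ≤ q) : 2 * e ≤ lam q := by
  rw [← lam_two_pow]
  exact lam_mono h

theorem pw_eq {n : ℕ} (h : 0 < n) : pw n = 2 ^ Nat.log 2 n := if_neg (by omega)

theorem log_eq_of_pw_eq {n n' : ℕ} (h : 0 < n) (h' : 0 < n') (he : pw n = pw n') :
    Nat.log 2 n = Nat.log 2 n' := by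
  rw [pw_eq h, pw_eq h'] at he
  exact Nat.pow_right_injective le_rfl he

/-- An upper bound for the weights on a path. -/
def top8 (bot T : ℕ → ℕ) (j : ℕ) : ℕ := 8 * (pw (T j) * pw (bot j))

/-- The depth that is available below a path. -/
def budget (R : ℕ) (bot T : ℕ → ℕ) (j : ℕ) : ℕ :=
  69 * (Nat.log 2 (bot (R - 1)) - Nat.log 2 (T j) + Nat.log 2 (bot j))

/-- The data computed for the nodes: the weight `key` of the block starting at a node, the first
node `nxt` below this block, the affine function of the block with coefficients `fa`, `fb`, `fc`
and the gate `sv` that has the value of the node; moreover the total weight `sum` and the number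
`hgt` of the blocks from a node to the end of the path. -/
structure Arr where
  key : ℕ → ℕ
  nxt : ℕ → ℕ
  fa : ℕ → ℕ
  fb : ℕ → ℕ
  fc : ℕ → ℕ
  sv : ℕ → ℕ
  sum : ℕ → ℕ
  hgt : ℕ → ℕ

/-- Agreement below `i`. -/
structure Arr.Agree (B B' : Arr) (i : ℕ) : Prop where
  key : ∀ j < i, B'.key j = B.key j
  nxt : ∀ j < i, B'.nxt j = B.nxt j
  fa : ∀ j < i, B'.fa j = B.fa j
  fb : ∀ j < i, B'.fb j = B.fb j
  fc : ∀ j < i, B'.fc j = B.fc j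
  sv : ∀ j < i, B'.sv j = B.sv j
  sum : ∀ j < i, B'.sum j = B.sum j
  hgt : ∀ j < i, B'.hgt j = B.hgt j

/-- Changes the entries at `i`. -/
def Arr.set (B : Arr) (i key nxt fa fb fc sv sum hgt : ℕ) : Arr where
  key := Function.update B.key i key
  nxt := Function.update B.nxt i nxt
  fa := Function.update B.fa i fa
  fb := Function.update B.fb i fb
  fc := Function.update B.fc i fc
  sv := Function.update B.sv i sv
  sum := Function.update B.sum i sum
  hgt := Function.update B.hgt i hgt

theorem Arr.agree_set (B : Arr) (i key nxt fa fb fc sv sum hgt : ℕ) :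
    B.Agree (B.set i key nxt fa fb fc sv sum hgt) i := by
  constructor <;> intro j hj <;> simp [Arr.set, hj.ne]

/-- The arrays computed in the first phases. -/
structure Setup (k R : ℕ) (tag X Y bot T S : ℕ → ℕ) : Prop where
  slp : Slp k R tag X Y bot
  top : TopInv R tag X Y bot 0 T
  hvy : HeavyInv R tag X Y bot T R S

section

variable {A : Type*} [Add A] [Mul A] {k R : ℕ}

/-- `v` is the array of the values of the nodes. -/
structure Vals (a : Fin k → A) (R : ℕ) (tag X Y : ℕ → ℕ) (v : ℕ → A) : Prop where
  const : ∀ i < R, tag i = 1 → ∃ h : X i < k, v i = a ⟨X i, h⟩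
  add : ∀ i < R, tag i = 2 → v i = v (X i) + v (Y i)
  mul : ∀ i < R, tag i = 3 → v i = v (X i) * v (Y i)

variable (a : Fin k → A) (R) (tag X Y bot T S : ℕ → ℕ) (v : ℕ → A)

/-- The invariant of the nodes that have been processed. -/
structure NodeInv (B : Arr) (L : List (ℕ × ℕ × ℕ)) (j : ℕ) : Prop where
  base : kind tag X Y bot T j = 0 → B.key j = top8 bot T j ∧ B.sum j = 0 ∧ B.hgt j = 0
  block : kind tag X Y bot T j ≠ 0 → B.nxt j < j ∧ SameClass bot T j (B.nxt j) ∧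
    2 * B.key j ≤ B.key (B.nxt j) ∧ B.sum j = B.key j + B.sum (B.nxt j) ∧
    B.hgt j = B.hgt (B.nxt j) + 1 ∧
    (T j - S j) * pw (bot j) + bot (light tag X Y bot T j) * pw (T j) ≤ B.key j ∧
    ∃ D, FunDen a L (B.fa j) (B.fb j) (B.fc j) (v (B.nxt j)) (v j) D ∧
      D + 6 * lam (top8 bot T j) ≤ budget R bot T j + 6 * lam (B.key j)
  sum_le : B.sum j + pw (bot j) * S j ≤ pw (T j) * bot j + 2 * (pw (bot j) * pw (T j))
  hgt_le : B.hgt j ≤ j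
  value : ∃ D, DenO a L (B.sv j) (some (v j)) D ∧
    D + 3 * lam (B.key j) ≤ budget R bot T j + 3 * lam (top8 bot T j)

variable {a R tag X Y bot T S v}

/-- The invariant at `j` looks only at the entries of `j` and of `nxt j < j`, and gates are never
changed. -/
theorem NodeInv.congr {B B' : Arr} {L L' : List (ℕ × ℕ × ℕ)} {i j : ℕ}
    (h : NodeInv R a tag X Y bot T S v B L j) (hj : j < i) (hB : B.Agree B' i) (hL : L <+: L') :
    NodeInv R a tag X Y bot T S v B' L' j where
  base hk := by rw [hB.key j hj, hB.sum j hj, hB.hgt j hj]; exact h.base hk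
  block hk := by
    obtain ⟨h1, h2, h3, h4, h5, h6, D, h7, h8⟩ := h.block hk
    have hn : B.nxt j < i := by omega
    rw [hB.nxt j hj, hB.key j hj, hB.sum j hj, hB.hgt j hj, hB.key _ hn, hB.sum _ hn,
      hB.hgt _ hn, hB.fa j hj, hB.fb j hj, hB.fc j hj]
    exact ⟨h1, h2, h3, h4, h5, h6, D, h7.mono hL le_rfl, h8⟩
  sum_le := by rw [hB.sum j hj]; exact h.sum_le
  hgt_le := by rw [hB.hgt j hj]; exact h.hgt_le
  value := by
    obtain ⟨D, h1, h2⟩ := h.value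
    rw [hB.sv j hj, hB.key j hj]
    exact ⟨D, h1.mono hL le_rfl, h2⟩

end

/-! ### Depth across light edges and total weight of a path. -/

namespace Setup

variable {k R : ℕ} {tag X Y bot T S : ℕ → ℕ} {i j : ℕ}

theorem T_pos (h : Setup k R tag X Y bot T S) (hj : j < R) : 0 < T j :=
  h.top.pos h.slp hj (by omega)

theorem mul_le (h : Setup k R tag X Y bot T S) (hj : j < R) :
    pw (T j) * pw (bot j) ≤ bot (R - 1) :=
  (Nat.mul_le_mul (pw_le _) (pw_le _)).trans (h.top.le j (Nat.zero_le _) hj)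

theorem log_T_le (h : Setup k R tag X Y bot T S) (hj : j < R) :
    Nat.log 2 (T j) ≤ Nat.log 2 (bot (R - 1)) :=
  Nat.log_mono_right ((Nat.le_mul_of_pos_right _ (h.slp.bot_pos hj)).trans
    (h.top.le j (Nat.zero_le _) hj))

theorem lam_top8 (h : Setup k R tag X Y bot T S) (hj : j < R) :
    lam (top8 bot T j) = 6 + 2 * Nat.log 2 (T j) + 2 * Nat.log 2 (bot j) := by
  rw [top8, pw_eq (h.T_pos hj), pw_eq (h.slp.bot_pos hj), ← pow_add,
    show (8 : ℕ) = 2 ^ 3 from rfl, ← pow_add, lam_two_pow]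
  ring

theorem top8_eq {j j' : ℕ} (h : SameClass bot T j j') : top8 bot T j = top8 bot T j' := by
  rw [top8, top8, h.1, h.2]

theorem budget_eq (h : Setup k R tag X Y bot T S) {j j' : ℕ} (hj : j < R) (hj' : j' < R)
    (hs : SameClass bot T j j') : budget R bot T j = budget R bot T j' := by
  rw [budget, budget, log_eq_of_pw_eq (h.slp.bot_pos hj) (h.slp.bot_pos hj') hs.1,
    log_eq_of_pw_eq (h.T_pos hj) (h.T_pos hj') hs.2]

variable {A : Type*} [Add A] [Mul A] {a : Fin k → A} {v : ℕ → A}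

/-- The depth of an argument that is not on the path of `i`. -/
theorem light_depth (h : Setup k R tag X Y bot T S) {B : Arr} {L : List (ℕ × ℕ × ℕ)} {b : Bool}
    (hi : i < R) (ht : tag i ≠ 1) (hn : ¬ SameClass bot T i (arg X Y b i))
    (hN : NodeInv R a tag X Y bot T S v B L (arg X Y b i)) :
    ∃ D, DenO a L (B.sv (arg X Y b i)) (some (v (arg X Y b i))) D ∧ D + 1 ≤ budget R bot T i ∧
      ∀ p, bot (arg X Y b i) * pw (T i) ≤ p →
        D + 3 + 6 * lam (top8 bot T i) ≤ budget R bot T i + 6 * lam p := by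
  obtain ⟨D, hD, hle⟩ := hN.value
  obtain ⟨-, hX, hY, hbot⟩ := h.slp.binary hi ht
  set c := arg X Y b i with hc
  have hci : c < i := by rw [hc]; cases b <;> simpa [arg]
  have hcb : bot c ≤ bot i := by rw [hc]; cases b <;> simp [arg] <;> omega
  have hcR : c < R := by omega
  have hTi := h.T_pos hi
  have hTc := h.T_pos hcR
  have hbc := h.slp.bot_pos hcR
  have hbi := h.slp.bot_pos hi
  have hT : T i ≤ T c := h.top.edge b i (Nat.zero_le _) hi ht
  have lT := Nat.log_mono_right (b := 2) hT
  have lb := Nat.log_mono_right (b := 2) hcb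
  have lL := h.log_T_le hcR
  have hTS : T i + S c ≤ T c := h.hvy.light_le h.top hi ht hcR (.inl hn)
  -- Leaving the class changes one of the two logarithms, and by `lT` and `lb` it can only change in
  -- the direction that lowers the budget.
  have hne : Nat.log 2 (T c) ≠ Nat.log 2 (T i) ∨ Nat.log 2 (bot c) ≠ Nat.log 2 (bot i) := by
    by_contra hcon
    push Not at hcon
    exact hn ⟨by rw [pw_eq hbi, pw_eq hbc, hcon.2], by rw [pw_eq hTi, pw_eq hTc, hcon.1]⟩
  -- The block starting at `c` weighs at least `(T c - S c) * pw (bot c)`, and `T c - S c` includes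
  -- the paths that arrive through the light edge from `i`. This is the purpose of the first summand
  -- of `weight`.
  have hkey : 2 ^ (Nat.log 2 (T i) + Nat.log 2 (bot c)) ≤ B.key c := by
    rw [pow_add, ← pw_eq hTi, ← pw_eq hbc]
    by_cases hk : kind tag X Y bot T c = 0
    · rw [(hN.base hk).1, top8]
      have : pw (T i) ≤ pw (T c) := by
        rw [pw_eq hTi, pw_eq hTc]; exact Nat.pow_le_pow_right (by norm_num) lT
      have := Nat.mul_le_mul_right (pw (bot c)) this
      omega
    · have h1 := (hN.block hk).2.2.2.2.2.1
      have h2 : pw (T i) ≤ T c - S c := by have := pw_le (T i); omega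
      have := Nat.mul_le_mul_right (pw (bot c)) h2
      omega
  have l1 := le_lam hkey
  rw [h.lam_top8 hcR] at hle
  have hbd : budget R bot T c = 69 * (Nat.log 2 (bot (R - 1)) - Nat.log 2 (T c) + Nat.log 2 (bot c)) :=
    rfl
  have hbd' : budget R bot T i = 69 * (Nat.log 2 (bot (R - 1)) - Nat.log 2 (T i) + Nat.log 2 (bot i)) :=
    rfl
  -- The constant `69` comes from here. Let `s` and `t` be the changes of the logarithms of `T` and
  -- `bot` from `i` to `c`, so `s + t ≥ 1`. Evaluating `c` exceeds its own budget by at most `18 + 6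
  -- * s`, the requirement at `i` asks for at most `36 + 12 * t` more, and `3` is added; since `18 +
  -- 36 + 3 = 69 - 12`, the loss `69 * (s + t)` of budget covers everything.
  refine ⟨D, hD, by omega, fun p hp => ?_⟩
  have hp2 : 2 ^ (Nat.log 2 (T i) + Nat.log 2 (bot c)) ≤ p := by
    rw [pow_add, ← pw_eq hTi, ← pw_eq hbc]
    refine le_trans ?_ hp
    rw [mul_comm]
    exact Nat.mul_le_mul_right _ (pw_le _)
  have l2 := le_lam hp2
  rw [h.lam_top8 hi]
  omega

end Setup

/-- The weight of a node in the block that starts with it. -/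
noncomputable def weight (tag X Y bot T S : ℕ → ℕ) (i : ℕ) : ℕ :=
  (T i - S i) * pw (bot i) + bot (light tag X Y bot T i) * pw (T i)

/-- `heavy` and `light` are the two arguments. -/
theorem exists_arg {tag X Y bot T : ℕ → ℕ} {i : ℕ} (hk : kind tag X Y bot T i ≠ 0) :
    ∃ b, light tag X Y bot T i = arg X Y b i := by
  rcases (kind_cases hk).2.2 with ⟨-, -, h⟩ | ⟨-, -, h⟩
  · exact ⟨false, h⟩
  · exact ⟨true, h⟩

namespace Setup

variable {k R : ℕ} {tag X Y bot T S : ℕ → ℕ} {i j : ℕ}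

theorem S_le (h : Setup k R tag X Y bot T S) (hi : i < R) : S i ≤ T i := by
  rcases h.hvy i hi with ⟨u, hu, hk, hh, hs⟩ | ⟨hs, -⟩
  · rw [hs]
    obtain ⟨ht, -, hc⟩ := kind_cases hk
    rcases hc with ⟨-, hc, -⟩ | ⟨-, hc, -⟩
    · have := h.top.edge true u (Nat.zero_le _) hu ht
      rwa [show arg X Y true u = X u from rfl, ← hc, hh] at this
    · have := h.top.edge false u (Nat.zero_le _) hu ht
      rwa [show arg X Y false u = Y u from rfl, ← hc, hh] at this
  · omega

variable {A : Type*} [Add A] [Mul A] {a : Fin k → A} {v : ℕ → A} {B : Arr}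
  {L : List (ℕ × ℕ × ℕ)}

/-- The end of a path has no block of its own. It gets the key `top8`, which acts as a sentinel that
no collected weight can reach. -/
theorem nodeInv_base (h : Setup k R tag X Y bot T S) (hi : i < R)
    (hk : kind tag X Y bot T i = 0) (hkey : B.key i = top8 bot T i) (hsum : B.sum i = 0)
    (hhgt : B.hgt i = 0) {D : ℕ} (hD : DenO a L (B.sv i) (some (v i)) D)
    (hb : D ≤ budget R bot T i) : NodeInv R a tag X Y bot T S v B L i where
  base _ := ⟨hkey, hsum, hhgt⟩
  block h := absurd hk h
  sum_le := by
    have h1 := h.S_le hi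
    have h2 := lt_two_pw (h.T_pos hi)
    have : pw (bot i) * S i ≤ pw (bot i) * (2 * pw (T i)) := Nat.mul_le_mul_left _ (by omega)
    rw [hsum]
    nlinarith
  hgt_le := by omega
  value := ⟨D, hD, by rw [hkey]; omega⟩

/-- Both parts of the weights telescope along the path: `S` at the heavy argument is `T i`, so the
terms `(T - S) * pw bot` collapse, and `bot (light)` is less than `bot i - bot (heavy)`. The rounded
factors are constant on the path. The term with `S` makes the statement inductive. -/
theorem weight_sum_le (h : Setup k R tag X Y bot T S) (hi : i < R)
    (hk : kind tag X Y bot T i ≠ 0)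
    (hN : NodeInv R a tag X Y bot T S v B L (heavy tag X Y bot T i)) :
    weight tag X Y bot T S i + B.sum (heavy tag X Y bot T i) + pw (bot i) * S i ≤
      pw (T i) * bot i + 2 * (pw (bot i) * pw (T i)) := by
  have h1 := hN.sum_le
  obtain ⟨-, hs, -⟩ := kind_cases hk
  obtain ⟨-, -, hb⟩ := heavy_lt h.slp hi hk
  rw [h.hvy.heavy_eq h.slp h.top hi hk, ← hs.1, ← hs.2] at h1
  obtain ⟨e, he⟩ := Nat.exists_eq_add_of_le (h.S_le hi)
  have : T i - S i = e := by omega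
  rw [weight, this]
  generalize pw (bot i) = p at *
  generalize pw (T i) = r at *
  rw [hb]
  rw [he] at h1
  have e1 : p * (S i + e) = p * S i + e * p := by ring
  have e2 : r * (1 + bot (heavy tag X Y bot T i) + bot (light tag X Y bot T i)) =
    r + r * bot (heavy tag X Y bot T i) + bot (light tag X Y bot T i) * r := by ring
  omega

/-- As `bot i < 2 * pw (bot i)`, the previous bound is below `4 * pw (T i) * pw (bot i)`; this
explains the factor `8` in `top8`. -/
theorem weight_sum_lt (h : Setup k R tag X Y bot T S) (hi : i < R)
    (hk : kind tag X Y bot T i ≠ 0)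
    (hN : NodeInv R a tag X Y bot T S v B L (heavy tag X Y bot T i)) :
    2 * (weight tag X Y bot T S i + B.sum (heavy tag X Y bot T i)) < top8 bot T i := by
  have h1 := h.weight_sum_le hi hk hN
  have h2 := lt_two_pw (h.slp.bot_pos hi)
  have h3 := pw_pos (h.T_pos hi)
  have : pw (T i) * bot i < pw (T i) * (2 * pw (bot i)) := Nat.mul_lt_mul_of_pos_left h2 h3
  rw [top8]
  nlinarith

end Setup

/-! ### Collecting blocks: correctness and depth. -/

section

variable {A : Type*} [Add A] [Mul A] {k : ℕ}

/-- The invariant of the loop that collects the blocks following the node `i`: the blocks before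
`cur` have been collected, their weights and the weight of `i` have the sum `q`, and `y₁`, `y₂`, `y₃`
are the coefficients of their composition. -/
structure PopInv (R : ℕ) (a : Fin k → A) (tag X Y bot T S : ℕ → ℕ) (v : ℕ → A) (B : Arr)
    (L₀ L : List (ℕ × ℕ × ℕ)) (i cur q n y₁ y₂ y₃ : ℕ) : Prop where
  grow : Grow k L₀ L (5 * n)
  lt : cur < i
  same : SameClass bot T i cur
  sum : q + B.sum cur = weight tag X Y bot T S i + B.sum (heavy tag X Y bot T i)
  hgt : n + B.hgt cur = B.hgt (heavy tag X Y bot T i)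
  le : weight tag X Y bot T S i ≤ q
  den : ∃ D, FunDen a L y₁ y₂ y₃ (v cur) (v (heavy tag X Y bot T i)) D ∧
    D + 6 * lam (top8 bot T i) ≤ budget R bot T i + 6 * lam (B.key cur) ∧
    D + 3 + 6 * lam (top8 bot T i) ≤ budget R bot T i + 6 * lam q

variable {R : ℕ} {a : Fin k → A} {tag X Y bot T S : ℕ → ℕ} {v : ℕ → A} {B : Arr}
    {L₀ L L' : List (ℕ × ℕ × ℕ)} {i cur q n y₁ y₂ y₃ : ℕ}

theorem Setup.weight_pos (h : Setup k R tag X Y bot T S) (hi : i < R)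
    (hk : kind tag X Y bot T i ≠ 0) : 0 < weight tag X Y bot T S i := by
  obtain ⟨-, hl, -⟩ := heavy_lt h.slp hi hk
  have := Nat.mul_pos (h.slp.bot_pos (i := light tag X Y bot T i) (by omega)) (pw_pos (h.T_pos hi))
  rw [weight]
  omega

theorem Setup.light_depth' (h : Setup k R tag X Y bot T S) (hi : i < R)
    (hk : kind tag X Y bot T i ≠ 0)
    (hN : NodeInv R a tag X Y bot T S v B L (light tag X Y bot T i)) :
    ∃ D, DenO a L (B.sv (light tag X Y bot T i)) (some (v (light tag X Y bot T i))) D ∧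
      ∀ q, weight tag X Y bot T S i ≤ q →
        D + 3 + 6 * lam (top8 bot T i) ≤ budget R bot T i + 6 * lam q := by
  obtain ⟨b, hb⟩ := exists_arg hk
  have hn := not_sameClass_light h.slp hi hk
  rw [hb] at hn hN
  obtain ⟨D, h1, -, h2⟩ := h.light_depth hi (kind_cases hk).1 hn hN
  rw [hb]
  refine ⟨D, h1, fun q hq => h2 q ?_⟩
  rw [weight, hb] at hq
  omega

namespace PopInv

theorem init (h : Setup k R tag X Y bot T S) (hi : i < R) (hk : kind tag X Y bot T i ≠ 0)
    (hN : ∀ j < i, NodeInv R a tag X Y bot T S v B L j) :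
    PopInv R a tag X Y bot T S v B L L i (heavy tag X Y bot T i) (weight tag X Y bot T S i) 0
      0 0 0 := by
  obtain ⟨h1, h2, -⟩ := heavy_lt h.slp hi hk
  obtain ⟨-, hs, -⟩ := kind_cases hk
  -- The empty composition has depth `0`, but the invariant still needs room for it; the inequality
  -- for the light argument provides this.
  obtain ⟨D, -, hD⟩ := h.light_depth' hi hk (hN _ h2)
  refine ⟨Grow.refl _ _, h1, hs, rfl, by omega, le_rfl, 0, FunDen.id _ _ _ _, ?_, ?_⟩
  · rw [Setup.top8_eq hs, h.budget_eq hi (by omega) hs]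
    by_cases hk' : kind tag X Y bot T (heavy tag X Y bot T i) = 0
    · rw [((hN _ h1).base hk').1]; omega
    · obtain ⟨-, -, -, -, -, -, D, -, hD⟩ := (hN _ h1).block hk'
      omega
  · have := hD _ le_rfl
    omega

theorem q_lt (hP : PopInv R a tag X Y bot T S v B L₀ L i cur q n y₁ y₂ y₃)
    (h : Setup k R tag X Y bot T S) (hi : i < R) (hk : kind tag X Y bot T i ≠ 0)
    (hN : ∀ j < i, NodeInv R a tag X Y bot T S v B L₀ j) : 2 * q < top8 bot T i := by
  have h1 := h.weight_sum_lt hi hk (hN _ (heavy_lt h.slp hi hk).1)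
  have := hP.sum
  omega

/-- Both the composition collected so far and the next block have a depth bounded in terms of `key
cur`. Composing adds `3`, and the two bounds in `den` need this once for the next key and twice for
the new weight `q + key cur`; each of these exceeds `key cur` by a factor `3/2`, which contributes
`6`. -/
theorem step (hP : PopInv R a tag X Y bot T S v B L₀ L i cur q n y₁ y₂ y₃)
    (h : Setup k R tag X Y bot T S) (hi : i < R) (hk : kind tag X Y bot T i ≠ 0)
    (hN : ∀ j < i, NodeInv R a tag X Y bot T S v B L₀ j) (hq : B.key cur < 2 * q) :
    0 < B.hgt cur ∧
    ∃ D, FunDen a L y₁ y₂ y₃ (v cur) (v (heavy tag X Y bot T i)) D ∧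
      FunDen a L (B.fa cur) (B.fb cur) (B.fc cur) (v (B.nxt cur)) (v cur) D ∧
      ∀ L' z₁ z₂ z₃, Grow k L L' 5 →
        FunDen a L' z₁ z₂ z₃ (v (B.nxt cur)) (v (heavy tag X Y bot T i)) (D + 3) →
        PopInv R a tag X Y bot T S v B L₀ L' i (B.nxt cur) (q + B.key cur) (n + 1) z₁ z₂ z₃ := by
  have hql := hP.q_lt h hi hk hN
  have hw := h.weight_pos hi hk
  have hcur := hP.lt
  have hle := hP.le
  -- At the end of the path the key would be `top8 > 2 * q`, so the loop would have stopped.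
  have hkc : kind tag X Y bot T cur ≠ 0 := by
    intro h0
    rw [((hN cur hcur).base h0).1, ← Setup.top8_eq hP.same] at hq
    omega
  obtain ⟨h1, h2, h3, h4, h5, h6, D, h7, h8⟩ := (hN cur hcur).block hkc
  have hkp : 0 < B.key cur := (h.weight_pos (by omega) hkc).trans_le h6
  refine ⟨by omega, ?_⟩
  obtain ⟨E, e1, e2, e3⟩ := hP.den
  rw [← Setup.top8_eq hP.same, ← h.budget_eq hi (by omega) hP.same] at h8
  -- Keys double from block to block, and the loop test gives `key cur < 2 * q`, that is, `3 * key
  -- cur < 2 * (q + key cur)`.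
  have l1 := lam_succ_le (x := B.key cur) (y := B.key (B.nxt cur)) hkp (by omega)
  have l2 := lam_succ_le (x := B.key cur) (y := q + B.key cur) hkp (by omega)
  have p1 := hP.grow.isPrefix
  refine ⟨max E D, e1.mono List.prefix_rfl (le_max_left _ _), h7.mono p1 (le_max_right _ _),
    fun L' z₁ z₂ z₃ hg hz => ⟨(hP.grow.trans hg).mono (by omega), by omega,
    ⟨hP.same.1.trans h2.1, hP.same.2.trans h2.2⟩, ?_, ?_, by omega, max E D + 3, hz, by omega,
    by omega⟩⟩
  · have := hP.sum; omega
  · have := hP.hgt; omega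

/-- The failed loop test `2 * q ≤ key cur` is exactly the doubling that the new block must satisfy.
It also pays for the three levels that separate the value of `i` from the value of `cur`. If instead
the new function is the deeper part, `2 * q < top8` leaves enough room. -/
theorem finish (hP : PopInv R a tag X Y bot T S v B L₀ L i cur q n y₁ y₂ y₃)
    (h : Setup k R tag X Y bot T S) (hi : i < R) (hk : kind tag X Y bot T i ≠ 0)
    (hN : ∀ j < i, NodeInv R a tag X Y bot T S v B L₀ j) (hq : ¬ B.key cur < 2 * q) :
    ∃ D, FunDen a L y₁ y₂ y₃ (v cur) (v (heavy tag X Y bot T i)) D ∧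
      DenO a L (B.sv (light tag X Y bot T i)) (some (v (light tag X Y bot T i))) D ∧
      ∃ D', D + 3 ≤ D' ∧ DenO a L (B.sv cur) (some (v cur)) D' ∧
      ∀ L' fa fb fc s, L₀ <+: L' → FunDen a L' fa fb fc (v cur) (v i) (D + 3) →
        DenO a L' s (some (v i)) (D' + 3) →
        NodeInv R a tag X Y bot T S v (B.set i q cur fa fb fc s (q + B.sum cur) (B.hgt cur + 1))
          L' i := by
  have hql := hP.q_lt h hi hk hN
  have hw := h.weight_pos hi hk
  have hcur := hP.lt
  have hle := hP.le
  have p1 := hP.grow.isPrefix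
  obtain ⟨E, e1, e2, e3⟩ := hP.den
  obtain ⟨F, f1, f2⟩ := h.light_depth' hi hk (hN _ (heavy_lt h.slp hi hk).2.1)
  have f2 := f2 q hP.le
  obtain ⟨G, g1, g2⟩ := (hN cur hcur).value
  rw [← Setup.top8_eq hP.same, ← h.budget_eq hi (by omega) hP.same] at g2
  have l1 := lam_succ_le (x := q) (y := B.key cur) (by omega) (by omega)
  have l2 := lam_succ_le (x := q) (y := top8 bot T i) (by omega) (by omega)
  refine ⟨max E F, e1.mono List.prefix_rfl (le_max_left _ _), f1.mono p1 (le_max_right _ _),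
    max (max E F + 3) G, le_max_left _ _, g1.mono p1 (le_max_right _ _),
    fun L' fa fb fc s hg hF hs => ?_⟩
  have hne : cur ≠ i := by omega
  constructor
  · intro h0; exact absurd h0 hk
  · intro _
    simp only [Arr.set, Function.update_self, Function.update_of_ne hne]
    exact ⟨hcur, hP.same, by omega, trivial, trivial, hP.le, max E F + 3, hF, by omega⟩
  · have := h.weight_sum_le hi hk (hN _ (heavy_lt h.slp hi hk).1)
    simp only [Arr.set, Function.update_self]
    rw [hP.sum]
    exact this
  · have := (hN cur hcur).hgt_le
    simp only [Arr.set, Function.update_self]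
    omega
  · simp only [Arr.set, Function.update_self]
    exact ⟨_, hs, by omega⟩

end PopInv

end

/-! ### Counting the collected blocks -/

/-- The number of binary nodes below `i`. -/
def binNodes (tag : ℕ → ℕ) (i : ℕ) : ℕ := ((Finset.range i).filter fun u => tag u ≠ 1).card

theorem binNodes_succ (tag : ℕ → ℕ) (i : ℕ) :
    binNodes tag (i + 1) = binNodes tag i + if tag i ≠ 1 then 1 else 0 := by
  unfold binNodes
  rw [Finset.range_add_one, Finset.filter_insert]
  split
  · rw [Finset.card_insert_of_notMem (by simp)]
  · rfl

theorem binNodes_le (tag : ℕ → ℕ) (i : ℕ) : binNodes tag i ≤ i :=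
  (Finset.card_filter_le _ _).trans (by simp)

/-- After the nodes below `i` have been processed, `n` blocks have been collected. -/
def CountInv (tag X Y bot T : ℕ → ℕ) (B : Arr) (i n : ℕ) : Prop :=
  n + ∑ j ∈ Finset.range i, B.hgt j = ∑ u ∈ Finset.range i,
    if kind tag X Y bot T u ≠ 0 then B.hgt (heavy tag X Y bot T u) + 1 else 0

namespace CountInv

variable {k R : ℕ} {tag X Y bot T S : ℕ → ℕ} {B B' : Arr} {i n : ℕ}

/-- Amortization: each node with a heavy argument takes over the stack of that argument and pushes
one block. By `heavy_injective` no stack is taken over twice, so the heights of the inherited stacks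
are covered by the sum of all heights and `n` is at most the number of pushes. -/
theorem le (h : Setup k R tag X Y bot T S) (hC : CountInv tag X Y bot T B i n) (hi : i ≤ R) :
    n ≤ binNodes tag i := by
  unfold CountInv at hC
  rw [← Finset.sum_filter, Finset.sum_add_distrib] at hC
  set F := (Finset.range i).filter fun u => kind tag X Y bot T u ≠ 0 with hF
  have h1 : ∑ u ∈ F, B.hgt (heavy tag X Y bot T u) ≤ ∑ j ∈ Finset.range i, B.hgt j := by
    rw [← Finset.sum_image (f := B.hgt) (g := heavy tag X Y bot T)]
    · apply Finset.sum_le_sum_of_subset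
      intro c hc
      simp only [Finset.mem_image, hF, Finset.mem_filter, Finset.mem_range] at hc
      obtain ⟨u, ⟨hu, hk⟩, rfl⟩ := hc
      have := (heavy_lt h.slp (by omega : u < R) hk).1
      simp only [Finset.mem_range]
      omega
    · intro u hu u' hu' he
      simp only [hF, Finset.coe_filter, Finset.mem_range, Set.mem_ofPred_eq] at hu hu'
      exact heavy_injective h.slp h.top (by omega) (by omega) hu.2 hu'.2 he
  have h2 : ∑ u ∈ F, 1 ≤ binNodes tag i := by
    rw [Finset.sum_const, smul_eq_mul, mul_one]
    apply Finset.card_le_card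
    intro u hu
    simp only [hF, Finset.mem_filter] at hu ⊢
    exact ⟨hu.1, (kind_cases hu.2).1⟩
  omega

theorem step (h : Setup k R tag X Y bot T S) (hC : CountInv tag X Y bot T B i n) (hi : i < R)
    (hB : ∀ j < i, B'.hgt j = B.hgt j) {m : ℕ}
    (h' : m + B'.hgt i = if kind tag X Y bot T i ≠ 0 then B.hgt (heavy tag X Y bot T i) + 1 else 0) :
    CountInv tag X Y bot T B' (i + 1) (n + m) := by
  unfold CountInv at *
  rw [Finset.sum_range_succ, Finset.sum_range_succ]
  have e1 : ∑ j ∈ Finset.range i, B'.hgt j = ∑ j ∈ Finset.range i, B.hgt j :=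
    Finset.sum_congr rfl fun j hj => hB j (Finset.mem_range.1 hj)
  have e2 : (∑ u ∈ Finset.range i,
      if kind tag X Y bot T u ≠ 0 then B'.hgt (heavy tag X Y bot T u) + 1 else 0) =
      ∑ u ∈ Finset.range i,
      if kind tag X Y bot T u ≠ 0 then B.hgt (heavy tag X Y bot T u) + 1 else 0 := by
    refine Finset.sum_congr rfl fun u hu => ?_
    have hu := Finset.mem_range.1 hu
    split
    · rw [hB _ (by have := (heavy_lt h.slp (by omega : u < R) ‹_›).1; omega)]
    · rfl
  rw [e1, e2]
  have e3 : (if kind tag X Y bot T i ≠ 0 then B'.hgt (heavy tag X Y bot T i) + 1 else 0) =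
      if kind tag X Y bot T i ≠ 0 then B.hgt (heavy tag X Y bot T i) + 1 else 0 := by
    split
    · rw [hB _ ((heavy_lt h.slp hi ‹_›).1)]
    · rfl
  rw [e3]
  omega

end CountInv

/-! ### The main loop -/

/-- The fields that the main loop reads. -/
structure Static (R : ℕ) (tag X Y bot T S : ℕ → ℕ) (fld : ℕ → ℕ → ℕ) : Prop where
  f2 : fld 2 = tag
  f3 : fld 3 = X
  f4 : fld 4 = Y
  f5 : ∀ i < R, fld 5 i = bot i
  f6 : ∀ i < R, fld 6 i = pw (bot i)
  f7 : fld 7 = T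
  f8 : ∀ i < R, fld 8 i = pw (T i)
  f9 : fld 9 = S
  f10 : ∀ i < R, fld 10 i = kind tag X Y bot T i

theorem Static.congr {R : ℕ} {tag X Y bot T S : ℕ → ℕ} {fld fld' : ℕ → ℕ → ℕ}
    (h : Static R tag X Y bot T S fld) (hf : ∀ f ≤ 10, fld' f = fld f) :
    Static R tag X Y bot T S fld' := by
  constructor
  · rw [hf 2 (by decide)]; exact h.f2
  · rw [hf 3 (by decide)]; exact h.f3
  · rw [hf 4 (by decide)]; exact h.f4
  · rw [hf 5 (by decide)]; exact h.f5
  · rw [hf 6 (by decide)]; exact h.f6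
  · rw [hf 7 (by decide)]; exact h.f7
  · rw [hf 8 (by decide)]; exact h.f8
  · rw [hf 9 (by decide)]; exact h.f9
  · rw [hf 10 (by decide)]; exact h.f10

/-- The fields that the main loop writes. -/
structure Fields (fld : ℕ → ℕ → ℕ) (B : Arr) (i : ℕ) : Prop where
  key : ∀ j < i, fld 11 j = B.key j
  nxt : ∀ j < i, fld 12 j = B.nxt j
  fa : ∀ j < i, fld 13 j = B.fa j
  fb : ∀ j < i, fld 14 j = B.fb j
  fc : ∀ j < i, fld 15 j = B.fc j
  sv : ∀ j < i, fld 16 j = B.sv j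

/-- Collects the blocks that follow the current node. -/
def popCode : Prog :=
  .loop (ATest.lt 15 16).code <|
    .seq (block [.get 23 13 14, .get 24 14 14, .get 25 15 14]) <| .seq compCode <|
    block [.op .add 13 13 15, .get 14 12 14, .get 15 11 14, .op .add 16 13 13]

/-- Completes a node with an argument in the same class. -/
def finCode : Prog :=
  .seq (block [.mov 23 20, .mov 24 21, .mov 25 22, .imm 20 0, .imm 21 0, .imm 22 0, .imm 28 2,
    .imm 9 1, .get 29 16 12]) <|
  .seq (.ite (ATest.eq 2 28).code (block [.mov 22 29]) <|
    .ite (ATest.eq 10 9).code (block [.mov 21 29]) (block [.mov 20 29])) <|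
  .seq compCode <|
  .seq (block [.put 13 1 20, .put 14 1 21, .put 15 1 22, .put 11 1 13, .put 12 1 14,
    .get 27 16 14]) <|
  .seq applyCode (block [.put 16 1 27])

section

variable {A : Type*} [AddCommSemigroup A] [Semigroup A] [LeftDistribClass A] [RightDistribClass A]
  {k R : ℕ} {a : Fin k → A} {tag X Y bot T S : ℕ → ℕ} {v : ℕ → A} {B : Arr} {i : ℕ}
  {E : Env} {Q : ℕ → AState → Prop} {σ : AState}

theorem WP.popCode (h : Setup k R tag X Y bot T S) (hi : i < R)
    (hk : kind tag X Y bot T i ≠ 0)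
    (hN : ∀ j < i, NodeInv R a tag X Y bot T S v B σ.out j)
    (hR : R ≤ E.m) (hn : 1000 * bot (R - 1) ≤ 2 ^ E.w) (hF : Fields σ.fld B i)
    (r13 : σ.reg 13 = weight tag X Y bot T S i) (r14 : σ.reg 14 = heavy tag X Y bot T i)
    (r15 : σ.reg 15 = B.key (heavy tag X Y bot T i))
    (r16 : σ.reg 16 = 2 * weight tag X Y bot T S i)
    (r20 : σ.reg 20 = 0) (r21 : σ.reg 21 = 0) (r22 : σ.reg 22 = 0)
    (h0 : 0 < σ.out.length) (hlen : σ.out.length + 5 * i < 100 * E.m)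
    (hQ : ∀ t σ' cur q n, t ≤ 200 * n + 10 →
      PopInv R a tag X Y bot T S v B σ.out σ'.out i cur q n (σ'.reg 20) (σ'.reg 21) (σ'.reg 22) →
      ¬ B.key cur < 2 * q → σ'.fld = σ.fld → (∀ r < 13, σ'.reg r = σ.reg r) → σ'.reg 13 = q →
      σ'.reg 14 = cur → Q t σ') : WP E popCode Q σ := by
  have hlt := (heavy_lt h.slp hi hk).1
  have hhgt := (hN _ hlt).hgt_le
  have hmul := h.mul_le hi
  refine WP.loop (fun n time σ' => ∃ cur q m, n = B.hgt cur ∧ time ≤ 200 * m ∧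
    PopInv R a tag X Y bot T S v B σ.out σ'.out i cur q m (σ'.reg 20) (σ'.reg 21) (σ'.reg 22) ∧
    σ'.fld = σ.fld ∧ (∀ r < 13, σ'.reg r = σ.reg r) ∧ σ'.reg 13 = q ∧ σ'.reg 14 = cur ∧
    σ'.reg 15 = B.key cur ∧ σ'.reg 16 = 2 * q)
    ⟨_, _, 0, rfl, by omega, by rw [r20, r21, r22]; exact PopInv.init h hi hk hN, rfl,
      fun _ _ => rfl, r13, r14, r15, r16⟩ ?_ ?_
  · rintro n time σ' P ⟨cur, q, m, rfl, htime, hP, hfld, hreg, s13, s14, s15, s16⟩ hlt' hP'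
    simp only [ATest.Holds, s15, s16] at hlt'
    obtain ⟨hpos, D, hY, hG, hnext⟩ := hP.step h hi hk hN hlt'
    have hcur := hP.lt
    have hm := hP.hgt
    have hlen' := hP.grow.length
    have hql := hP.q_lt h hi hk hN
    rw [top8] at hql
    have hkc : B.nxt cur < i := by
      by_cases h0 : kind tag X Y bot T cur = 0
      · have := ((hN cur hcur).base h0).2.2; omega
      · have := ((hN cur hcur).block h0).1; omega
    refine WP.seq (WP.block ?_ ?_)
    · simp [BlockOk, Instr.Ok, Instr.step, s14]; omega
    simp [blockStep, Instr.step, s14, hfld, hF.fa cur hcur, hF.fb cur hcur, hF.fc cur hcur]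
    refine WP.seq (WP.compCode (hP.grow.length_pos h0) (by simp; omega) (by simpa using hY)
      (by simpa using hG) fun t ht L p₁ p₂ p₃ s hL hY' => WP.block ?_ ?_)
    · simp only [BlockOk, Instr.Ok, Instr.step, Op.eval]
      simp [s13, s14, s15, hF.nxt cur hcur]
      omega
    · refine hP' _ _ ⟨B.hgt (B.nxt cur), ?_, B.nxt cur, q + B.key cur, m + 1, rfl, ?_, ?_⟩
      · have := (hnext _ _ _ _ hL hY').hgt
        omega
      · simp [blockCost, Instr.cost]; omega
      · simp [blockStep, Instr.step, Op.eval, s13, s14, s15, hF.nxt cur hcur, hF.key _ hkc]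
        refine ⟨by simpa using hnext _ _ _ _ hL hY', fun r hr => ?_, by omega⟩
        rw [← hreg r hr]
        simp only [Function.update_apply]
        repeat rw [if_neg (by omega)]
  · rintro n time σ' ⟨cur, q, m, rfl, htime, hP, hfld, hreg, s13, s14, s15, s16⟩ hlt'
    simp only [ATest.Holds, s15, s16] at hlt'
    exact hQ _ _ cur q m (by omega) hP hlt' hfld hreg s13 s14

theorem WP.finCode (h : Setup k R tag X Y bot T S) (hv : Vals a R tag X Y v) (hi : i < R)
    (hk : kind tag X Y bot T i ≠ 0) {L₀ : List (ℕ × ℕ × ℕ)}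
    (hN : ∀ j < i, NodeInv R a tag X Y bot T S v B L₀ j) (hR : R ≤ E.m)
    (hF : Fields σ.fld B i) {cur q n : ℕ}
    (hP : PopInv R a tag X Y bot T S v B L₀ σ.out i cur q n (σ.reg 20) (σ.reg 21) (σ.reg 22))
    (hq : ¬ B.key cur < 2 * q) (r1 : σ.reg 1 = i) (r2 : σ.reg 2 = tag i)
    (r10 : σ.reg 10 = kind tag X Y bot T i) (r12 : σ.reg 12 = light tag X Y bot T i)
    (r13 : σ.reg 13 = q) (r14 : σ.reg 14 = cur)
    (h0 : 0 < σ.out.length) (hlen : σ.out.length + 10 < 100 * E.m)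
    (hQ : ∀ t σ' B', t ≤ 300 → Grow k σ.out σ'.out 8 → B.Agree B' i → Fields σ'.fld B' (i + 1) →
      NodeInv R a tag X Y bot T S v B' σ'.out i →
      n + B'.hgt i = B.hgt (heavy tag X Y bot T i) + 1 → (∀ f ≤ 10, σ'.fld f = σ.fld f) →
      (∀ r < 2, σ'.reg r = σ.reg r) → Q t σ') : WP E finCode Q σ := by
  have hb := E.bound
  obtain ⟨D, hY, hl, D', hDD', hc, hfin⟩ := hP.finish h hi hk hN hq
  obtain ⟨hhv, hlt, -⟩ := heavy_lt h.slp hi hk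
  have hcur := hP.lt
  obtain ⟨α, β, γ, d1, d2, d3, hact⟩ := id hY
  have g1 := d1.lt_length h0
  have g2 := d2.lt_length h0
  have g3 := d3.lt_length h0
  have g4 := hl.lt_length h0
  refine WP.seq (WP.block ?_ ?_)
  · simp [BlockOk, Instr.Ok, Instr.step, r12]; omega
  simp only [blockStep, Instr.step]
  refine WP.seq (WP.mono (Q' := fun t σ' => t ≤ 10 ∧ σ'.out = σ.out ∧ σ'.fld = σ.fld ∧
    (∀ r < 15, r ≠ 9 → σ'.reg r = σ.reg r) ∧ σ'.reg 23 = σ.reg 20 ∧ σ'.reg 24 = σ.reg 21 ∧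
    σ'.reg 25 = σ.reg 22 ∧ FunDen a σ.out (σ'.reg 20) (σ'.reg 21) (σ'.reg 22)
      (v (heavy tag X Y bot T i)) (v i) D) ?_ ?_)
  · have frame : ∀ (e : ℕ) (x : ℕ), 20 ≤ e → ∀ r < 15, r ≠ 9 → Function.update
        (Function.update (Function.update (Function.update (Function.update (Function.update
        (Function.update (Function.update (Function.update (Function.update σ.reg
        23 (σ.reg 20)) 24 (σ.reg 21)) 25 (σ.reg 22)) 20 0) 21 0) 22 0) 28 2) 9 1)
        29 (B.sv (light tag X Y bot T i))) e x r = σ.reg r := by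
      intro e x he r hr hr9
      simp only [Function.update_apply]
      repeat rw [if_neg (by omega)]
    obtain ⟨ht, -, hcases⟩ := kind_cases hk
    refine WP.ite (fun hz => WP.block ?_ ?_)
      (fun hz => WP.ite (fun hz' => WP.block ?_ ?_) (fun hz' => WP.block ?_ ?_))
    · simp [BlockOk, Instr.Ok, Instr.step, r12, hF.sv _ hlt]; omega
    · simp [ATest.Holds, r2] at hz
      simp [blockStep, Instr.step, blockCost, Instr.cost, r12, hF.sv _ hlt]
      refine ⟨frame 22 _ (by omega), none, none, some (v (light tag X Y bot T i)), rfl, rfl, hl, ?_⟩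
      have := hv.add i hi hz
      rw [this]
      rcases hcases with ⟨-, e1, e2⟩ | ⟨-, e1, e2⟩ <;> rw [e1, e2]
      · rfl
      -- The affine form has its summand on the right, so a heavy right argument of a sum is moved
      -- to the left.
      · rw [add_comm (v (X i))]; rfl
    · simp [BlockOk, Instr.Ok, Instr.step, r12, hF.sv _ hlt]; omega
    · simp [ATest.Holds, r2] at hz
      simp [ATest.Holds, r10] at hz'
      simp [blockStep, Instr.step, blockCost, Instr.cost, r12, hF.sv _ hlt]
      refine ⟨frame 21 _ (by omega), none, some (v (light tag X Y bot T i)), none, rfl, hl, rfl, ?_⟩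
      have := hv.mul i hi (by have := (h.slp.binary hi ht).1; omega)
      rw [this]
      rcases hcases with ⟨-, e1, e2⟩ | ⟨e0, e1, e2⟩
      · rw [e1, e2]; rfl
      · omega
    · simp [BlockOk, Instr.Ok, Instr.step, r12, hF.sv _ hlt]; omega
    · simp [ATest.Holds, r2] at hz
      simp [ATest.Holds, r10] at hz'
      simp [blockStep, Instr.step, blockCost, Instr.cost, r12, hF.sv _ hlt]
      refine ⟨frame 20 _ (by omega), some (v (light tag X Y bot T i)), none, none, hl, rfl, rfl, ?_⟩
      have := hv.mul i hi (by have := (h.slp.binary hi ht).1; omega)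
      rw [this]
      rcases hcases with ⟨e0, e1, e2⟩ | ⟨-, e1, e2⟩
      · omega
      · rw [e1, e2]; rfl
  · rintro t1 σ' ⟨ht1, hout, hfld, hreg, s23, s24, s25, hF1⟩
    rw [← hout] at hF1 h0 hlen hY
    rw [← s23, ← s24, ← s25] at hY
    refine WP.seq (WP.compCode h0 (by omega) hF1 hY fun t2 ht2 L p₁ p₂ p₃ s hL hF2 => ?_)
    have u1 : σ'.reg 1 = i := by rw [hreg 1 (by decide) (by decide), r1]
    have u13 : σ'.reg 13 = q := by rw [hreg 13 (by decide) (by decide), r13]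
    have u14 : σ'.reg 14 = cur := by rw [hreg 14 (by decide) (by decide), r14]
    have hlenL := hL.length
    refine WP.seq (WP.block ?_ ?_)
    · simp [BlockOk, Instr.Ok, Instr.step, u1, u13, u14]; omega
    simp [blockStep, Instr.step, u1, u13, u14, hfld, hF.sv _ hcur]
    refine WP.seq (WP.applyCode (x := v cur) (y := v i) (D := D') (hL.length_pos h0)
      (by simp; omega) (by simpa using hF2.mono List.prefix_rfl hDD')
      (by rw [← hout] at hc; simpa using hc.mono hL.isPrefix le_rfl) fun t3 ht3 L' o hL' ho =>
      WP.block ?_ ?_)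
    · simp [BlockOk, Instr.Ok, Instr.step, u1]; omega
    simp only at hL'
    have hg := hL.trans hL'
    -- The new block is the function of node `i` itself after the collected ones; applied to the
    -- gate of `cur` it gives the gate of `i`.
    have hNi := hfin L' p₁ p₂ p₃ o
      (hP.grow.isPrefix.trans (by rw [← hout]; exact hg.isPrefix))
      (hF2.mono hL'.isPrefix le_rfl) ho
    refine hQ _ _ (B.set i q cur p₁ p₂ p₃ o (q + B.sum cur) (B.hgt cur + 1)) ?_ ?_
      (Arr.agree_set _ _ _ _ _ _ _ _ _ _) ?_ ?_ ?_ ?_ ?_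
    · simp [blockCost, Instr.cost]; omega
    · rw [hout] at hg
      exact hg
    · constructor <;> intro j hj <;> by_cases hji : j = i <;>
        simp [blockStep, Instr.step, Arr.set, u1, hji]
      · exact hF.key j (by omega)
      · exact hF.nxt j (by omega)
      · exact hF.fa j (by omega)
      · exact hF.fb j (by omega)
      · exact hF.fc j (by omega)
      · exact hF.sv j (by omega)
    · exact hNi
    · have := hP.hgt
      simp [Arr.set]
      omega
    · intro f hf
      simp only [blockStep, Instr.step]
      simp only [Function.update_apply]
      repeat rw [if_neg (by omega)]
    · intro r hr
      rw [← hreg r (by omega) (by omega)]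
      simp only [blockStep, Instr.step, Function.update_apply]
      repeat rw [if_neg (by omega)]

end

/-- Processes a node without an argument in the same class. -/
def baseCode : Prog :=
  .seq (block [.imm 28 8, .op .mul 7 5 6, .op .mul 7 28 7, .put 11 1 7]) <|
  .seq (.ite (ATest.eq 2 9).code (block [.imm 4 0, .emit 27 1 3 4]) <|
    .seq (block [.get 4 4 1, .get 3 16 3, .get 4 16 4, .imm 28 2]) <|
    .ite (ATest.eq 2 28).code (block [.emit 27 2 3 4]) (block [.emit 27 3 3 4])) <|
  block [.put 16 1 27]

/-- Processes a node with an argument in the same class. -/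
def heavyCode : Prog :=
  .seq (block [.get 4 4 1]) <|
  .seq (.ite (ATest.eq 10 9).code (block [.mov 11 3, .mov 12 4]) (block [.mov 11 4, .mov 12 3])) <|
  .seq (block [.get 7 7 1, .get 8 9 1, .op .sub 7 7 8, .op .mul 7 7 5, .get 8 5 12, .op .mul 8 8 6,
    .op .add 13 7 8, .mov 14 11, .get 15 11 14, .op .add 16 13 13, .imm 20 0, .imm 21 0,
    .imm 22 0]) <|
  .seq popCode finCode

/-- Writes the balanced circuit. -/
def mainCode : Prog :=
  .seq (block [.imm 1 0, .imm 4 0, .get 3 3 1, .emit 27 1 3 4]) <|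
  .loop (ATest.lt 1 0).code <|
    .seq (block [.get 2 2 1, .get 3 3 1, .imm 9 1, .get 10 10 1, .get 5 6 1, .get 6 8 1]) <|
    .seq (.ite (ATest.zero 10).code baseCode heavyCode) <|
    block [.imm 9 1, .op .add 1 1 9]

section

variable {A : Type*} [AddCommSemigroup A] [Semigroup A] [LeftDistribClass A] [RightDistribClass A]
  {k R : ℕ} {a : Fin k → A} {tag X Y bot T S : ℕ → ℕ} {v : ℕ → A} {B : Arr} {i : ℕ}
  {E : Env} {Q : ℕ → AState → Prop} {σ : AState}

theorem Fields.succ {fld fld' : ℕ → ℕ → ℕ} {s : ℕ} (hF : Fields fld B i)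
    (h11 : fld' 11 = Function.update (fld 11) i (top8 bot T i)) (h12 : fld' 12 = fld 12)
    (h13 : fld' 13 = fld 13) (h14 : fld' 14 = fld 14) (h15 : fld' 15 = fld 15)
    (h16 : fld' 16 = Function.update (fld 16) i s) :
    Fields fld' (B.set i (top8 bot T i) (fld 12 i) (fld 13 i) (fld 14 i) (fld 15 i) s 0 0)
      (i + 1) := by
  constructor <;> intro j hj <;> by_cases hji : j = i <;>
    simp [Arr.set, hji, h11, h12, h13, h14, h15, h16]
  · exact hF.key j (by omega)
  · exact hF.nxt j (by omega)
  · exact hF.fa j (by omega)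
  · exact hF.fb j (by omega)
  · exact hF.fc j (by omega)
  · exact hF.sv j (by omega)

theorem WP.baseCode (h : Setup k R tag X Y bot T S) (hv : Vals a R tag X Y v) (hi : i < R)
    (hk : kind tag X Y bot T i = 0)
    (hN : ∀ j < i, NodeInv R a tag X Y bot T S v B σ.out j) (hR : R ≤ E.m)
    (hn : 1000 * bot (R - 1) ≤ 2 ^ E.w) (hS : Static R tag X Y bot T S σ.fld)
    (hF : Fields σ.fld B i) (r1 : σ.reg 1 = i) (r2 : σ.reg 2 = tag i) (r3 : σ.reg 3 = X i)
    (r5 : σ.reg 5 = pw (bot i)) (r6 : σ.reg 6 = pw (T i)) (r9 : σ.reg 9 = 1)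
    (h0 : 0 < σ.out.length) (hlen : σ.out.length < 100 * E.m)
    (hQ : ∀ t σ' B', t ≤ 300 → σ.out <+: σ'.out → (WfGates k σ.out → WfGates k σ'.out) →
      binCount σ'.out ≤ binCount σ.out + (if tag i ≠ 1 then 8 else 0) →
      σ'.out.length ≤ σ.out.length + 8 → B.Agree B' i → Fields σ'.fld B' (i + 1) →
      NodeInv R a tag X Y bot T S v B' σ'.out i → B'.hgt i = 0 →
      (∀ f ≤ 10, σ'.fld f = σ.fld f) → (∀ r < 2, σ'.reg r = σ.reg r) → Q t σ') :
    WP E baseCode Q σ := by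
  have hb := E.bound
  have hmul := h.mul_le hi
  rw [mul_comm] at hmul
  refine WP.seq (WP.block ?_ ?_)
  · simp [BlockOk, Instr.Ok, Instr.step, Op.eval, r1, r5, r6]; omega
  simp only [blockStep, Instr.step, Op.eval]
  refine WP.seq (WP.mono (Q' := fun t σ' => t ≤ 80 ∧ σ.out <+: σ'.out ∧
    (WfGates k σ.out → WfGates k σ'.out) ∧
    binCount σ'.out ≤ binCount σ.out + (if tag i ≠ 1 then 8 else 0) ∧
    σ'.out.length ≤ σ.out.length + 8 ∧ (∀ r < 2, σ'.reg r = σ.reg r) ∧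
    σ'.fld = Function.update σ.fld 11 (Function.update (σ.fld 11) i (top8 bot T i)) ∧
    ∃ D, DenO a σ'.out (σ'.reg 27) (some (v i)) D ∧ D ≤ budget R bot T i) ?_ ?_)
  · have etop : 8 * (pw (bot i) * pw (T i)) = top8 bot T i := by rw [top8, mul_comm (pw (T i))]
    refine WP.ite (fun hz => WP.block ?_ ?_) (fun hz => WP.seq (WP.block ?_ ?_))
    · simp [BlockOk, Instr.Ok, Instr.step]; omega
    · simp [ATest.Holds, r2, r9] at hz
      obtain ⟨hc, hvi⟩ := hv.const i hi hz
      simp [blockStep, Instr.step, blockCost, Instr.cost, r1, r3, r5, r6, etop]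
      refine ⟨fun hw => hw.append (.inl ⟨rfl, hc, rfl⟩), ?_, fun r hr => ?_, 0, ⟨h0, ?_⟩,
        Nat.zero_le _⟩
      · simp [binCount, hz]
      · simp only [Function.update_apply]
        repeat rw [if_neg (by omega)]
      · rw [hvi]
        exact .const hc (by simp)
    · simp [ATest.Holds, r2, r9] at hz
      obtain ⟨-, hX, hY, -⟩ := h.slp.binary hi hz
      simp [BlockOk, Instr.Ok, Instr.step, r1, r3, hS.f4]; omega
    · simp [ATest.Holds, r2, r9] at hz
      obtain ⟨htag, hX, hY, -⟩ := h.slp.binary hi hz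
      obtain ⟨hnX, hnY⟩ := not_sameClass_of_kind hk hz
      obtain ⟨D1, d1, e1, -⟩ := h.light_depth (b := true) hi hz hnX (hN _ hX)
      obtain ⟨D2, d2, e2, -⟩ := h.light_depth (b := false) hi hz hnY (hN _ hY)
      rw [show arg X Y true i = X i from rfl] at d1
      rw [show arg X Y false i = Y i from rfl] at d2
      have hden : ∀ t, ∃ D, Den a (σ.out ++ [(t, B.sv (X i), B.sv (Y i))]) (B.sv (X i)) (v (X i)) D ∧
          Den a (σ.out ++ [(t, B.sv (X i), B.sv (Y i))]) (B.sv (Y i)) (v (Y i)) D ∧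
          D + 1 ≤ budget R bot T i := fun t =>
        ⟨max D1 D2, d1.2.mono (List.prefix_append _ _) (le_max_left _ _),
          d2.2.mono (List.prefix_append _ _) (le_max_right _ _), by omega⟩
      have l1 := d1.lt_length h0
      have l2 := d2.lt_length h0
      simp only [blockStep, Instr.step]
      refine WP.ite (fun hz' => WP.block ?_ ?_) (fun hz' => WP.block ?_ ?_)
      · simp [BlockOk, Instr.Ok, Instr.step]; omega
      · simp [ATest.Holds, r2] at hz'
        obtain ⟨D, d1, d2, e⟩ := hden 2
        have hg := Grow.append (k := k) (L := σ.out) (t := 2) (.inl rfl) l1 l2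
        have g1 := hg.bin
        simp [blockStep, Instr.step, blockCost, Instr.cost, r1, r3, r5, r6, etop, hS.f4,
          hF.sv _ hX, hF.sv _ hY]
        refine ⟨hg.wf, by rw [if_neg hz]; omega, fun r hr => by
          simp only [Function.update_apply]
          repeat rw [if_neg (by omega)], D + 1, ⟨h0, ?_⟩, e⟩
        rw [hv.add i hi hz']
        exact .add (by simp) d1 d2
      · simp [BlockOk, Instr.Ok, Instr.step]; omega
      · simp [ATest.Holds, r2] at hz'
        obtain ⟨D, d1, d2, e⟩ := hden 3
        have hg := Grow.append (k := k) (L := σ.out) (t := 3) (.inr rfl) l1 l2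
        have g1 := hg.bin
        simp [blockStep, Instr.step, blockCost, Instr.cost, r1, r3, r5, r6, etop, hS.f4,
          hF.sv _ hX, hF.sv _ hY]
        refine ⟨hg.wf, by rw [if_neg hz]; omega, fun r hr => by
          simp only [Function.update_apply]
          repeat rw [if_neg (by omega)], D + 1, ⟨h0, ?_⟩, e⟩
        rw [hv.mul i hi (by omega)]
        exact .mul (by simp) d1 d2
  · rintro t σ' ⟨ht, hp, hw, hbin, hl, hreg, hfld, D, hD, hle⟩
    have s1 := hreg 1 (by decide)
    refine WP.block ?_ (hQ _ _ (B.set i (top8 bot T i) (σ.fld 12 i) (σ.fld 13 i) (σ.fld 14 i)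
      (σ.fld 15 i) (σ'.reg 27) 0 0) ?_ hp hw hbin hl (Arr.agree_set _ _ _ _ _ _ _ _ _ _) ?_ ?_ ?_
      ?_ hreg)
    · simp [BlockOk, Instr.Ok, Instr.step, s1, r1]; omega
    · simp [blockCost, Instr.cost]; omega
    · apply hF.succ (s := σ'.reg 27) <;> simp [blockStep, Instr.step, hfld, s1, r1]
    · exact h.nodeInv_base hi hk (by simp [Arr.set]) (by simp [Arr.set]) (by simp [Arr.set])
        (D := D) (by simpa [Arr.set, blockStep, Instr.step] using hD) hle
    · simp [Arr.set]
    · intro f hf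
      have e1 : f ≠ 11 := by omega
      have e2 : f ≠ 16 := by omega
      simp [blockStep, Instr.step, hfld, e1, e2]

theorem WP.heavyCode (h : Setup k R tag X Y bot T S) (hv : Vals a R tag X Y v) (hi : i < R)
    (hk : kind tag X Y bot T i ≠ 0)
    (hN : ∀ j < i, NodeInv R a tag X Y bot T S v B σ.out j) (hR : R ≤ E.m)
    (hn : 1000 * bot (R - 1) ≤ 2 ^ E.w) (hS : Static R tag X Y bot T S σ.fld)
    (hF : Fields σ.fld B i) (r1 : σ.reg 1 = i) (r2 : σ.reg 2 = tag i) (r3 : σ.reg 3 = X i)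
    (r5 : σ.reg 5 = pw (bot i)) (r6 : σ.reg 6 = pw (T i)) (r9 : σ.reg 9 = 1)
    (r10 : σ.reg 10 = kind tag X Y bot T i)
    (h0 : 0 < σ.out.length) (hlen : σ.out.length + 5 * i + 10 < 100 * E.m)
    (hQ : ∀ t σ' B' n, t ≤ 500 + 200 * n → Grow k σ.out σ'.out (5 * n + 8) → B.Agree B' i →
      Fields σ'.fld B' (i + 1) → NodeInv R a tag X Y bot T S v B' σ'.out i →
      n + B'.hgt i = B.hgt (heavy tag X Y bot T i) + 1 → (∀ f ≤ 10, σ'.fld f = σ.fld f) →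
      (∀ r < 2, σ'.reg r = σ.reg r) → Q t σ') :
    WP E heavyCode Q σ := by
  have hb := E.bound
  obtain ⟨hh, hl, hbot⟩ := heavy_lt h.slp hi hk
  obtain ⟨ht, -, hcases⟩ := kind_cases hk
  obtain ⟨-, hX, hY, -⟩ := h.slp.binary hi ht
  refine WP.seq (WP.block ?_ ?_)
  · simp [BlockOk, Instr.Ok, Instr.step, r1]; omega
  simp only [blockStep, Instr.step]
  refine WP.seq (WP.mono (Q' := fun t σ' => t ≤ 10 ∧ σ'.out = σ.out ∧ σ'.fld = σ.fld ∧
    (∀ r < 11, r ≠ 4 → σ'.reg r = σ.reg r) ∧ σ'.reg 11 = heavy tag X Y bot T i ∧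
    σ'.reg 12 = light tag X Y bot T i) ?_ ?_)
  · refine WP.ite (fun hz => WP.block ?_ ?_) (fun hz => WP.block ?_ ?_)
    · simp [BlockOk, Instr.Ok, Instr.step, r1, r3, hS.f4]; omega
    · simp [ATest.Holds, r10, r9] at hz
      have e : heavy tag X Y bot T i = X i ∧ light tag X Y bot T i = Y i := by
        rcases hcases with ⟨-, h⟩ | ⟨h, -⟩
        · exact h
        · omega
      simp [blockStep, Instr.step, blockCost, Instr.cost, r1, r3, hS.f4, e.1, e.2]
      intro r hr hr4
      simp only [Function.update_apply]
      repeat rw [if_neg (by omega)]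
    · simp [BlockOk, Instr.Ok, Instr.step, r1, r3, hS.f4]; omega
    · simp [ATest.Holds, r10, r9] at hz
      have e : heavy tag X Y bot T i = Y i ∧ light tag X Y bot T i = X i := by
        rcases hcases with ⟨h, -⟩ | ⟨-, h⟩
        · omega
        · exact h
      simp [blockStep, Instr.step, blockCost, Instr.cost, r1, r3, hS.f4, e.1, e.2]
      intro r hr hr4
      simp only [Function.update_apply]
      repeat rw [if_neg (by omega)]
  · rintro t1 σ' ⟨ht1, hout, hfld, hreg, s11, s12⟩
    have s1 : σ'.reg 1 = i := by rw [hreg 1 (by decide) (by decide), r1]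
    have s5 : σ'.reg 5 = pw (bot i) := by rw [hreg 5 (by decide) (by decide), r5]
    have s6 : σ'.reg 6 = pw (T i) := by rw [hreg 6 (by decide) (by decide), r6]
    -- Everything computed here is bounded by `T i * bot i ≤ bot (R - 1)`, up to small factors, and
    -- hence fits into a word.
    have b1 : (T i - S i) * pw (bot i) ≤ bot (R - 1) :=
      (Nat.mul_le_mul (Nat.sub_le _ _) (pw_le _)).trans (h.top.le i (Nat.zero_le _) hi)
    have b2 : bot (light tag X Y bot T i) * pw (T i) ≤ bot (R - 1) := by
      rw [mul_comm]
      exact (Nat.mul_le_mul (pw_le _) (by omega)).trans (h.top.le i (Nat.zero_le _) hi)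
    have b3 : T i ≤ bot (R - 1) :=
      (Nat.le_mul_of_pos_right _ (h.slp.bot_pos hi)).trans (h.top.le i (Nat.zero_le _) hi)
    refine WP.seq (WP.block ?_ ?_)
    · simp [BlockOk, Instr.Ok, Instr.step, Op.eval, s1, s5, s6, s11, s12, hfld, hS.f7, hS.f9,
        hS.f5 (light tag X Y bot T i) (by omega)]
      have b4 : T i - S i ≤ bot (R - 1) := (Nat.sub_le _ _).trans b3
      refine ⟨?_, ?_, ?_, ?_, ?_, ?_, ?_, ?_, ?_⟩ <;> omega
    simp [blockStep, Instr.step, Op.eval, s1, s5, s6, s11, s12, hfld, hS.f7, hS.f9,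
      hS.f5 (light tag X Y bot T i) (by omega), hF.key _ hh, hout]
    refine WP.seq (WP.popCode (v := v) (a := a) (B := B) h hi hk hN hR hn hF (by simp [weight])
      (by simp) (by simp) (by simp [weight]; omega) (by simp) (by simp) (by simp) h0 (by simp; omega)
      fun t2 σ'' cur q n ht2 hP hq hfld2 hreg2 u13 u14 => ?_)
    simp only at hP hfld2 hreg2
    have hPl := hP.grow.length
    have hPh := hP.hgt
    have hhl := (hN _ hh).hgt_le
    refine WP.finCode h hv hi hk hN hR (by rw [hfld2]; exact hF) hP hq ?_ ?_ ?_ ?_ u13 u14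
      (hP.grow.length_pos h0) (by omega) fun t3 σ3 B' ht3 hG hB hF' hN' hh' hf' hr' => ?_
    · rw [hreg2 1 (by decide)]; simpa using s1
    · rw [hreg2 2 (by decide)]; simpa using (hreg 2 (by decide) (by decide)).trans r2
    · rw [hreg2 10 (by decide)]; simpa using (hreg 10 (by decide) (by decide)).trans r10
    · rw [hreg2 12 (by decide)]; simpa using s12
    · refine hQ _ _ B' n ?_ (hP.grow.trans hG) hB hF' hN' hh' (fun f hf => ?_) fun r hr => ?_
      · simp [blockCost, Instr.cost]; omega
      · rw [hf' f hf, hfld2]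
      · rw [hr' r hr, hreg2 r (by omega)]
        simp only [Function.update_apply]
        repeat rw [if_neg (by omega)]
        exact hreg r (by omega) (by omega)

theorem WP.mainCode (h : Setup k R tag X Y bot T S) (hv : Vals a R tag X Y v) (hR : R ≤ E.m)
    (hn : 1000 * bot (R - 1) ≤ 2 ^ E.w) (hS : Static R tag X Y bot T S σ.fld)
    (r0 : σ.reg 0 = R) (hout : σ.out = [])
    (hQ : ∀ t σ' B, t ≤ 1000 * R + 50 → σ'.reg 0 = R → Fields σ'.fld B R →
      NodeInv R a tag X Y bot T S v B σ'.out (R - 1) → WfGates k σ'.out →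
      binCount σ'.out ≤ 13 * binNodes tag R → σ'.out.length < 100 * E.m → Q t σ') :
    WP E mainCode Q σ := by
  have hb := E.bound
  have hR0 := h.slp.pos
  -- Gate `0` of the output is a dummy constant, emitted so that `0` is free to denote an absent
  -- coefficient. Node `0` supplies its symbol: having no smaller arguments, it is a constant.
  have hX0 : X 0 < k := by
    rcases h.slp.gate 0 hR0 with h | h
    · exact h.2.1
    · omega
  refine WP.seq (WP.block ?_ ?_)
  · simp [BlockOk, Instr.Ok, Instr.step, hout]; omega
  refine WP.loop (fun n time σ' => ∃ i ≤ R, n = R - i ∧ ∃ B m, time ≤ 700 * i + 200 * m ∧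
    σ'.reg 0 = R ∧ σ'.reg 1 = i ∧ Static R tag X Y bot T S σ'.fld ∧ Fields σ'.fld B i ∧
    (∀ j < i, NodeInv R a tag X Y bot T S v B σ'.out j) ∧ CountInv tag X Y bot T B i m ∧
    WfGates k σ'.out ∧ 0 < σ'.out.length ∧ σ'.out.length ≤ 1 + 8 * i + 5 * m ∧
    binCount σ'.out ≤ 8 * binNodes tag i + 5 * m)
    ⟨0, by omega, rfl, ⟨σ.fld 11, σ.fld 12, σ.fld 13, σ.fld 14, σ.fld 15, σ.fld 16, fun _ => 0,
      fun _ => 0⟩, 0, by omega, ?_⟩ ?_ ?_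
  · simp [blockStep, Instr.step, r0, hout, hS, CountInv, hS.f3]
    refine ⟨⟨?_, ?_, ?_, ?_, ?_, ?_⟩, ?_, ?_⟩
    iterate 6 simp
    · have := WfGates.append (k := k) (L := []) (t := 1) (x := X 0) (y := 0)
        (fun g t x y hg => by simp at hg) (.inl ⟨rfl, hX0, rfl⟩)
      simpa using this
    · simp [binCount]
  · rintro n time σ' P ⟨i, hi, rfl, B, m, htime, s0, s1, hS, hF, hN, hC, hW, h0, hlen, hbin⟩ hlt hP
    simp only [ATest.Holds, s0, s1] at hlt
    have hm := (hC.le h hi).trans (binNodes_le tag i)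
    have hsucc := binNodes_succ tag i
    refine WP.seq (WP.block ?_ ?_)
    · simp [BlockOk, Instr.Ok, Instr.step, s1]; omega
    simp [blockStep, Instr.step, s1, hS.f2, hS.f3, hS.f6 i hlt, hS.f8 i hlt, hS.f10 i hlt]
    refine WP.seq (WP.ite (fun hz => ?_) (fun hz => ?_))
    · have hk : kind tag X Y bot T i = 0 := by simpa [ATest.Holds] using hz
      refine WP.baseCode h hv hlt hk (B := B) hN hR hn hS hF (by simpa using s1) (by simp) (by simp)
        (by simp) (by simp) (by simp) h0 (by simp; omega)
        fun t σ'' B' ht hp hw hbin' hl' hB hF' hN' hh hf hr => WP.block ?_ ?_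
      · have := hr 1 (by decide)
        simp [s1] at this
        simp [BlockOk, Instr.Ok, Instr.step, this, Op.eval]; omega
      · have e0 := hr 0 (by decide)
        have e1 := hr 1 (by decide)
        simp [s0, s1] at e0 e1
        refine hP _ _ ⟨R - (i + 1), by omega, i + 1, by omega, rfl, B', m, ?_, ?_⟩
        · simp [blockCost, Instr.cost]; omega
        · simp [blockStep, Instr.step, e0, e1, Op.eval]
          refine ⟨hS.congr hf, hF', ?_, ?_, hw hW, h0.trans_le hp.length_le, ?_, ?_⟩
          · intro j hj
            rcases Nat.lt_succ_iff_lt_or_eq.1 (Nat.lt_succ_of_le hj) with hj | rfl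
            · exact (hN j hj).congr hj hB hp
            · exact hN'
          · exact hC.step h hlt hB.hgt (m := 0) (by rw [hh, hk]; rfl)
          · simp only at hl'; omega
          · rw [hsucc]
            simp only at hbin'
            split_ifs at * <;> omega
    · have hk : kind tag X Y bot T i ≠ 0 := by simpa [ATest.Holds] using hz
      have ht1 := (kind_cases hk).1
      refine WP.heavyCode h hv hlt hk (B := B) hN hR hn hS hF (by simpa using s1) (by simp) (by simp)
        (by simp) (by simp) (by simp) (by simp) h0 (by simp; omega)
        fun t σ'' B' n ht hG hB hF' hN' hh hf hr => WP.block ?_ ?_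
      · have := hr 1 (by decide)
        simp [s1] at this
        simp [BlockOk, Instr.Ok, Instr.step, this, Op.eval]; omega
      · have e0 := hr 0 (by decide)
        have e1 := hr 1 (by decide)
        simp [s0, s1] at e0 e1
        refine hP _ _ ⟨R - (i + 1), by omega, i + 1, by omega, rfl, B', m + n, ?_, ?_⟩
        · simp [blockCost, Instr.cost]; omega
        · have hl' := hG.length
          have hb' := hG.bin
          simp [blockStep, Instr.step, e0, e1, Op.eval]
          refine ⟨hS.congr hf, hF', ?_, ?_, hG.wf hW, hG.length_pos h0, ?_, ?_⟩
          · intro j hj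
            rcases Nat.lt_succ_iff_lt_or_eq.1 (Nat.lt_succ_of_le hj) with hj | rfl
            · exact (hN j hj).congr hj hB hG.isPrefix
            · exact hN'
          · exact hC.step h hlt hB.hgt (m := n) (by rw [hh, if_pos hk])
          · simp only at hl'; omega
          · rw [hsucc, if_pos ht1]
            simp only at hb'
            omega
  · rintro n time σ' ⟨i, hi, rfl, B, m, htime, s0, s1, hS, hF, hN, hC, hW, h0, hlen, hbin⟩ hlt
    simp only [ATest.Holds, s0, s1] at hlt
    obtain rfl : i = R := by omega
    -- At most `binNodes` collected blocks with five gates each, together with eight gates per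
    -- binary node, give the factor `13`.
    have hm := hC.le h le_rfl
    have hm' := binNodes_le tag i
    exact hQ _ _ B (by simp [blockCost, Instr.cost]; omega) s0 hF (hN _ (by omega)) hW (by omega)
      (by omega)

end

/-! ### Depth-first search -/

namespace Env

variable (E : Env) (g : ℕ)

/-- The tag of an input gate. -/
def tg : ℕ := E.inp (2 + 3 * g)

/-- The first argument of an input gate. -/
def fst : ℕ := E.inp (2 + 3 * g + 1)

/-- The second argument of an input gate. -/
def snd : ℕ := E.inp (2 + 3 * g + 2)

end Env

/-- The input is a circuit; `num g` is the number of nodes of the unfolding at the gate `g`. -/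
def Env.IsDag (E : Env) (k : ℕ) (num : ℕ → ℕ) : Prop :=
  ∀ g < E.m, (E.tg g = 1 ∧ E.fst g < k ∧ num g = 1) ∨
    ((E.tg g = 2 ∨ E.tg g = 3) ∧ E.fst g < E.m ∧ E.snd g < E.m ∧
      num g = 1 + num (E.fst g) + num (E.snd g))

theorem Env.IsDag.binary {E : Env} {k : ℕ} {num : ℕ → ℕ} (h : E.IsDag k num) {g : ℕ} (hg : g < E.m)
    (ht : E.tg g ≠ 1) : (E.tg g = 2 ∨ E.tg g = 3) ∧ E.fst g < E.m ∧ E.snd g < E.m ∧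
      num g = 1 + num (E.fst g) + num (E.snd g) := by
  rcases h g hg with h | h
  · exact absurd h.1 ht
  · exact h

/-- The array `stk` contains the stack `S`, whose top is the head of the list. -/
def Stk (stk : ℕ → ℕ) : List ℕ → Prop
  | [] => True
  | g :: S => stk S.length = g ∧ Stk stk S

theorem Stk.update {stk : ℕ → ℕ} {S : List ℕ} (h : Stk stk S) {i : ℕ} (hi : S.length ≤ i) (z : ℕ) :
    Stk (Function.update stk i z) S := by
  induction S with
  | nil => trivial
  | cons g S ih =>
    simp only [List.length_cons] at hi
    refine ⟨?_, ih h.2 (by omega)⟩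
    rw [Function.update_of_ne (by omega)]
    exact h.1

/-- The node `i` is the copy of the input gate `ord i`. -/
def IsCopy (E : Env) (tag X Y ord : ℕ → ℕ) (i : ℕ) : Prop :=
  tag i = E.tg (ord i) ∧ (tag i = 1 → X i = E.fst (ord i)) ∧
    (tag i ≠ 1 → X i < i ∧ ord (X i) = E.fst (ord i) ∧ Y i < i ∧ ord (Y i) = E.snd (ord i))

/-- The state of the search: `S` is the stack, `n` gates are finished, the `i`-th of them is
`ord i`. -/
structure Dfs (E : Env) (num : ℕ → ℕ) (out : ℕ) (pos tag X Y : ℕ → ℕ) (S : List ℕ) (n : ℕ)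
    (ord : ℕ → ℕ) : Prop where
  lt : ∀ g ∈ S, g < E.m
  sorted : S.Pairwise fun g h => num g < num h
  open_ : ∀ g ∈ S, pos g = 0
  ord_lt : ∀ i < n, ord i < E.m
  pos_ord : ∀ i < n, pos (ord i) = i + 1
  ord_pos : ∀ g, pos g ≠ 0 → pos g ≤ n ∧ ord (pos g - 1) = g
  copy : ∀ i < n, IsCopy E tag X Y ord i
  parent : ∀ g, g ∈ S ∨ pos g ≠ 0 → g = out ∨
    ∃ p, (p ∈ S ∨ pos p ≠ 0) ∧ E.tg p ≠ 1 ∧ (E.fst p = g ∨ E.snd p = g)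
  last : S.getLast? = some out ∨ S = [] ∧ 0 < n ∧ ord (n - 1) = out

namespace Dfs

variable {E : Env} {num : ℕ → ℕ} {out : ℕ} {pos tag X Y ord : ℕ → ℕ} {S : List ℕ} {n : ℕ}

theorem init (ho : out < E.m) : Dfs E num out (fun _ => 0) tag X Y [out] 0 ord := by
  constructor <;> simp [ho]

theorem inj (h : Dfs E num out pos tag X Y S n ord) {i j : ℕ} (hi : i < n) (hj : j < n)
    (hij : ord i = ord j) : i = j := by
  have h1 := h.pos_ord i hi
  have h2 := h.pos_ord j hj
  rw [hij] at h1
  omega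

/-- Numbered gates and gates on the stack are distinct. The stack has no repetitions because `num`
is strictly monotone along it, which is also how acyclicity enters. -/
theorem card_le (h : Dfs E num out pos tag X Y S n ord) : n + S.length ≤ E.m := by
  have hnd : ((List.range n).map ord ++ S).Nodup := by
    rw [List.nodup_append]
    refine ⟨List.Nodup.map_on (fun i hi j hj hij => h.inj (List.mem_range.1 hi)
      (List.mem_range.1 hj) hij) List.nodup_range,
      h.sorted.imp fun {g g'} hlt (e : g = g') => by rw [e] at hlt; omega, ?_⟩
    rintro g hg g' hg' rfl
    obtain ⟨i, hi, rfl⟩ := List.mem_map.1 hg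
    have h1 := h.pos_ord i (List.mem_range.1 hi)
    have h2 := h.open_ _ hg'
    omega
  have := List.toFinset_card_of_nodup hnd
  have hsub : ((List.range n).map ord ++ S).toFinset ⊆ Finset.range E.m := by
    intro g hg
    simp only [List.mem_toFinset, List.mem_append, List.mem_map, List.mem_range] at hg
    rw [Finset.mem_range]
    rcases hg with ⟨i, hi, rfl⟩ | hg
    · exact h.ord_lt i hi
    · exact h.lt g hg
  have := Finset.card_le_card hsub
  simp at *
  omega

theorem push {g z : ℕ} (h : Dfs E num out pos tag X Y (g :: S) n ord) (ht : E.tg g ≠ 1)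
    (hz : E.fst g = z ∨ E.snd g = z) (hm : z < E.m) (hlt : num z < num g) (hp : pos z = 0) :
    Dfs E num out pos tag X Y (z :: g :: S) n ord where
  lt := by
    intro g' hg'
    rcases List.mem_cons.1 hg' with rfl | hg'
    · exact hm
    · exact h.lt _ hg'
  sorted := by
    refine List.Pairwise.cons (fun g' hg' => ?_) h.sorted
    rcases List.mem_cons.1 hg' with rfl | hg'
    · exact hlt
    · exact hlt.trans ((List.pairwise_cons.1 h.sorted).1 _ hg')
  open_ := by
    intro g' hg'
    rcases List.mem_cons.1 hg' with rfl | hg'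
    · exact hp
    · exact h.open_ _ hg'
  ord_lt := h.ord_lt
  pos_ord := h.pos_ord
  ord_pos := h.ord_pos
  copy := h.copy
  parent := by
    intro g' hg'
    by_cases e : g' = z
    · subst e
      exact .inr ⟨g, .inl (by simp), ht, hz⟩
    · rcases h.parent g' (by simpa [e] using hg') with h1 | ⟨p, hp, h1⟩
      · exact .inl h1
      · exact .inr ⟨p, hp.imp_left (List.mem_cons_of_mem _), h1⟩
  last := by
    rcases h.last with h1 | h1
    · exact .inl (by rw [List.getLast?_cons_cons]; exact h1)
    · simp at h1

theorem finish {g : ℕ} {tag' X' Y' : ℕ → ℕ} (h : Dfs E num out pos tag X Y (g :: S) n ord)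
    (h2 : ∀ i < n, tag' i = tag i) (h3 : ∀ i < n, X' i = X i) (h4 : ∀ i < n, Y' i = Y i)
    (hc : IsCopy E tag' X' Y' (Function.update ord n g) n) :
    Dfs E num out (Function.update pos g (n + 1)) tag' X' Y' S (n + 1)
      (Function.update ord n g) := by
  have hg0 : pos g = 0 := h.open_ g (by simp)
  have hgS : g ∉ S := fun hg => lt_irrefl _ ((List.pairwise_cons.1 h.sorted).1 _ hg)
  have hne : ∀ i < n, ord i ≠ g := by
    rintro i hi rfl
    have := h.pos_ord i hi
    omega
  have hvis : ∀ g', g' ∈ S ∨ Function.update pos g (n + 1) g' ≠ 0 ↔ g' ∈ g :: S ∨ pos g' ≠ 0 := by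
    intro g'
    by_cases e : g' = g
    · simp [e]
    · simp [e]
  constructor
  · exact fun g' hg' => h.lt g' (List.mem_cons_of_mem _ hg')
  · exact (List.pairwise_cons.1 h.sorted).2
  · intro g' hg'
    rw [Function.update_of_ne (by rintro rfl; exact hgS hg')]
    exact h.open_ g' (List.mem_cons_of_mem _ hg')
  · intro i hi
    rcases Nat.lt_succ_iff_lt_or_eq.1 hi with hi | rfl
    · rw [Function.update_of_ne (by omega)]
      exact h.ord_lt i hi
    · rw [Function.update_self]
      exact h.lt _ (by simp)
  · intro i hi
    rcases Nat.lt_succ_iff_lt_or_eq.1 hi with hi | rfl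
    · have e : Function.update ord n g i = ord i := Function.update_of_ne (by omega) _ _
      rw [e, Function.update_of_ne (hne i hi)]
      exact h.pos_ord i hi
    · simp
  · intro g' hg'
    by_cases e : g' = g
    · simp [e]
    · rw [Function.update_of_ne e] at hg' ⊢
      obtain ⟨h5, h6⟩ := h.ord_pos g' hg'
      exact ⟨by omega, by rw [Function.update_of_ne (by omega)]; exact h6⟩
  · intro i hi
    rcases Nat.lt_succ_iff_lt_or_eq.1 hi with hi | rfl
    · obtain ⟨c1, c2, c3⟩ := h.copy i hi
      unfold IsCopy
      rw [Function.update_of_ne (by omega), h2 i hi, h3 i hi, h4 i hi]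
      refine ⟨c1, c2, fun c => ?_⟩
      obtain ⟨c4, c5, c6, c7⟩ := c3 c
      rw [Function.update_of_ne (by omega), Function.update_of_ne (by omega)]
      exact ⟨c4, c5, c6, c7⟩
    · exact hc
  · intro g' hg'
    rcases h.parent g' ((hvis g').1 hg') with h1 | ⟨p, hp, h1⟩
    · exact .inl h1
    · exact .inr ⟨p, (hvis p).2 hp, h1⟩
  · rcases h.last with h1 | h1
    · cases S with
      | nil =>
        right
        simp at h1
        simp [h1]
      | cons g' S => exact .inl (by rw [List.getLast?_cons_cons] at h1; exact h1)
    · simp at h1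

theorem ord_last (h : Dfs E num out pos tag X Y [] n ord) : 0 < n ∧ ord (n - 1) = out := by
  rcases h.last with h1 | h1
  · simp at h1
  · exact h1.2

/-- A gate is numbered after its arguments, and the output gate, at the bottom of the stack, is
numbered last. Every visited gate other than the output was reached from a visited binary gate,
which gives the parents. -/
theorem slp {k : ℕ} (h : Dfs E num out pos tag X Y [] n ord) (hD : E.IsDag k num) :
    Slp k n tag X Y (fun i => num (ord i)) where
  pos := h.ord_last.1
  gate := by
    intro i hi
    obtain ⟨c1, c2, c3⟩ := h.copy i hi
    rcases hD (ord i) (h.ord_lt i hi) with ⟨d1, d2, d3⟩ | ⟨d1, d2, d3, d4⟩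
    · have : tag i = 1 := c1.trans d1
      exact .inl ⟨this, by rw [c2 this]; exact d2, d3⟩
    · rw [← c1] at d1
      obtain ⟨c4, c5, c6, c7⟩ := c3 (by omega)
      exact .inr ⟨d1, c4, c6, by rw [c5, c7]; exact d4⟩
  parent := by
    intro i hi
    have h1 := h.pos_ord i (by omega)
    rcases h.parent (ord i) (.inr (by omega)) with h2 | ⟨p, hp, ht, h2⟩
    · have := h.inj (i := i) (j := n - 1) (by omega) (by omega) (h2.trans h.ord_last.2.symm)
      omega
    · simp only [List.not_mem_nil, false_or] at hp
      obtain ⟨h3, h4⟩ := h.ord_pos p hp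
      have hj : pos p - 1 < n := by omega
      obtain ⟨c1, -, c3⟩ := h.copy _ hj
      rw [h4] at c1 c3
      rw [← c1] at ht
      obtain ⟨c4, c5, c6, c7⟩ := c3 ht
      refine ⟨_, hj, ht, h2.imp (fun e => ?_) fun e => ?_⟩
      · exact h.inj (by omega) (by omega) (c5.trans e)
      · exact h.inj (by omega) (by omega) (c7.trans e)

theorem vals {A : Type*} [Add A] [Mul A] {k : ℕ} {a : Fin k → A} {val : ℕ → A}
    (h : Dfs E num out pos tag X Y [] n ord) (hV : Vals a E.m E.tg E.fst E.snd val) :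
    Vals a n tag X Y (fun i => val (ord i)) where
  const i hi ht := by
    obtain ⟨c1, c2, -⟩ := h.copy i hi
    rw [c2 ht]
    exact hV.const _ (h.ord_lt i hi) (c1.symm.trans ht)
  add i hi ht := by
    obtain ⟨c1, -, c3⟩ := h.copy i hi
    obtain ⟨-, c5, -, c7⟩ := c3 (by omega)
    rw [c5, c7]
    exact hV.add _ (h.ord_lt i hi) (c1.symm.trans ht)
  mul i hi ht := by
    obtain ⟨c1, -, c3⟩ := h.copy i hi
    obtain ⟨-, c5, -, c7⟩ := c3 (by omega)
    rw [c5, c7]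
    exact hV.mul _ (h.ord_lt i hi) (c1.symm.trans ht)

theorem binNodes_le (h : Dfs E num out pos tag X Y S n ord) :
    binNodes tag n ≤ binNodes E.tg E.m := by
  refine Finset.card_le_card_of_injOn ord (fun i hi => ?_) fun i hi j hj hij => ?_
  · simp only [Finset.coe_filter, Finset.mem_range, Set.mem_ofPred_eq] at hi ⊢
    exact ⟨h.ord_lt i hi.1, by rw [← (h.copy i hi.1).1]; exact hi.2⟩
  · simp only [Finset.coe_filter, Finset.mem_range, Set.mem_ofPred_eq] at hi hj
    exact h.inj hi.1 hj.1 hij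

end Dfs

/-- Every node except the last is one of the two arguments of a binary node. So time linear in the
number of reachable gates is linear in the number of wires, however many unreachable gates the input
lists. -/
theorem Slp.le_binNodes {k R : ℕ} {tag X Y bot : ℕ → ℕ} (h : Slp k R tag X Y bot) :
    R ≤ 2 * binNodes tag R + 1 := by
  have hsub : Finset.range (R - 1) ⊆
      ((Finset.range R).filter fun u => tag u ≠ 1).image X ∪
        ((Finset.range R).filter fun u => tag u ≠ 1).image Y := by
    intro i hi
    rw [Finset.mem_range] at hi
    obtain ⟨j, hj, ht, he⟩ := h.parent i (by omega)
    simp only [Finset.mem_union, Finset.mem_image, Finset.mem_filter, Finset.mem_range]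
    exact he.imp (fun e => ⟨j, ⟨hj, ht⟩, e⟩) fun e => ⟨j, ⟨hj, ht⟩, e⟩
  have h1 := (Finset.card_le_card hsub).trans (Finset.card_union_le _ _)
  have h2 := Finset.card_image_le (s := (Finset.range R).filter fun u => tag u ≠ 1) (f := X)
  have h3 := Finset.card_image_le (s := (Finset.range R).filter fun u => tag u ≠ 1) (f := Y)
  rw [Finset.card_range] at h1
  unfold binNodes
  omega

/-- Numbers the gates that are reachable from the gate in register `2` in topological order. -/
def dfsCode : Prog :=
  .seq (block [.put 1 0 2, .imm 1 1, .imm 9 1]) <|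
  .loop (ATest.pos 1).code <|
    .seq (block [.op .sub 3 1 9, .get 2 1 3, .inp 4 0 2, .inp 5 1 2, .inp 6 2 2]) <|
    .ite (ATest.eq 4 9).code (block [.put 2 0 4, .put 3 0 5, .op .add 0 0 9, .put 0 2 0, .mov 1 3]) <|
    .seq (block [.get 7 0 5, .get 8 0 6]) <|
    .ite (ATest.zero 7).code (block [.put 1 1 5, .op .add 1 1 9]) <|
    .ite (ATest.zero 8).code (block [.put 1 1 6, .op .add 1 1 9]) <|
    block [.put 2 0 4, .op .sub 5 7 9, .op .sub 6 8 9, .put 3 0 5, .put 4 0 6, .op .add 0 0 9,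
      .put 0 2 0, .mov 1 3]

theorem WP.dfsCode {E : Env} {k : ℕ} {num : ℕ → ℕ} (hD : E.IsDag k num) {Q : ℕ → AState → Prop}
    {σ : AState} (r0 : σ.reg 0 = 0) (r2 : σ.reg 2 < E.m) (f0 : σ.fld 0 = fun _ => 0)
    (hQ : ∀ t σ' R ord, t ≤ 200 * R + 100 → σ'.reg 0 = R → σ'.out = σ.out →
      (∀ f, 5 ≤ f → σ'.fld f = σ.fld f) → Dfs E num (σ.reg 2) (σ'.fld 0) (σ'.fld 2) (σ'.fld 3)
        (σ'.fld 4) [] R ord → Q t σ') : WP E dfsCode Q σ := by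
  have hb := E.bound
  refine WP.seq (WP.block ?_ ?_)
  · simp [BlockOk, Instr.Ok, Instr.step, r0]; omega
  -- Each iteration increases `2 * n + S.length` by one: it pushes a gate, or it pops one and
  -- numbers it. By `Dfs.card_le` this quantity stays at most `2 * E.m`.
  refine WP.loop (fun d time σ' => ∃ S n ord, d = 2 * E.m - (2 * n + S.length) ∧
    time + 100 ≤ 100 * (2 * n + S.length) ∧ σ'.reg 0 = n ∧ σ'.reg 1 = S.length ∧ σ'.reg 9 = 1 ∧
    σ'.out = σ.out ∧ (∀ f, 5 ≤ f → σ'.fld f = σ.fld f) ∧ Stk (σ'.fld 1) S ∧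
    Dfs E num (σ.reg 2) (σ'.fld 0) (σ'.fld 2) (σ'.fld 3) (σ'.fld 4) S n ord)
    ⟨[σ.reg 2], 0, fun _ => 0, rfl, by simp, ?_⟩ ?_ ?_
  · simp [blockStep, Instr.step, r0, f0, Stk]
    refine ⟨fun f hf => ?_, Dfs.init r2⟩
    rw [Function.update_of_ne (by omega)]
  · rintro d time σ' P ⟨S, n, ord, rfl, htime, s0, s1, s9, hout, hfr, hst, hI⟩ hlt hP
    simp only [ATest.Holds, s1] at hlt
    obtain ⟨g, S, rfl⟩ := List.exists_cons_of_length_pos hlt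
    have hcard := hI.card_le
    have hg := hI.lt g (by simp)
    simp only [List.length_cons] at *
    refine WP.seq (WP.block ?_ ?_)
    · simp [BlockOk, Instr.Ok, Instr.step, Op.eval, s1, s9, hst.1, hg]; omega
    have e1 : E.inp (2 + 3 * g) = E.tg g := rfl
    have e2 : E.inp (2 + 3 * g + 1) = E.fst g := rfl
    have e3 : E.inp (2 + 3 * g + 2) = E.snd g := rfl
    simp [blockStep, Instr.step, Op.eval, s1, s9, hst.1, e1, e2, e3]
    refine WP.ite (fun hz => WP.block ?_ (hP _ _ ⟨2 * E.m - (2 * (n + 1) + S.length), by omega, S,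
      n + 1, Function.update ord n g, rfl, ?_⟩)) fun hz => ?_
    · simp [BlockOk, Instr.Ok, Instr.step, Op.eval, s0, s9, hg]; omega
    · simp [ATest.Holds, s9] at hz
      simp [blockCost, Instr.cost, blockStep, Instr.step, Op.eval, s0, s9]
      refine ⟨by omega, hout, fun f hf => ?_, hst.2, hI.finish ?_ ?_ (fun _ _ => rfl) ?_⟩
      · simp only [Function.update_apply]
        repeat rw [if_neg (by omega)]
        exact hfr f hf
      · intro i hi
        rw [Function.update_of_ne (by omega)]
      · intro i hi
        rw [Function.update_of_ne (by omega)]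
      · simp [IsCopy, hz]
    · simp [ATest.Holds, s9] at hz
      obtain ⟨ht, hx, hy, hn⟩ := hD.binary hg hz
      refine WP.seq (WP.block ?_ ?_)
      · simp [BlockOk, Instr.Ok, Instr.step, hx, hy]
      simp [blockStep, Instr.step]
      refine WP.ite (fun hz1 => ?_) fun hz1 => WP.ite (fun hz2 => ?_) fun hz2 => ?_
      · simp [ATest.Holds] at hz1
        have hI' := hI.push hz (.inl rfl) hx (by omega) hz1
        have := hI'.card_le
        simp only [List.length_cons] at this
        refine WP.block ?_ (hP _ _ ⟨2 * E.m - (2 * n + (S.length + 2)), by omega, E.fst g :: g :: S, n, ord,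
          rfl, ?_⟩)
        · simp [BlockOk, Instr.Ok, Instr.step, Op.eval, s0, s1, s9]; omega
        · simp [blockCost, Instr.cost, blockStep, Instr.step, Op.eval, s0, s1, s9]
          refine ⟨by omega, hout, fun f hf => ?_, ⟨by simp, hst.update (by simp) _⟩, hI'⟩
          rw [Function.update_of_ne (by omega)]
          exact hfr f hf
      · simp [ATest.Holds] at hz2
        have hI' := hI.push hz (.inr rfl) hy (by omega) hz2
        have := hI'.card_le
        simp only [List.length_cons] at this
        refine WP.block ?_ (hP _ _ ⟨2 * E.m - (2 * n + (S.length + 2)), by omega, E.snd g :: g :: S, n, ord,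
          rfl, ?_⟩)
        · simp [BlockOk, Instr.Ok, Instr.step, Op.eval, s0, s1, s9]; omega
        · simp [blockCost, Instr.cost, blockStep, Instr.step, Op.eval, s0, s1, s9]
          refine ⟨by omega, hout, fun f hf => ?_, ⟨by simp, hst.update (by simp) _⟩, hI'⟩
          rw [Function.update_of_ne (by omega)]
          exact hfr f hf
      · simp [ATest.Holds] at hz1 hz2
        obtain ⟨p1, p2⟩ := hI.ord_pos _ hz1
        obtain ⟨p3, p4⟩ := hI.ord_pos _ hz2
        refine WP.block ?_ (hP _ _ ⟨2 * E.m - (2 * (n + 1) + S.length), by omega, S,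
          n + 1, Function.update ord n g, rfl, ?_⟩)
        · simp [BlockOk, Instr.Ok, Instr.step, Op.eval, s0, s9, hg]; omega
        · simp [blockCost, Instr.cost, blockStep, Instr.step, Op.eval, s0, s9]
          refine ⟨by omega, hout, fun f hf => ?_, hst.2, hI.finish ?_ ?_ ?_ ?_⟩
          · simp only [Function.update_apply]
            repeat rw [if_neg (by omega)]
            exact hfr f hf
          · intro i hi
            rw [Function.update_of_ne (by omega)]
          · intro i hi
            rw [Function.update_of_ne (by omega)]
          · intro i hi
            rw [Function.update_of_ne (by omega)]
          · simp [IsCopy, hz]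
            rw [Function.update_of_ne (by omega), Function.update_of_ne (by omega), p2, p4]
            exact ⟨by omega, rfl, by omega, rfl⟩
  · rintro d time σ' ⟨S, n, ord, rfl, htime, s0, s1, s9, hout, hfr, hst, hI⟩ hlt
    simp only [ATest.Holds, s1, not_lt, Nat.le_zero, List.length_eq_zero_iff] at hlt
    subst hlt
    simp only [List.length_nil] at htime
    exact hQ _ _ n ord (by simp [blockCost, Instr.cost]; omega) s0 hout hfr hI

/-! ### Circuits given by lists of gates -/

/-- The entry `e` describes the gate `g`, whose arguments are smaller than `i`. -/
def IsGate {k n : ℕ} (e : ℕ × ℕ × ℕ) (i : ℕ) : Gate k n → Prop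
  | .const c => e = (1, c.1, 0)
  | .add x y => e = (2, x.1, y.1) ∧ x.1 < i ∧ y.1 < i
  | .mul x y => e = (3, x.1, y.1) ∧ x.1 < i ∧ y.1 < i

/-- Arguments have smaller numbers than the gates they feed, so the numbering itself excludes
cycles. -/
theorem WfGates.exists_circuit {k : ℕ} {L : List (ℕ × ℕ × ℕ)} (h : WfGates k L)
    {g : ℕ} (hg : g < L.length) : ∃ H : Circuit k, ∃ hn : H.numGates = L.length, H.out.1 = g ∧
      ∀ i : Fin H.numGates, IsGate (L[i.1]'(hn ▸ i.2)) i.1 (H.gate i) := by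
  have hgate : ∀ i : Fin L.length, ∃ G : Gate k L.length, IsGate L[i.1] i.1 G := by
    intro i
    rcases hL : L[i.1] with ⟨t, x, y⟩
    have := i.2
    rcases h i t x y (by rw [← hL]; exact List.getElem?_eq_getElem i.2) with
      ⟨rfl, hx, rfl⟩ | ⟨rfl | rfl, hx, hy⟩
    · exact ⟨.const ⟨x, hx⟩, rfl⟩
    · exact ⟨.add ⟨x, by omega⟩ ⟨y, by omega⟩, rfl, hx, hy⟩
    · exact ⟨.mul ⟨x, by omega⟩ ⟨y, by omega⟩, rfl, hx, hy⟩
  choose gate hgate using hgate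
  have hlt : ∀ y z, y ∈ (gate z).inputs → y.1 < z.1 := by
    intro y z hy
    have := hgate z
    rcases e : gate z with c | ⟨u, v⟩ | ⟨u, v⟩ <;> rw [e] at this hy <;>
      simp [Gate.inputs] at hy
    · rcases hy with rfl | rfl
      · exact this.2.1
      · exact this.2.2
    · rcases hy with rfl | rfl
      · exact this.2.1
      · exact this.2.2
  refine ⟨⟨L.length, gate, ⟨g, hg⟩, fun x hx => ?_⟩, rfl, rfl, hgate⟩
  have : ∀ {y z}, Relation.TransGen (fun y z => y ∈ (gate z).inputs) y z → y.1 < z.1 := by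
    intro y z hyz
    induction hyz with
    | single h => exact hlt _ _ h
    | tail _ h ih => exact ih.trans (hlt _ _ h)
  exact lt_irrefl _ (this hx)

section

variable {k : ℕ} {H : Circuit k} {L : List (ℕ × ℕ × ℕ)} (hn : H.numGates = L.length)
  (hH : ∀ i : Fin H.numGates, IsGate (L[i.1]'(hn ▸ i.2)) i.1 (H.gate i))

include hH

theorem Den.unfoldAt {A : Type*} [Add A] [Mul A] {a : Fin k → A} {g d : ℕ} {u : A}
    (h : Den a L g u d) (hg : g < H.numGates) :
    (H.unfoldAt ⟨g, hg⟩).eval a = u ∧ (H.unfoldAt ⟨g, hg⟩).depth ≤ d := by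
  induction h with
  | @const g c d hc h =>
    have h1 := hH ⟨g, hg⟩
    rw [List.getElem?_eq_getElem (hn ▸ hg), Option.some_inj] at h
    rw [Circuit.unfoldAt_eq]
    rcases e : H.gate ⟨g, hg⟩ with c | ⟨x, y⟩ | ⟨x, y⟩ <;>
      simp [e, h, IsGate] at h1 ⊢
    subst h1
    simp [ArithTree.eval, ArithTree.depth]
  | @add g x y d u v h _ _ ih1 ih2 =>
    have h1 := hH ⟨g, hg⟩
    rw [List.getElem?_eq_getElem (hn ▸ hg), Option.some_inj] at h
    rw [Circuit.unfoldAt_eq]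
    rcases e : H.gate ⟨g, hg⟩ with c | ⟨x, y⟩ | ⟨x, y⟩ <;>
      simp [e, h, IsGate] at h1 ⊢
    obtain ⟨⟨rfl, rfl⟩, -⟩ := h1
    have i1 := ih1 x.2
    have i2 := ih2 y.2
    simp only [ArithTree.eval, ArithTree.depth, Fin.eta] at *
    exact ⟨by rw [i1.1, i2.1], by omega⟩
  | @mul g x y d u v h _ _ ih1 ih2 =>
    have h1 := hH ⟨g, hg⟩
    rw [List.getElem?_eq_getElem (hn ▸ hg), Option.some_inj] at h
    rw [Circuit.unfoldAt_eq]
    rcases e : H.gate ⟨g, hg⟩ with c | ⟨x, y⟩ | ⟨x, y⟩ <;>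
      simp [e, h, IsGate] at h1 ⊢
    obtain ⟨⟨rfl, rfl⟩, -⟩ := h1
    have i1 := ih1 x.2
    have i2 := ih2 y.2
    simp only [ArithTree.eval, ArithTree.depth, Fin.eta] at *
    exact ⟨by rw [i1.1, i2.1], by omega⟩

theorem size_eq_binCount : H.size = 2 * binCount L := by
  have h1 : ∀ i : Fin H.numGates, (H.gate i).inputs.length =
      if (L[i.1]'(hn ▸ i.2)).1 ≠ 1 then 2 else 0 := by
    intro i
    have := hH i
    rcases e : H.gate i with c | ⟨x, y⟩ | ⟨x, y⟩ <;> rw [e] at this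
    · rw [show _ = _ from this]; rfl
    · rw [this.1]; rfl
    · rw [this.1]; rfl
  have h2 : H.size = ∑ i : Fin L.length, if L[i.1].1 ≠ 1 then 2 else 0 := by
    rw [Circuit.size, Finset.sum_congr rfl fun i _ => h1 i]
    exact Fintype.sum_equiv (finCongr hn) _ _ fun i => rfl
  rw [h2, Fin.sum_univ_fun_getElem L fun e => if e.1 ≠ 1 then 2 else 0]
  clear h1 h2 hH hn
  induction L with
  | nil => rfl
  | cons e L ih =>
    rw [List.map_cons, List.sum_cons, ih, binCount, binCount, List.countP_cons]
    split_ifs <;> simp_all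
    omega

end

/-! ### The whole program -/

/-- Computes the balanced circuit from the circuit whose output gate is in register `2`, and puts
the number of the new output gate into register `2`. -/
def balanceCode : Prog :=
  .seq dfsCode <| .seq botCode <| .seq topCode <| .seq kindCode <| .seq mainCode <|
    block [.imm 9 1, .op .sub 1 0 9, .get 2 16 1]

section

variable {A : Type*} [AddCommSemigroup A] [Semigroup A] [LeftDistribClass A] [RightDistribClass A]
  {k R : ℕ} {a : Fin k → A} {tag X Y bot T S : ℕ → ℕ} {v : ℕ → A} {B : Arr}

/-- At the root `T = 1`, so the budget is `2 * 69` times the logarithm. The path through the root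
adds at most `3 * 6 = 18`, which is absorbed because the logarithm is positive whenever there is a
heavy argument; for `n = 1` the bound is `0`. -/
theorem Setup.root_depth (h : Setup k R tag X Y bot T S) {L : List (ℕ × ℕ × ℕ)}
    (hN : NodeInv R a tag X Y bot T S v B L (R - 1)) :
    DenO a L (B.sv (R - 1)) (some (v (R - 1))) (156 * Nat.log 2 (bot (R - 1))) := by
  have hR := h.slp.pos
  have hi : R - 1 < R := by omega
  obtain ⟨D, h1, h2⟩ := hN.value
  refine h1.mono List.prefix_rfl ?_
  have hT := h.top.root
  have hb : budget R bot T (R - 1) = 138 * Nat.log 2 (bot (R - 1)) := by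
    rw [budget, hT]
    simp
    ring
  rw [hb] at h2
  by_cases hk : kind tag X Y bot T (R - 1) = 0
  · rw [(hN.base hk).1] at h2
    omega
  · obtain ⟨-, -, -, -, -, hkey, -⟩ := hN.block hk
    -- The last node is nobody's argument, so no heavy edge enters it and its block has weight at
    -- least `pw (bot (R - 1))`.
    have hS : S (R - 1) = 0 := by
      rcases h.hvy _ hi with ⟨u, hu, hku, he, -⟩ | h
      · have := (heavy_lt h.slp hu hku).1
        omega
      · exact h.1
    rw [hT, hS] at hkey
    have h3 := h.lam_top8 hi
    rw [hT] at h3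
    have h4 : 2 * Nat.log 2 (bot (R - 1)) ≤ lam (B.key (R - 1)) := by
      apply le_lam
      rw [← pw_eq (h.slp.bot_pos hi)]
      omega
    obtain ⟨l1, l2, l3⟩ := heavy_lt h.slp hi hk
    have h5 := h.slp.bot_pos (l1.trans hi)
    have h6 := Nat.log_pos (b := 2) (by norm_num) (show 2 ≤ bot (R - 1) by omega)
    simp at h3
    omega

theorem WP.balanceCode {E : Env} {num : ℕ → ℕ} {val : ℕ → A} (hD : E.IsDag k num)
    (hV : Vals a E.m E.tg E.fst E.snd val) {Q : ℕ → AState → Prop} {σ : AState} (r0 : σ.reg 0 = 0)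
    (r2 : σ.reg 2 < E.m) (hn : 1000 * num (σ.reg 2) ≤ 2 ^ E.w) (hf : σ.fld = fun _ _ => 0)
    (hout : σ.out = [])
    (hQ : ∀ t σ', t ≤ 5000 * (binNodes E.tg E.m + 1) → WfGates k σ'.out →
      binCount σ'.out ≤ 13 * binNodes E.tg E.m →
      Den a σ'.out (σ'.reg 2) (val (σ.reg 2)) (156 * Nat.log 2 (num (σ.reg 2))) → Q t σ') :
    WP E balanceCode Q σ := by
  have hb := E.bound
  refine WP.seq (WP.dfsCode hD r0 r2 (by rw [hf]) fun t1 σ1 R ord ht1 q0 qout qf hI => ?_)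
  have hS := hI.slp hD
  have hVals := hI.vals hV
  have hR : R ≤ E.m := by simpa using hI.card_le
  have hbin := hI.binNodes_le
  have hR' := hS.le_binNodes
  have hroot := hI.ord_last.2
  have hR0 := hS.pos
  have hn' : 1000 * num (ord (R - 1)) ≤ 2 ^ E.w := by rw [hroot]; exact hn
  -- The later phases rely on the initial zeros in the arrays that the search does not touch.
  have hz : ∀ f, 5 ≤ f → ∀ i, σ1.fld f i = 0 := fun f h5 i => by rw [qf f h5, hf]
  refine WP.seq (WP.botCode hS hR hn' q0 rfl rfl rfl fun t2 σ2 ht2 u0 uout uf u5 u6 => ?_)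
  have u2 := uf 2 (by decide) (by decide)
  have u3 := uf 3 (by decide) (by decide)
  have u4 := uf 4 (by decide) (by decide)
  refine WP.seq (WP.topCode hS hR hn' u0 u2 u3 u4
    (fun i _ => by rw [uf 7 (by decide) (by decide)]; exact hz 7 (by decide) i)
    (fun i _ => by rw [uf 8 (by decide) (by decide)]; exact hz 8 (by decide) i)
    fun t3 σ3 ht3 v0 vout vf hT v8 => ?_)
  have v2 := (vf 2 (by decide) (by decide)).trans u2
  have v3 := (vf 3 (by decide) (by decide)).trans u3
  have v4 := (vf 4 (by decide) (by decide)).trans u4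
  have v6 : ∀ i < R, σ3.fld 6 i = pw (num (ord i)) := by
    rw [vf 6 (by decide) (by decide)]
    exact u6
  refine WP.seq (WP.kindCode hS hT hR hn' v0 v2 v3 v4 rfl v6 v8
    (fun i _ => by rw [vf 9 (by decide) (by decide), uf 9 (by decide) (by decide)]
                   exact hz 9 (by decide) i)
    (fun i _ => by rw [vf 10 (by decide) (by decide), uf 10 (by decide) (by decide)]
                   exact hz 10 (by decide) i)
    fun t4 σ4 ht4 w0 wout wf w10 hH => ?_)
  have hSet : Setup k R (σ1.fld 2) (σ1.fld 3) (σ1.fld 4) (fun i => num (ord i)) (σ3.fld 7)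
    (σ4.fld 9) := ⟨hS, hT, hH⟩
  refine WP.seq (WP.mainCode hSet hVals hR hn' ?_ w0 (by rw [wout, vout, uout, qout, hout])
    fun t5 σ5 B ht5 x0 hF hN hW hcnt hlen => WP.block ?_ (hQ _ _ ?_ ?_ ?_ ?_))
  · constructor
    · exact (wf 2 (by decide) (by decide)).trans v2
    · exact (wf 3 (by decide) (by decide)).trans v3
    · exact (wf 4 (by decide) (by decide)).trans v4
    · intro i hi
      rw [wf 5 (by decide) (by decide), vf 5 (by decide) (by decide)]
      exact u5 i hi
    · rw [wf 6 (by decide) (by decide)]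
      exact v6
    · exact wf 7 (by decide) (by decide)
    · rw [wf 8 (by decide) (by decide)]
      exact v8
    · rfl
    · exact w10
  · simp [BlockOk, Instr.Ok, Instr.step, Op.eval, x0]; omega
  · simp [blockCost, Instr.cost]; omega
  · exact hW
  · exact hcnt.trans (Nat.mul_le_mul_left _ hbin)
  · have := (hSet.root_depth hN).2
    rw [hroot] at this
    simpa [blockStep, Instr.step, Op.eval, x0, hF.sv (R - 1) (by omega)] using this

end

/-- Reads the header of the input and computes the base addresses. -/
def loadCode : Prog :=
  .seq (.load 7 0) <| .seq (.imm 1 1) <| .seq (.load 10 1) <|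
  .seq (.imm 1 3) <| .seq (.op .mul 3 1 7) <| .seq (.imm 1 2) <| .seq (.op .add 3 1 3) <|
  .seq (.imm 1 20) <| .seq (.op .mul 4 1 7) <| .seq (.imm 1 4) (.op .add 4 1 4)

/-- Writes the header of the output. -/
def storeCode : Prog :=
  .seq (.imm 1 1) <| .seq (.op .sub 4 4 1) <| .seq (.store 4 10) <| .seq (.op .sub 4 4 1) <|
  .seq (.store 4 5) <| .seq (.imm 1 0) (.op .add 0 4 1)

/-- Computes a balanced circuit. -/
def program : Prog := .seq loadCode (.seq balanceCode storeCode)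

theorem exec_loadCode (E : Env) {s : State} (hm : s.mem 0 = E.m) (hreg : ∀ i, s.reg i = 0)
    (hinp : ∀ a < 2 + 3 * E.m, s.mem a = E.inp a) (hmem : ∀ i, 2 + 3 * E.m ≤ i → s.mem i = 0) :
    ∃ t s', t ≤ 20 ∧ Exec E.w loadCode s t s' ∧
      Rel E s' ⟨Function.update (fun _ => 0) 2 (E.inp 1), fun _ _ => 0, []⟩ := by
  have hb := E.bound
  refine ⟨_, _, ?_, Exec.seq (Exec.load _ _ _) (Exec.seq (Exec.imm _ _ _ ?_)
    (Exec.seq (Exec.load _ _ _) (Exec.seq (Exec.imm _ _ _ ?_) (Exec.seq (Exec.op _ _ _ _ _ ?_)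
    (Exec.seq (Exec.imm _ _ _ ?_) (Exec.seq (Exec.op _ _ _ _ _ ?_) (Exec.seq (Exec.imm _ _ _ ?_)
    (Exec.seq (Exec.op _ _ _ _ _ ?_) (Exec.seq (Exec.imm _ _ _ ?_)
    (Exec.op _ _ _ _ _ ?_)))))))))), ?_⟩
  · omega
  any_goals simp [Op.eval, hreg, hm]
  any_goals omega
  have h1 := hinp 1 (by omega)
  constructor <;> simp [Op.eval, Function.update_apply, hreg, hm, h1]
  · exact hinp
  · intro f hf i hi
    exact hmem _ (by omega)

/-- The header goes into the two free cells just before the emitted gates, so the gate list need not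
be moved. -/
theorem exec_storeCode {E : Env} {s : State} {σ : AState} (h : Rel E s σ) :
    ∃ t s', t ≤ 10 ∧ Exec E.w storeCode s t s' ∧ s'.reg 0 = 2 + 20 * E.m ∧
      s'.mem (2 + 20 * E.m) = σ.out.length ∧ s'.mem (2 + 20 * E.m + 1) = σ.reg 2 ∧
      ∀ j t x y, σ.out[j]? = some (t, x, y) → s'.mem (2 + 20 * E.m + 2 + 3 * j) = t ∧
        s'.mem (2 + 20 * E.m + 2 + 3 * j + 1) = x ∧ s'.mem (2 + 20 * E.m + 2 + 3 * j + 2) = y := by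
  have hb := E.bound
  have h4 := h.obase
  have h10 := h.reg 2
  have h5 := h.cnt
  refine ⟨_, _, ?_, Exec.seq (Exec.imm _ _ _ ?_) (Exec.seq (Exec.op _ _ _ _ _ ?_)
    (Exec.seq (Exec.store _ _ _) (Exec.seq (Exec.op _ _ _ _ _ ?_) (Exec.seq (Exec.store _ _ _)
    (Exec.seq (Exec.imm _ _ _ ?_) (Exec.op _ _ _ _ _ ?_)))))), ?_, ?_, ?_, ?_⟩
  · omega
  any_goals simp [Op.eval, Function.update_apply, h4, h5]
  any_goals omega
  · simp at h10
    rw [if_pos (by omega), h10]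
  · intro j t x y hj
    obtain ⟨h6, h7, h8⟩ := h.out j t x y hj
    rw [show 2 + 20 * E.m + 2 + 3 * j = 4 + 20 * E.m + 3 * j by ring]
    rw [if_neg (by omega), if_neg (by omega), if_neg (by omega), if_neg (by omega),
      if_neg (by omega), if_neg (by omega)]
    exact ⟨h6, h7, h8⟩

end RAM

/-! ### The input circuit as seen by the machine. -/

section

variable {k : ℕ} (G : Circuit k)

open RAM

/-- The number of nodes of the unfolding at the gate `g`. -/
noncomputable def Circuit.numAt (g : ℕ) : ℕ :=
  if h : g < G.numGates then (G.unfoldAt ⟨g, h⟩).numNodes else 0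

/-- The value of the gate `g`. -/
noncomputable def Circuit.valAt {A : Type*} [Add A] [Mul A] (a : Fin k → A) (g : ℕ) : A :=
  if h : g < G.numGates then (G.unfoldAt ⟨g, h⟩).eval a else G.value a

variable {G} {E : Env} (hm : E.m = G.numGates) (hG : G.StoredAt E.inp 0)

include hm hG

theorem Circuit.StoredAt.cases {g : ℕ} (hg : g < G.numGates) :
    (∃ c, G.gate ⟨g, hg⟩ = .const c ∧ E.tg g = 1 ∧ E.fst g = c) ∨
    (∃ x y, G.gate ⟨g, hg⟩ = .add x y ∧ E.tg g = 2 ∧ E.fst g = x ∧ E.snd g = y) ∨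
    ∃ x y, G.gate ⟨g, hg⟩ = .mul x y ∧ E.tg g = 3 ∧ E.fst g = x ∧ E.snd g = y := by
  have h := hG.2.2 ⟨g, hg⟩
  simp only [Nat.zero_add] at h
  rcases e : G.gate ⟨g, hg⟩ with c | ⟨x, y⟩ | ⟨x, y⟩ <;> rw [e] at h
  · exact .inl ⟨c, rfl, h.1, h.2.1⟩
  · exact .inr (.inl ⟨x, y, rfl, h⟩)
  · exact .inr (.inr ⟨x, y, rfl, h⟩)

theorem Circuit.StoredAt.isDag : E.IsDag k G.numAt := by
  intro g hg
  rw [hm] at hg ⊢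
  rw [Circuit.numAt, dif_pos hg, Circuit.unfoldAt_eq]
  rcases hG.cases hm hg with ⟨c, e, h1, h2⟩ | ⟨x, y, e, h1, h2, h3⟩ | ⟨x, y, e, h1, h2, h3⟩
  · exact .inl ⟨h1, h2 ▸ c.2, by rw [e]; rfl⟩
  all_goals
    refine .inr ⟨by simp [h1], h2 ▸ x.2, h3 ▸ y.2, ?_⟩
    simp [e, h2, h3, Circuit.numAt, ArithTree.numNodes]

theorem Circuit.StoredAt.vals {A : Type*} [Add A] [Mul A] (a : Fin k → A) :
    Vals a E.m E.tg E.fst E.snd (G.valAt a) := by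
  rw [hm]
  constructor <;> intro g hg ht <;>
    rw [Circuit.valAt, dif_pos hg, Circuit.unfoldAt_eq] <;>
    rcases hG.cases hm hg with ⟨c, e, h1, h2⟩ | ⟨x, y, e, h1, h2, h3⟩ | ⟨x, y, e, h1, h2, h3⟩ <;>
    rw [ht] at h1 <;> simp at h1
  · simp [e, h2, ArithTree.eval]
  all_goals simp [e, h2, h3, Circuit.valAt, ArithTree.eval]

theorem Circuit.StoredAt.size_eq : G.size = 2 * binNodes E.tg E.m := by
  have h : ∀ i : Fin G.numGates, (G.gate i).inputs.length = if E.tg i ≠ 1 then 2 else 0 := by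
    intro i
    rcases hG.cases hm i.2 with ⟨c, e, h1, h2⟩ | ⟨x, y, e, h1, h2, h3⟩ | ⟨x, y, e, h1, h2, h3⟩ <;>
      rw [e, h1] <;> rfl
  rw [Circuit.size, Finset.sum_congr rfl fun i _ => h i,
    Fin.sum_univ_eq_sum_range (fun i => if E.tg i ≠ 1 then 2 else 0), binNodes, Finset.card_filter,
    Finset.mul_sum, hm]
  exact Finset.sum_congr rfl fun i _ => by split_ifs <;> rfl

end

open RAM in
theorem mainTheorem10 :
    ∃ (P : RAM.Prog) (C : ℕ),
      ∀ (A : Type*) [AddCommSemigroup A] [Semigroup A] [LeftDistribClass A] [RightDistribClass A]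
        (k : ℕ) (a : Fin k → A) (G : Circuit k) (w : ℕ) (s : RAM.State),
        C * (G.unfolding.numNodes + G.numGates + k) ≤ 2 ^ w →
        s.IsInitial G →
        ∃ (t : ℕ) (s' : RAM.State) (H : Circuit k),
          RAM.Exec w P s t s' ∧ s'.Outputs H ∧
          t ≤ C * (G.size + 1) ∧
          H.value a = G.value a ∧
          H.size ≤ C * G.size ∧
          H.depth ≤ C * Nat.log 2 G.unfolding.numNodes := by
  -- Any large constant works: with `b` binary gates in the input, the time is at most `5000 * (b +
  -- 1) + 30`, the new size at most `26 * b` against `G.size = 2 * b`, and the depth factor is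
  -- `156`.
  refine ⟨program, 10000, fun A _ _ _ _ k a G w s hw ⟨hreg, hG, hmem⟩ => ?_⟩
  have hpos := G.out.2
  let E : Env := ⟨w, G.numGates, s.mem, by omega⟩
  have hm : E.m = G.numGates := rfl
  have hG' : G.StoredAt E.inp 0 := hG
  have ho : E.inp 1 = G.out := by simpa using hG.2.1
  obtain ⟨t1, s1, ht1, hs1, hr1⟩ := exec_loadCode E (s := s) (by simpa using hG.1) hreg
    (fun _ _ => rfl) hmem
  have hnum : G.numAt G.out = G.unfolding.numNodes := by
    rw [Circuit.numAt, dif_pos hpos]; rfl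
  have hval : G.valAt a G.out = G.value a := by
    rw [Circuit.valAt, dif_pos hpos]; rfl
  obtain ⟨t2, s2, σ, hs2, hr2, ht2, hW, hbin, hden⟩ := WP.balanceCode (hG'.isDag hm)
    (hG'.vals hm a) (Q := fun t σ => t ≤ 5000 * (binNodes E.tg E.m + 1) ∧ WfGates k σ.out ∧
      binCount σ.out ≤ 13 * binNodes E.tg E.m ∧
      Den a σ.out (σ.reg 2) (G.value a) (156 * Nat.log 2 G.unfolding.numNodes))
    (σ := ⟨Function.update (fun _ => 0) 2 (E.inp 1), fun _ _ => 0, []⟩) (by simp)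
    (by simp [ho, hm]) (by simp only [Function.update_self, ho, hnum]; exact le_trans (by omega) hw)
    rfl rfl
    (fun t σ h1 h2 h3 h4 => ⟨h1, h2, h3, by
      simpa only [Function.update_self, ho, hnum, hval] using h4⟩) s1 hr1
  obtain ⟨t3, s3, ht3, hs3, h0, hlen, hout, hgates⟩ := exec_storeCode hr2
  obtain ⟨H, hn, hHo, hH⟩ := hW.exists_circuit hden.lt_length
  have hsize := hG'.size_eq hm
  have hd := hden.unfoldAt hn hH (hHo ▸ H.out.2)
  have hHo' : (⟨σ.reg 2, hHo ▸ H.out.2⟩ : Fin H.numGates) = H.out := Fin.ext hHo.symm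
  rw [hHo'] at hd
  refine ⟨_, s3, H, hs1.seq (hs2.seq hs3), ⟨?_, ?_, fun i => ?_⟩, by omega, hd.1, ?_,
    hd.2.trans (Nat.mul_le_mul_right _ (by norm_num))⟩
  · rw [h0, hlen, hn]
  · rw [h0, hout, hHo]
  · have h1 := hH i
    have hg := hgates i.1
    rw [List.getElem?_eq_getElem (hn ▸ i.2)] at hg
    rw [h0]
    rcases e : H.gate i with c | ⟨x, y⟩ | ⟨x, y⟩ <;> rw [e] at h1
    · exact hg _ _ _ (congrArg some h1)
    · exact hg _ _ _ (congrArg some h1.1)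
    · exact hg _ _ _ (congrArg some h1.1)
  · rw [size_eq_binCount hn hH]
    omega
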